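/- **Setting.** Let $\widehat g(p)=(2\pi)^{-3/2}\int_{\mathbb R^3}e^{-ip\cdot x}g(x)\,dx$ be the unitary Fourier transform on $L^2(\mathbb R^3)$, and let $\mathring H=-\Delta$ with domain $\mathcal D(\mathring H)=H^2_0(\mathbb R^3\setminus\{0\})$, the closure of $C_0^\infty(\mathbb R^3\setminus\{0\})$ in the $H^2$-norm. Let $\mathring H^*$ be its adjoint. For $\lambda>0$ and $\tau\in\mathbb R$ let $\mathring H^{(\tau)}$ be the operator whose domain consists of the $g\in L^2(\mathbb R^3)$ of the form $$\widehat g(p)=\widehat f(p)+\frac{\tau\xi}{(p^2+\lambda)^2}+\frac{\xi}{p^2+\lambda},\qquad f\in\mathcal D(\mathring H),\ \xi\in\mathbb C,$$ with action $\big((\mathring H^{(\tau)}+\lambda)g\big)^{\wedge}(p)=(p^2+\lambda)\Big(\widehat f(p)+\frac{\tau\xi}{(p^2+\lambda)^2}\Big)$; let $\mathring H^{(\infty)}=-\Delta$ with domain $H^2(\mathbb R^3)$. For $\alpha\in\mathbb R$ let $\mathring H_{\langle\alpha\rangle}$ be the restriction of $\mathring H^*$ to those $g\in\mathcal D(\mathring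 H^*)$ that satisfy, for some $\xi\in\mathbb C$, the Ter-Martirosyan–Skornyakov (TMS) condition $$\int_{|p|<R}\widehat g(p)\,dp=4\pi\xi\,(R+2\pi^2\alpha)+o(1)\qquad(R\to+\infty),\tag{1}$$ and let $\mathring H_{\langle\infty\rangle}$ be the restriction of $\mathring H^*$ to those $g\in\mathcal D(\mathring H^*)$ for which the term of order $R$ is absent, i.e. $\int_{|p|<R}\widehat g(p)\,dp=c+o(1)$ for some constant $c\in\mathbb C$. An operator $H$ on $L^2(\mathbb R^3)$ has $s$-wave scattering length $a\in\mathbb R\cup\{\infty\}$ if for each $k>0$ there is exactly one $f(k)\in\mathbb C$ for which there exists a spherically symmetric function $\psi$, locally in the domain of $H$ and locally solving $H\psi=k^2\psi$ (for every ball centred at $0$ there is $g\in\mathcal D(H)$ with $g=\psi$ and $Hg=k^2\psi$ a.e. on that ball), with $\psi(x)=\frac{\sin k|x|}{k|x|}+f(k)\frac{e^{ik|x|}}{|x|}+o(|x|^{-1})$ as $|x|\to\infty$, and if $a=-\lim_{k\downarrow0}f(k)$ (a limit in $\mathbb C\cup\{\infty\}$). **Theorem.** 1. Let $\lambda>0$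 and let $g\in\mathcal D(\mathring H^*)$ be decomposed as $\widehat g=\widehat f+(p^2+\lambda)^{-2}\eta+(p^2+\lambda)^{-1}\xi$ with $f\in\mathcal D(\mathring H)$ and $\eta,\xi\in\mathbb C$. For every $\alpha\in\mathbb R$ the following are equivalent: $g\in\mathcal D(\mathring H_{\langle\alpha\rangle})$; (1) holds with this $\xi$; $8\pi^3\alpha\,\xi=-2\pi^2\sqrt\lambda\,\xi+\frac{\pi^2}{\sqrt\lambda}\,\eta$; $\eta=2\sqrt\lambda\,(4\pi\alpha+\sqrt\lambda)\,\xi$. Moreover $g\in\mathcal D(\mathring H_{\langle\infty\rangle})$ if and only if $\xi=0$. 2. For every $\lambda>0$ and $\alpha\in\mathbb R\cup\{\infty\}$ one has $\mathring H_{\langle\alpha\rangle}=\mathring H^{(\tau)}$ (same domain and same action) with $\tau=2\sqrt\lambda\,(4\pi\alpha+\sqrt\lambda)$, where $\tau=\infty$ for $\alpha=\infty$. 3. For every $\alpha\in\mathbb R\cup\{\infty\}$ the operator $\mathring H_{\langle\alpha\rangle}$ has $s$-wave scattering length $-(4\pi\alpha)^{-1}$, which is read as $\infty$ for $\alpha=0$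 and as $0$ for $\alpha=\infty$. 4. An operator $H$ on $L^2(\mathbb R^3)$ is a self-adjoint extension of $\mathring H$ if and only if $H=\mathring H_{\langle\alpha\rangle}$ for some $\alpha\in\mathbb R\cup\{\infty\}$. -/

import Mathlib

open MeasureTheory Filter Topology
open scoped ENNReal ContDiff FourierTransform

noncomputable section

namespace PointInteraction

/-- The configuration space `ℝ³` of the relative variable. -/
abbrev R3 : Type := EuclideanSpace ℝ (Fin 3)

/-- The Hilbert space `L²(ℝ³)`. -/
abbrev L2 : Type := Lp ℂ 2 (volume : Measure R3)

/-- The unitary Fourier transform in angular momentum `p`,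
`ĝ(p) = (2π)^(-3/2) ∫ exp(-i p·x) g(x) dx`, expressed through Mathlib's
`L²`-transform `𝓕 g (w) = ∫ exp(-2π i w·x) g(x) dx`. -/
def hat (g : L2) (p : R3) : ℂ :=
  (((2 * Real.pi) ^ (-(3 / 2 : ℝ)) : ℝ) : ℂ) * (𝓕 g : L2) ((2 * Real.pi)⁻¹ • p)

theorem two_pi_inv_ne : ((2 * Real.pi)⁻¹ : ℝ) ≠ 0 := by positivity

theorem ae_scale {P : R3 → Prop} (h : ∀ᵐ p : R3, P p) :
    ∀ᵐ p : R3, P ((2 * Real.pi)⁻¹ • p) :=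
  (Measure.quasiMeasurePreserving_smul (volume : Measure R3) two_pi_inv_ne).ae h

theorem hat_add (f g : L2) : ∀ᵐ p : R3, hat (f + g) p = hat f p + hat g p := by
  have h := Lp.coeFn_add (𝓕 f : L2) (𝓕 g : L2)
  filter_upwards [ae_scale h] with p hp
  unfold hat
  rw [FourierTransform.fourier_add, hp, Pi.add_apply, mul_add]

theorem hat_smul (c : ℂ) (f : L2) : ∀ᵐ p : R3, hat (c • f) p = c * hat f p := by
  have h := Lp.coeFn_smul c (𝓕 f : L2)
  filter_upwards [ae_scale h] with p hp
  unfold hat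
  rw [FourierTransform.fourier_smul, hp, Pi.smul_apply, smul_eq_mul]
  ring

theorem hat_zero : ∀ᵐ p : R3, hat 0 p = 0 := by
  filter_upwards [hat_smul 0 0] with p hp
  simpa using hp

theorem hat_sub (f g : L2) : ∀ᵐ p : R3, hat (f - g) p = hat f p - hat g p := by
  have e : f - g = f + (-1 : ℂ) • g := by simp [sub_eq_add_neg]
  rw [e]
  filter_upwards [hat_add f ((-1 : ℂ) • g), hat_smul (-1) g] with p h1 h2
  rw [h1, h2]; ring

theorem hat_memLp (f : L2) : MemLp (hat f) 2 (volume : Measure R3) := by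
  have h : MemLp (fun p : R3 => (𝓕 f : L2) ((2 * Real.pi)⁻¹ • p)) 2 (volume : Measure R3) := by
    have hm : MemLp ((𝓕 f : L2) : R3 → ℂ) 2
        (Measure.map (fun p : R3 => (2 * Real.pi)⁻¹ • p) volume) := by
      rw [Measure.map_addHaar_smul (volume : Measure R3) two_pi_inv_ne]
      exact (Lp.memLp (𝓕 f : L2)).smul_measure ENNReal.ofReal_ne_top
    exact hm.comp_of_map (measurable_const_smul _).aemeasurable
  exact h.const_mul _

theorem hat_integrableOn_ball (f : L2) (R : ℝ) :
    IntegrableOn (hat f) (Metric.ball (0 : R3) R) := by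
  have : IsFiniteMeasure ((volume : Measure R3).restrict (Metric.ball (0 : R3) R)) :=
    ⟨by rw [Measure.restrict_apply_univ]; exact measure_ball_lt_top⟩
  exact ((hat_memLp f).restrict _).integrable (by norm_num)

/-! ### The free Laplacian and the Hamiltonian away from the origin -/

/-- The graph of `-Δ` on `L²(ℝ³)` in Fourier space: pairs with `ĥ(p) = p² f̂(p)`. -/
def freeGraph : Submodule ℂ (L2 × L2) where
  carrier := {x | ∀ᵐ p : R3, hat x.2 p = (‖p‖ ^ 2 : ℝ) * hat x.1 p}
  add_mem' := by
    intro x y hx hy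
    filter_upwards [hx, hy, hat_add x.1 y.1, hat_add x.2 y.2] with p h1 h2 h3 h4
    rw [Prod.fst_add, Prod.snd_add, h3, h4, h1, h2]; ring
  zero_mem' := by
    filter_upwards [hat_zero] with p h
    simp [h]
  smul_mem' := by
    intro c x hx
    filter_upwards [hx, hat_smul c x.1, hat_smul c x.2] with p h1 h2 h3
    rw [Prod.smul_fst, Prod.smul_snd, h2, h3, h1]; ring

/-- The free Hamiltonian `-Δ` with domain `H²(ℝ³)`. -/
def freeHamiltonian : L2 →ₗ.[ℂ] L2 := freeGraph.toLinearPMap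

/-- The `H²`-norm `‖(1 + p²) f̂‖₂`, with values in `[0, ∞]`. -/
def sobolevNorm (f : L2) : ℝ≥0∞ :=
  eLpNorm (fun p : R3 => ((1 + ‖p‖ ^ 2 : ℝ) : ℂ) * hat f p) 2 volume

/-- `f` is (the class of) a smooth function with compact support in `ℝ³ ∖ {0}`. -/
def IsTestFunction (f : L2) : Prop :=
  ∃ φ : R3 → ℂ, ContDiff ℝ ∞ φ ∧ HasCompactSupport φ ∧ (0 : R3) ∉ tsupport φ ∧
    (f : R3 → ℂ) =ᵐ[volume] φ

theorem IsTestFunction.add {f g : L2} (hf : IsTestFunction f) (hg : IsTestFunction g) :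
    IsTestFunction (f + g) := by
  obtain ⟨φ, h1, h2, h3, h4⟩ := hf
  obtain ⟨ψ, k1, k2, k3, k4⟩ := hg
  refine ⟨φ + ψ, h1.add k1, h2.add k2, fun h => ?_, ?_⟩
  · exact (tsupport_add φ ψ h).elim h3 k3
  · filter_upwards [Lp.coeFn_add f g, h4, k4] with x e1 e2 e3
    rw [e1, Pi.add_apply, Pi.add_apply, e2, e3]

theorem IsTestFunction.smul {f : L2} (c : ℂ) (hf : IsTestFunction f) :
    IsTestFunction (c • f) := by
  obtain ⟨φ, h1, h2, h3, h4⟩ := hf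
  refine ⟨fun x => c • φ x, h1.const_smul c, h2.smul_left (f := fun _ => c), fun h => ?_, ?_⟩
  · exact h3 (tsupport_smul_subset_right (fun _ => c) φ h)
  · filter_upwards [Lp.coeFn_smul c f, h4] with x e1 e2
    rw [e1, Pi.smul_apply, e2]

theorem sobolevNorm_add_le (f g : L2) : sobolevNorm (f + g) ≤ sobolevNorm f + sobolevNorm g := by
  have hw : ∀ f : L2, AEStronglyMeasurable
      (fun p : R3 => ((1 + ‖p‖ ^ 2 : ℝ) : ℂ) * hat f p) volume := fun f =>
    (Continuous.aestronglyMeasurable (by fun_prop)).mul (hat_memLp f).1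
  refine le_trans (le_of_eq ?_) (eLpNorm_add_le (hw f) (hw g) (by norm_num))
  refine eLpNorm_congr_ae ?_
  filter_upwards [hat_add f g] with p hp
  rw [hp, Pi.add_apply, mul_add]

theorem sobolevNorm_smul (c : ℂ) (f : L2) : sobolevNorm (c • f) = ‖c‖ₑ * sobolevNorm f := by
  unfold sobolevNorm
  rw [← eLpNorm_const_smul]
  refine eLpNorm_congr_ae ?_
  filter_upwards [hat_smul c f] with p hp
  rw [hp, Pi.smul_apply, smul_eq_mul]; ring

/-- `H²₀(ℝ³ ∖ {0})`: the closure of the test functions on `ℝ³ ∖ {0}` in the `H²`-norm. -/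
def H20 : Submodule ℂ L2 where
  carrier := {f | ∀ ε : ℝ≥0∞, 0 < ε → ∃ φ, IsTestFunction φ ∧ sobolevNorm (f - φ) < ε}
  add_mem' := by
    intro f g hf hg ε hε
    obtain ⟨φ, h1, h2⟩ := hf (ε / 2) (ENNReal.half_pos hε.ne')
    obtain ⟨ψ, k1, k2⟩ := hg (ε / 2) (ENNReal.half_pos hε.ne')
    refine ⟨φ + ψ, h1.add k1, ?_⟩
    rw [add_sub_add_comm]
    calc _ ≤ _ := sobolevNorm_add_le _ _
      _ < ε / 2 + ε / 2 := ENNReal.add_lt_add h2 k2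
      _ = ε := ENNReal.add_halves ε
  zero_mem' := by
    intro ε hε
    refine ⟨0, ⟨0, contDiff_const, HasCompactSupport.zero, by simp, Lp.coeFn_zero _ _ _⟩, ?_⟩
    have := sobolevNorm_smul 0 0
    simp only [smul_zero, enorm_zero, zero_mul] at this
    rw [sub_zero, this]
    exact hε
  smul_mem' := by
    intro c f hf ε hε
    obtain ⟨φ, h1, h2⟩ := hf (ε / (‖c‖ₑ + 1)) (ENNReal.div_pos hε.ne' (by simp))
    refine ⟨c • φ, h1.smul c, ?_⟩
    rw [← smul_sub, sobolevNorm_smul]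
    by_cases hc : c = 0
    · simpa [hc] using hε
    · have hc0 : ‖c‖ₑ ≠ 0 := by simpa using hc
      calc _ < ‖c‖ₑ * (ε / (‖c‖ₑ + 1)) := by
            exact (ENNReal.mul_lt_mul_iff_right hc0 (by simp)).2 h2
        _ ≤ (‖c‖ₑ + 1) * (ε / (‖c‖ₑ + 1)) := by gcongr; exact le_self_add
        _ = ε := ENNReal.mul_div_cancel (by simp) (by simp)

/-- The operator `H̊ = -Δ` with domain `H²₀(ℝ³ ∖ {0})`. -/
def Hring : L2 →ₗ.[ℂ] L2 := freeHamiltonian.domRestrict H20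

/-- The adjoint `H̊*`. -/
def HringAdj : L2 →ₗ.[ℂ] L2 := Hring.adjoint

/-! ### The operators `H̊^(τ)` -/

/-- The graph of `H̊^(τ)` for `τ ∈ ℝ`, written with the auxiliary parameter `lam`: pairs `(g, h)`
with `ĝ = f̂ + τ ξ / (p² + λ)² + ξ / (p² + λ)` and
`ĥ + λ ĝ = (p² + λ) (f̂ + τ ξ / (p² + λ)²)` for some `f ∈ D(H̊)` and `ξ ∈ ℂ`. -/
def extGraph (lam τ : ℝ) : Submodule ℂ (L2 × L2) where
  carrier := {x | ∃ f ∈ Hring.domain, ∃ ξ : ℂ, ∀ᵐ p : R3,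
    hat x.1 p = hat f p + τ * ξ / ((‖p‖ ^ 2 + lam : ℝ) : ℂ) ^ 2 + ξ / ((‖p‖ ^ 2 + lam : ℝ) : ℂ) ∧
    hat x.2 p + lam * hat x.1 p = ((‖p‖ ^ 2 + lam : ℝ) : ℂ) *
      (hat f p + τ * ξ / ((‖p‖ ^ 2 + lam : ℝ) : ℂ) ^ 2)}
  add_mem' := by
    rintro x y ⟨f, hf, ξ, hx⟩ ⟨g, hg, η, hy⟩
    refine ⟨f + g, add_mem hf hg, ξ + η, ?_⟩
    filter_upwards [hx, hy, hat_add x.1 y.1, hat_add x.2 y.2, hat_add f g] with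
      p ⟨a1, a2⟩ ⟨b1, b2⟩ h1 h2 h3
    rw [Prod.fst_add, Prod.snd_add, h1, h2, h3]
    constructor
    · rw [a1, b1]; ring
    · linear_combination a2 + b2
  zero_mem' := by
    refine ⟨0, zero_mem _, 0, ?_⟩
    filter_upwards [hat_zero] with p h
    simp [h]
  smul_mem' := by
    rintro c x ⟨f, hf, ξ, hx⟩
    refine ⟨c • f, Submodule.smul_mem _ c hf, c * ξ, ?_⟩
    filter_upwards [hx, hat_smul c x.1, hat_smul c x.2, hat_smul c f] with p ⟨a1, a2⟩ h1 h2 h3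
    rw [Prod.smul_fst, Prod.smul_snd, h1, h2, h3]
    constructor
    · rw [a1]; ring
    · linear_combination c * a2

/-- The operator `H̊^(τ)`, `τ ∈ ℝ ∪ {∞}`; `H̊^(∞)` is `-Δ` with domain `H²(ℝ³)`. -/
def Hext (lam : ℝ) (τ : OnePoint ℝ) : L2 →ₗ.[ℂ] L2 :=
  τ.elim freeHamiltonian (fun t => (extGraph lam t).toLinearPMap)

/-! The two graphs above are single-valued, so that the operators have these graphs. -/

theorem eq_zero_of_hat {h : L2} (hh : ∀ᵐ p : R3, hat h p = 0) : h = 0 := by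
  have h2 : ∀ᵐ p : R3, hat h ((2 * Real.pi) • p) = 0 :=
    (Measure.quasiMeasurePreserving_smul (volume : Measure R3)
      (by positivity : (2 * Real.pi : ℝ) ≠ 0)).ae hh
  have h3 : (𝓕 h : L2) = 0 := by
    rw [Lp.eq_zero_iff_ae_eq_zero]
    filter_upwards [h2] with p hp
    unfold hat at hp
    rw [smul_smul, inv_mul_cancel₀ (by positivity), one_smul] at hp
    have hc : (((2 * Real.pi) ^ (-(3 / 2 : ℝ)) : ℝ) : ℂ) ≠ 0 := by
      exact_mod_cast (Real.rpow_pos_of_pos (by positivity) _).ne'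
    exact (mul_eq_zero.1 hp).resolve_left hc
  exact (Lp.fourierTransformₗᵢ R3 ℂ).map_eq_zero_iff.1 h3

theorem freeHamiltonian_graph : freeHamiltonian.graph = freeGraph := by
  refine Submodule.toLinearPMap_graph_eq _ ?_
  rintro ⟨f, h⟩ hx (rfl : f = 0)
  refine eq_zero_of_hat ?_
  filter_upwards [hx, hat_zero] with p h1 h2
  simpa [h2] using h1

theorem Hext_coe_graph {lam : ℝ} (hlam : 0 < lam) (τ : ℝ) :
    (Hext lam τ).graph = extGraph lam τ := by
  refine Submodule.toLinearPMap_graph_eq _ ?_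
  rintro ⟨g, h⟩ ⟨f, -, ξ, hx⟩ (rfl : g = 0)
  have hc : ∀ᵐ p : R3, hat h p = -ξ := by
    filter_upwards [hx, hat_zero] with p ⟨h1, h2⟩ h0
    have hne : ((‖p‖ ^ 2 + lam : ℝ) : ℂ) ≠ 0 := by
      exact_mod_cast (by positivity : (‖p‖ ^ 2 + lam : ℝ) ≠ 0)
    simp only [h0] at h1 h2
    have h3 : hat f p + τ * ξ / ((‖p‖ ^ 2 + lam : ℝ) : ℂ) ^ 2 =
        -(ξ / ((‖p‖ ^ 2 + lam : ℝ) : ℂ)) := by linear_combination -h1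
    rw [h3] at h2
    rw [mul_neg, mul_div_cancel₀ _ hne] at h2
    linear_combination h2
  have hm : MemLp (fun _ : R3 => -ξ) 2 (volume : Measure R3) :=
    (memLp_congr_ae hc).1 (hat_memLp h)
  have hξ : ξ = 0 := by
    rcases (memLp_const_iff (by norm_num) (by norm_num)).1 hm with h | h
    · simpa using h
    · simp at h
  refine eq_zero_of_hat ?_
  filter_upwards [hc] with p hp
  simp [hp, hξ]

/-! ### The Ter-Martirosyan--Skornyakov condition -/

/-- The momentum cut-off integral `∫_{|p| < R} ĝ(p) dp`. -/
def cutoffIntegral (g : L2) (R : ℝ) : ℂ := ∫ p in Metric.ball (0 : R3) R, hat g p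

/-- `∫_{|p| < R} ĝ(p) dp = 4 π ξ (R + 2 π² α) + o(1)` as `R → +∞`. -/
def TMSAsymptotics (α : ℝ) (ξ : ℂ) (g : L2) : Prop :=
  Tendsto (fun R : ℝ => cutoffIntegral g R - 4 * Real.pi * ξ * (R + 2 * Real.pi ^ 2 * α))
    atTop (𝓝 0)

theorem cutoffIntegral_add (f g : L2) (R : ℝ) :
    cutoffIntegral (f + g) R = cutoffIntegral f R + cutoffIntegral g R := by
  unfold cutoffIntegral
  rw [← integral_add (hat_integrableOn_ball f R) (hat_integrableOn_ball g R)]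
  exact integral_congr_ae (ae_restrict_of_ae (hat_add f g))

theorem cutoffIntegral_smul (c : ℂ) (f : L2) (R : ℝ) :
    cutoffIntegral (c • f) R = c * cutoffIntegral f R := by
  unfold cutoffIntegral
  rw [← integral_const_mul]
  exact integral_congr_ae (ae_restrict_of_ae (hat_smul c f))

theorem cutoffIntegral_zero (R : ℝ) : cutoffIntegral 0 R = 0 := by
  simpa using cutoffIntegral_smul 0 0 R

/-- The functions satisfying the TMS condition with parameter `α ∈ ℝ`, for some charge `ξ`. -/
def tmsReal (α : ℝ) : Submodule ℂ L2 where
  carrier := {g | ∃ ξ : ℂ, TMSAsymptotics α ξ g}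
  add_mem' := by
    rintro f g ⟨ξ, hf⟩ ⟨η, hg⟩
    refine ⟨ξ + η, ?_⟩
    have h := Tendsto.add hf hg
    rw [add_zero] at h
    refine h.congr fun R => ?_
    rw [cutoffIntegral_add]; ring
  zero_mem' := ⟨0, by simp [TMSAsymptotics, cutoffIntegral_zero]⟩
  smul_mem' := by
    rintro c f ⟨ξ, hf⟩
    refine ⟨c * ξ, ?_⟩
    have h := Tendsto.const_mul c hf
    rw [mul_zero] at h
    refine h.congr fun R => ?_
    rw [cutoffIntegral_smul]; ring

/-- The functions satisfying the TMS condition with parameter `α = ∞`: the term of order `R` is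
absent from the asymptotics, that is, `∫_{|p| < R} ĝ(p) dp = c + o(1)` for some constant `c`. -/
def tmsInfty : Submodule ℂ L2 where
  carrier := {g | ∃ c : ℂ, Tendsto (cutoffIntegral g) atTop (𝓝 c)}
  add_mem' := by
    rintro f g ⟨a, hf⟩ ⟨b, hg⟩
    exact ⟨a + b, (hf.add hg).congr fun R => (cutoffIntegral_add f g R).symm⟩
  zero_mem' := ⟨0, tendsto_const_nhds.congr fun R => (cutoffIntegral_zero R).symm⟩
  smul_mem' := by
    rintro c f ⟨a, hf⟩
    exact ⟨c * a, (hf.const_mul c).congr fun R => (cutoffIntegral_smul c f R).symm⟩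

/-- The functions satisfying the TMS condition with parameter `α ∈ ℝ ∪ {∞}`. -/
def tmsCondition (α : OnePoint ℝ) : Submodule ℂ L2 := α.elim tmsInfty tmsReal

/-- The TMS operator with parameter `α`: the restriction of `H̊*` to those elements of `D(H̊*)` that
satisfy the TMS condition with parameter `α`. -/
def HTMS (α : OnePoint ℝ) : L2 →ₗ.[ℂ] L2 := HringAdj.domRestrict (tmsCondition α)

/-! ### Scattering length -/

/-- `z` is an `s`-wave scattering amplitude of `H` at momentum `k`: there is a spherically symmetric
function `ψ(x) = w(|x|)` that belongs locally to the domain of `H`, solves `H ψ = k² ψ` locally, and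
behaves at infinity as the `s`-wave part `sin(k|x|) / (k|x|)` of the plane wave plus the outgoing
spherical wave `z exp(i k|x|) / |x|`, up to `o(1/|x|)`. -/
def IsSWaveAmplitude (H : L2 →ₗ.[ℂ] L2) (k : ℝ) (z : ℂ) : Prop :=
  ∃ w : ℝ → ℂ,
    (∀ ρ : ℝ, 0 < ρ → ∃ g : H.domain,
      (∀ᵐ x ∂(volume.restrict (Metric.ball (0 : R3) ρ)), (g : L2) x = w ‖x‖) ∧
      (∀ᵐ x ∂(volume.restrict (Metric.ball (0 : R3) ρ)), (H g) x = (k : ℂ) ^ 2 * w ‖x‖)) ∧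
    Tendsto (fun r : ℝ => r * (w r -
      (Complex.sin (k * r) / (k * r) + z * Complex.exp (Complex.I * k * r) / r))) atTop (𝓝 0)

/-- `H` has `s`-wave scattering length `a ∈ ℝ ∪ {∞}`: at every momentum `k > 0` there is exactly one
`s`-wave scattering amplitude `f k`, and `a = - lim_{k → 0} f k`. -/
def HasScatteringLength (H : L2 →ₗ.[ℂ] L2) (a : OnePoint ℝ) : Prop :=
  ∃ f : ℝ → ℂ, (∀ k : ℝ, 0 < k → ∀ z : ℂ, IsSWaveAmplitude H k z ↔ z = f k) ∧
    Tendsto (fun k : ℝ => ((-f k : ℂ) : OnePoint ℂ)) (𝓝[>] 0)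
      (𝓝 (OnePoint.map (fun t : ℝ => (t : ℂ)) a))

end PointInteraction

end

noncomputable section

namespace PointInteraction

open scoped SchwartzMap Laplacian ComplexConjugate

/-! Two numbers attached to an element `g` of the domain of the adjoint govern everything: the
charge `ξ`, for which the adjoint acts as `p² ĝ - ξ` in momentum space, and the regular part `c` in
`∫_{|p|<R} ĝ = 4πξR + c + o(1)`.

That the adjoint acts this way rests on a fact about dimension three. A functional `φ ↦ ⟨h, φ⟩ + ⟨g,
Δφ⟩` with `g, h ∈ L²` that kills all test functions supported away from `0` also kills every
Schwartz function with `φ(0) = 0`, since the cut-offs of such a function have Laplacians dominated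
by one square integrable function (`exists_cutoffSchwartz_bound`). Hence it is a multiple of the
point evaluation at `0`, which is a constant density in momentum space
(`exists_charge_of_annihilates`, `mem_HringAdj_graph`). The same fact identifies `H²₀` with the `f ∈
H²` satisfying `∫ f̂ = 0` (`mem_H20_iff`).

Explicit integrals of the resolvent and its square give `c = π²η/√λ - 2π²√λ ξ`
(`IsDecomposition.hasRegularPart`). The TMS condition is therefore the linear relation `c = 8π³αξ`,
which is `η = τξ`. Green's formula (`BoundaryData.inner_sub_inner`) turns the failure of symmetry
into the form `conj ξ' · c - ξ · conj c'`. All pairs `(ξ, c)` occur, so the self-adjoint extensions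
correspond to the lines in `ℂ²` that equal their own annihilator: those of real slope `c/ξ`, and `ξ
= 0`.

For scattering, `W(|x|)/|x|` has charge proportional to `W(0)` and regular part proportional to
`W'(0)` (`boundaryData_radialL2`), and the TMS condition becomes `W'(0) = 4παW(0)`. For `sin(kr)/k +
z exp(ikr)` this reads `1 + ikz = 4παz`, so `f(k) = (4πα - ik)⁻¹`; for `α = ∞` it reads `z = 0`.
Truncating this function shows that `z` is an amplitude. Conversely, a competitor is known only
almost everywhere and through its asymptotics. Pairing it with a truncated real solution gives zero
at every truncation radius, while far out the pairing approaches a Wronskian, which must then vanish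
(`IsSWaveAmplitude.radialBC`). -/

/-! ### The unitary Fourier transform: Plancherel, surjectivity, Schwartz functions -/

/-- The normalisation constant `(2π)^(-3/2)` of the unitary Fourier transform. -/
def fourierConst : ℝ := (2 * Real.pi) ^ (-(3 / 2 : ℝ))

theorem fourierConst_pos : 0 < fourierConst := Real.rpow_pos_of_pos (by positivity) _

/-- This cancels the Jacobian `(2π)³` of `p ↦ p/(2π)`, which is what makes `hat` unitary. -/
theorem fourierConst_sq : fourierConst ^ 2 = ((2 * Real.pi) ^ 3)⁻¹ := by
  unfold fourierConst
  rw [← Real.rpow_natCast, ← Real.rpow_mul (by positivity), ← Real.rpow_natCast,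
    ← Real.rpow_neg (by positivity)]
  norm_num

theorem hat_eq (g : L2) (p : R3) :
    hat g p = (fourierConst : ℂ) * (𝓕 g : L2) ((2 * Real.pi)⁻¹ • p) := rfl

theorem integral_comp_two_pi_inv_smul (F : R3 → ℂ) :
    ∫ p : R3, F ((2 * Real.pi)⁻¹ • p) = ((2 * Real.pi) ^ 3 : ℝ) * ∫ p : R3, F p := by
  rw [Measure.integral_comp_smul]
  have : |((2 * Real.pi)⁻¹ ^ Module.finrank ℝ R3)⁻¹| = (2 * Real.pi) ^ 3 := by
    rw [finrank_euclideanSpace_fin, abs_of_pos (by positivity), inv_pow, inv_inv]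
  rw [this]; simp

theorem hat_congr_ae {f : L2} {F : R3 → ℂ}
    (h : ((𝓕 f : L2) : R3 → ℂ) =ᵐ[volume] F) :
    ∀ᵐ p : R3, hat f p = (fourierConst : ℂ) * F ((2 * Real.pi)⁻¹ • p) := by
  filter_upwards [ae_scale h] with p hp
  rw [hat_eq, hp]

/-- Plancherel's identity for `hat`. -/
theorem inner_eq_integral_hat (f g : L2) :
    inner ℂ f g = ∫ p : R3, conj (hat f p) * hat g p := by
  rw [← Lp.inner_fourier_eq, L2.inner_def]
  have h : ∀ p : R3, conj (hat f p) * hat g p = ((fourierConst ^ 2 : ℝ) : ℂ) *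
      (fun q : R3 => inner ℂ ((𝓕 f : L2) q) ((𝓕 g : L2) q)) ((2 * Real.pi)⁻¹ • p) := by
    intro p
    simp only [hat_eq, RCLike.inner_apply, map_mul, Complex.conj_ofReal]
    push_cast; ring
  rw [integral_congr_ae (Eventually.of_forall h), integral_const_mul,
    integral_comp_two_pi_inv_smul (fun q : R3 => inner ℂ ((𝓕 f : L2) q) ((𝓕 g : L2) q)), ← mul_assoc, fourierConst_sq,
    ← Complex.ofReal_mul, inv_mul_cancel₀ (by positivity)]
  simp

theorem integrable_conj_hat_mul {F : R3 → ℂ} (f : L2) (hF : MemLp F 2 (volume : Measure R3)) :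
    Integrable (fun p : R3 => conj (hat f p) * F p) := by
  have := (hat_memLp f).star.integrable_mul hF
  exact this

/-- Elements of `L²` are constructed throughout by prescribing their transform. The witness is the
inverse transform of the rescaled function. -/
theorem exists_hat_eq {F : R3 → ℂ} (hF : MemLp F 2 (volume : Measure R3)) :
    ∃ f : L2, ∀ᵐ p : R3, hat f p = F p := by
  have hne : (2 * Real.pi : ℝ) ≠ 0 := by positivity
  have hG : MemLp (fun p : R3 => (fourierConst : ℂ)⁻¹ * F ((2 * Real.pi) • p)) 2
      (volume : Measure R3) := by
    have hm : MemLp F 2 (Measure.map (fun p : R3 => (2 * Real.pi) • p) volume) := by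
      rw [Measure.map_addHaar_smul (volume : Measure R3) hne]
      exact hF.smul_measure ENNReal.ofReal_ne_top
    exact (hm.comp_of_map (measurable_const_smul _).aemeasurable).const_mul _
  refine ⟨(𝓕⁻ (hG.toLp _) : L2), ?_⟩
  have h := hG.coeFn_toLp
  have h2 : (𝓕 (𝓕⁻ (hG.toLp _) : L2) : L2) = hG.toLp _ := FourierTransform.fourier_fourierInv_eq _
  filter_upwards [ae_scale h] with p hp
  rw [hat_eq, h2, hp, smul_smul, mul_inv_cancel₀ hne, one_smul, ← mul_assoc, mul_inv_cancel₀,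
    one_mul]
  exact_mod_cast fourierConst_pos.ne'

theorem eq_of_hat {f g : L2} (h : ∀ᵐ p : R3, hat f p = hat g p) : f = g := by
  rw [← sub_eq_zero]
  refine eq_zero_of_hat ?_
  filter_upwards [h, hat_sub f g] with p h1 h2
  rw [h2, h1, sub_self]

theorem eLpNorm_hat (f : L2) : eLpNorm (hat f) 2 volume = ‖f‖ₑ := by
  have h1 : ‖(hat_memLp f).toLp _‖ ^ 2 = ‖f‖ ^ 2 := by
    have a := inner_self_eq_norm_sq_to_K (𝕜 := ℂ) f
    have b := inner_self_eq_norm_sq_to_K (𝕜 := ℂ) ((hat_memLp f).toLp _)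
    rw [inner_eq_integral_hat] at a
    rw [L2.inner_def] at b
    have e : ∫ p : R3, inner ℂ ((hat_memLp f).toLp _ p) ((hat_memLp f).toLp _ p) =
        ∫ p : R3, conj (hat f p) * hat f p := by
      refine integral_congr_ae ?_
      filter_upwards [(hat_memLp f).coeFn_toLp] with p hp
      rw [hp, RCLike.inner_apply, mul_comm]
    rw [e, a] at b
    exact_mod_cast b.symm
  have h2 : ‖(hat_memLp f).toLp _‖ = ‖f‖ := by
    rwa [sq_eq_sq₀ (norm_nonneg _) (norm_nonneg _)] at h1
  rw [Lp.norm_toLp] at h2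
  rw [← ofReal_norm, ← h2, ENNReal.ofReal_toReal (hat_memLp f).2.ne]

theorem hat_toLp_schwartz (φ : 𝓢(R3, ℂ)) : ∀ᵐ p : R3,
    hat (φ.toLp 2 : L2) p = (fourierConst : ℂ) * (𝓕 φ : 𝓢(R3, ℂ)) ((2 * Real.pi)⁻¹ • p) := by
  refine hat_congr_ae ?_
  rw [SchwartzMap.toLp_fourier_eq]
  exact SchwartzMap.coeFn_toLp _ _ _

theorem fourier_laplacian_apply (φ : 𝓢(R3, ℂ)) (w : R3) :
    (𝓕 (Δ φ) : 𝓢(R3, ℂ)) w = -((2 * Real.pi) ^ 2 * ‖w‖ ^ 2 : ℝ) * (𝓕 φ : 𝓢(R3, ℂ)) w := by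
  rw [SchwartzMap.laplacian_eq_fourierMultiplierCLM, FourierTransform.fourier_smul,
    SchwartzMap.fourierMultiplierCLM_apply, FourierTransform.fourier_fourierInv_eq,
    _root_.smul_apply, SchwartzMap.smulLeftCLM_apply_apply (by fun_prop)]
  simp only [Complex.real_smul]
  push_cast; ring

theorem hat_toLp_laplacian (φ : 𝓢(R3, ℂ)) : ∀ᵐ p : R3,
    hat ((Δ φ : 𝓢(R3, ℂ)).toLp 2 : L2) p = -(‖p‖ ^ 2 : ℝ) * hat (φ.toLp 2 : L2) p := by
  filter_upwards [hat_toLp_schwartz φ, hat_toLp_schwartz (Δ φ)] with p h1 h2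
  rw [h1, h2, fourier_laplacian_apply, norm_smul]
  have : (2 * Real.pi) ^ 2 * (‖(2 * Real.pi)⁻¹‖ * ‖p‖) ^ 2 = ‖p‖ ^ 2 := by
    rw [Real.norm_of_nonneg (by positivity)]; field_simp
  rw [this]; ring

/-- On `L¹ ∩ L²` the `L²`-Fourier transform is given by the Fourier integral. -/
theorem fourier_toLp_ae_eq {f : R3 → ℂ} (h1 : Integrable f) (h2 : MemLp f 2 (volume : Measure R3)) :
    ((𝓕 (h2.toLp f) : L2) : R3 → ℂ) =ᵐ[volume] 𝓕 f := by
  have hcont : Continuous (𝓕 f) := VectorFourier.fourierIntegral_continuous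
    Real.continuous_fourierChar (by exact continuous_inner) h1
  have key : ∀ᵐ x : R3, ((𝓕 (h2.toLp f) : L2) : R3 → ℂ) x - 𝓕 f x = 0 := by
    refine ae_eq_zero_of_integral_contDiff_smul_eq_zero
      (((Lp.memLp _).locallyIntegrable (by norm_num)).sub hcont.locallyIntegrable) ?_
    intro g hg hgc
    let G : 𝓢(R3, ℂ) := (hgc.comp_left (g := ((↑) : ℝ → ℂ)) (by simp)).toSchwartzMap
      (Complex.ofRealCLM.contDiff.comp hg)
    have hG : ∀ x, G x = (g x : ℂ) := fun x => rfl
    -- Both transforms are tested against smooth compactly supported functions: the `L²` one agrees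
    -- with the transform of tempered distributions, the integral one satisfies the multiplication
    -- formula `e3`.
    have e1 := congrArg (fun T : 𝓢'(R3, ℂ) => T G)
      (Lp.fourier_toTemperedDistribution_eq (h2.toLp f))
    simp only [TemperedDistribution.fourier_apply, Lp.toTemperedDistribution_apply] at e1
    have e2 : ∫ x : R3, (𝓕 G : 𝓢(R3, ℂ)) x • (h2.toLp f) x =
        ∫ x : R3, (𝓕 G : 𝓢(R3, ℂ)) x • f x := by
      refine integral_congr_ae ?_
      filter_upwards [h2.coeFn_toLp] with x hx
      rw [hx]
    have e3 : ∫ x : R3, (𝓕 G : 𝓢(R3, ℂ)) x • f x = ∫ x : R3, G x • 𝓕 f x := by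
      have := VectorFourier.integral_fourierIntegral_smul_eq_flip (L := innerₗ R3)
        (μ := volume) (ν := volume) Real.continuous_fourierChar (by exact continuous_inner)
        G.integrable h1
      simp only [flip_innerₗ] at this
      exact this
    rw [e2, e3] at e1
    have i1 : Integrable (fun x : R3 => G x • 𝓕 f x) := by
      have : Integrable (fun x : R3 => g x • 𝓕 f x) :=
        hcont.locallyIntegrable.integrable_smul_left_of_hasCompactSupport hg.continuous hgc
      simpa [hG] using this
    have i2 : Integrable (fun x : R3 => G x • ((𝓕 (h2.toLp f) : L2) : R3 → ℂ) x) := by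
      have : Integrable (fun x : R3 => g x • ((𝓕 (h2.toLp f) : L2) : R3 → ℂ) x) :=
        ((Lp.memLp _).locallyIntegrable (by norm_num)).integrable_smul_left_of_hasCompactSupport
          hg.continuous hgc
      simpa [hG] using this
    have e4 : ∀ x : R3, g x • (((𝓕 (h2.toLp f) : L2) : R3 → ℂ) x - 𝓕 f x) =
        G x • ((𝓕 (h2.toLp f) : L2) : R3 → ℂ) x - G x • 𝓕 f x := by
      intro x; rw [hG]; simp [mul_sub]
    simp_rw [e4]
    rw [integral_sub i2 i1, ← e1, sub_self]
  filter_upwards [key] with x hx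
  exact sub_eq_zero.1 hx

theorem hat_toLp {f : R3 → ℂ} (h1 : Integrable f) (h2 : MemLp f 2 (volume : Measure R3)) :
    ∀ᵐ p : R3, hat (h2.toLp f) p = (fourierConst : ℂ) * 𝓕 f ((2 * Real.pi)⁻¹ • p) :=
  hat_congr_ae (fourier_toLp_ae_eq h1 h2)

/-! ### Cutting off Schwartz functions near the origin and near infinity -/

/-- A smooth cutoff function on `ℝ³`, equal to one near the origin. -/
def unitBump : ContDiffBump (0 : R3) := ⟨1, 2, one_pos, one_lt_two⟩

/-- A cutoff that vanishes near the origin and near infinity and tends to one as `n → ∞`. -/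
def annularCutoff (n : ℕ) (x : R3) : ℝ :=
  unitBump ((n + 2 : ℝ)⁻¹ • x) - unitBump ((n + 2 : ℝ) • x)

theorem contDiff_annularCutoff (n : ℕ) : ContDiff ℝ ∞ (annularCutoff n) :=
  (unitBump.contDiff.comp (contDiff_const_smul _)).sub
    (unitBump.contDiff.comp (contDiff_const_smul _))

theorem hasCompactSupport_annularCutoff (n : ℕ) : HasCompactSupport (annularCutoff n) := by
  have h : ∀ a : ℝ, a ≠ 0 → HasCompactSupport (fun x : R3 => unitBump (a • x)) := fun a ha =>
    unitBump.hasCompactSupport.comp_homeomorph (Homeomorph.smulOfNeZero a ha)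
  exact (h _ (by positivity)).sub (h _ (by positivity))

theorem annularCutoff_eq_zero (n : ℕ) {x : R3} (hx : ‖x‖ ≤ (n + 2 : ℝ)⁻¹) :
    annularCutoff n x = 0 := by
  have hn : (0 : ℝ) < n + 2 := by positivity
  have h1 : (n + 2 : ℝ)⁻¹ ≤ 1 := inv_le_one_of_one_le₀ (by linarith [n.cast_nonneg (α := ℝ)])
  unfold annularCutoff
  rw [unitBump.one_of_mem_closedBall, unitBump.one_of_mem_closedBall, sub_self]
  · rw [mem_closedBall_zero_iff, norm_smul, Real.norm_of_nonneg hn.le]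
    exact (mul_le_mul_of_nonneg_left hx hn.le).trans (mul_inv_cancel₀ hn.ne').le
  · rw [mem_closedBall_zero_iff, norm_smul, Real.norm_of_nonneg (by positivity)]
    exact (mul_le_mul h1 (hx.trans h1) (norm_nonneg _) zero_le_one).trans (one_mul _).le

theorem annularCutoff_eq_one (n : ℕ) {x : R3} (hx : ‖x‖ ≤ n + 2) (hx' : 2 ≤ (n + 2 : ℝ) * ‖x‖) :
    annularCutoff n x = 1 := by
  have hn : (0 : ℝ) < n + 2 := by positivity
  unfold annularCutoff
  rw [unitBump.one_of_mem_closedBall, unitBump.zero_of_le_dist, sub_zero]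
  · rwa [dist_zero_right, norm_smul, Real.norm_of_nonneg hn.le]
  · rw [mem_closedBall_zero_iff, norm_smul, Real.norm_of_nonneg (by positivity)]
    exact (inv_mul_le_one₀ hn).2 hx

theorem eventually_annularCutoff_eq_one {x : R3} (hx : x ≠ 0) :
    ∀ᶠ n : ℕ in atTop, annularCutoff n =ᶠ[𝓝 x] fun _ => 1 := by
  have h0 : 0 < ‖x‖ := norm_pos_iff.2 hx
  filter_upwards [tendsto_natCast_atTop_atTop.eventually_ge_atTop (‖x‖ + 1),
    tendsto_natCast_atTop_atTop.eventually_ge_atTop (4 / ‖x‖)] with n h1 h2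
  have e1 : ∀ᶠ y : R3 in 𝓝 x, ‖y‖ < ‖x‖ + 1 :=
    continuous_norm.continuousAt.eventually (gt_mem_nhds (by linarith))
  have e2 : ∀ᶠ y : R3 in 𝓝 x, ‖x‖ / 2 < ‖y‖ :=
    continuous_norm.continuousAt.eventually (lt_mem_nhds (by linarith))
  filter_upwards [e1, e2] with y h3 h4
  refine annularCutoff_eq_one n (by linarith) ?_
  have : 4 ≤ n * ‖x‖ := by rwa [div_le_iff₀ h0] at h2
  nlinarith [n.cast_nonneg (α := ℝ)]

/-- Scale invariance: the `k`-th derivative of `χ(a·)` is `aᵏ χ⁽ᵏ⁾(a·)`, so after weighting with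
`|x|ᵏ` it is bounded by a Schwartz seminorm of `χ` for every `a`. Both pieces of the cut-off have
this form. -/
theorem exists_annularCutoff_bound : ∃ C : ℝ, 0 ≤ C ∧ ∀ (n : ℕ) (x : R3) (k : ℕ), k ≤ 2 →
    ‖x‖ ^ k * ‖iteratedFDeriv ℝ k (annularCutoff n) x‖ ≤ C := by
  let χ : 𝓢(R3, ℝ) := unitBump.hasCompactSupport.toSchwartzMap unitBump.contDiff
  let S : ℕ → ℝ := fun k => SchwartzMap.seminorm ℝ k k χ
  have hS : ∀ k, 0 ≤ S k := fun k => apply_nonneg _ _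
  have hb : ∀ (a : ℝ) (x : R3) (k : ℕ),
      ‖x‖ ^ k * ‖iteratedFDeriv ℝ k (fun y : R3 => unitBump (a • y)) x‖ ≤ S k := by
    intro a x k
    have := SchwartzMap.le_seminorm ℝ k k χ (a • x)
    rw [iteratedFDeriv_comp_const_smul a (unitBump.contDiff (n := (k : ℕ∞)))]
    rw [norm_smul, mul_pow] at this
    rw [norm_smul, norm_pow]
    calc _ = ‖a‖ ^ k * ‖x‖ ^ k * ‖iteratedFDeriv ℝ k unitBump (a • x)‖ := by ring
      _ ≤ _ := this
  refine ⟨2 * (S 0 + S 1 + S 2), by linarith [hS 0, hS 1, hS 2], fun n x k hk => ?_⟩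
  have hsum : S k ≤ S 0 + S 1 + S 2 := by
    interval_cases k <;> linarith [hS 0, hS 1, hS 2]
  have hc : ∀ a : ℝ, ContDiffAt ℝ k (fun y : R3 => unitBump (a • y)) x := fun a =>
    ((unitBump.contDiff (n := (k : ℕ∞))).comp (contDiff_const_smul a)).contDiffAt
  have he : annularCutoff n = (fun y : R3 => unitBump ((n + 2 : ℝ)⁻¹ • y)) -
    fun y : R3 => unitBump ((n + 2 : ℝ) • y) := rfl
  rw [he, iteratedFDeriv_sub_apply (hc _) (hc _)]
  calc _ ≤ ‖x‖ ^ k * (‖iteratedFDeriv ℝ k (fun y : R3 => unitBump ((n + 2 : ℝ)⁻¹ • y)) x‖ +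
        ‖iteratedFDeriv ℝ k (fun y : R3 => unitBump ((n + 2 : ℝ) • y)) x‖) := by
        gcongr; exact norm_sub_le _ _
    _ ≤ _ := by rw [mul_add]; linarith [hb (n + 2 : ℝ)⁻¹ x k, hb (n + 2 : ℝ) x k]

theorem norm_laplacian_le (f : R3 → ℂ) (x : R3) :
    ‖(Δ f) x‖ ≤ 3 * ‖iteratedFDeriv ℝ 2 f x‖ := by
  rw [InnerProductSpace.laplacian_eq_iteratedFDeriv_orthonormalBasis f
    (EuclideanSpace.basisFun (Fin 3) ℝ)]
  refine (norm_sum_le _ _).trans ?_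
  refine (Finset.sum_le_card_nsmul _ _ ‖iteratedFDeriv ℝ 2 f x‖ fun i _ => ?_).trans (by simp)
  refine (ContinuousMultilinearMap.le_opNorm _ _).trans ?_
  simp [Fin.prod_univ_two]

/-- The cut-off Schwartz functions. -/
def cutoffSchwartz (n : ℕ) (φ : 𝓢(R3, ℂ)) : 𝓢(R3, ℂ) :=
  ((hasCompactSupport_annularCutoff n).smul_right (f' := φ)).toSchwartzMap
    ((contDiff_annularCutoff n).smul (φ.smooth ⊤))

theorem cutoffSchwartz_coe (n : ℕ) (φ : 𝓢(R3, ℂ)) :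
    (cutoffSchwartz n φ : R3 → ℂ) = fun x => annularCutoff n x • φ x := rfl

theorem zero_notMem_tsupport_cutoffSchwartz (n : ℕ) (φ : 𝓢(R3, ℂ)) :
    (0 : R3) ∉ tsupport (cutoffSchwartz n φ) := by
  rw [notMem_tsupport_iff_eventuallyEq]
  have : Metric.ball (0 : R3) (n + 2 : ℝ)⁻¹ ∈ 𝓝 (0 : R3) :=
    Metric.ball_mem_nhds _ (by positivity)
  filter_upwards [this] with x hx
  rw [cutoffSchwartz_coe]
  simp [annularCutoff_eq_zero n (mem_ball_zero_iff.1 hx).le]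

theorem hasCompactSupport_cutoffSchwartz (n : ℕ) (φ : 𝓢(R3, ℂ)) :
    HasCompactSupport (cutoffSchwartz n φ) :=
  (hasCompactSupport_annularCutoff n).smul_right (f' := φ)

/-- Two derivatives on the cut-off cost `|x|⁻²`, but `φ(0) = 0` gives `φ = O(|x|)` and wins one
power back. The remaining `|x|⁻¹` is locally square integrable in dimension three, and the bound
does not depend on `n`. -/
theorem exists_cutoffSchwartz_bound (φ : 𝓢(R3, ℂ)) (h0 : φ 0 = 0) : ∃ C : ℝ, ∀ (n : ℕ) (x : R3),
    x ≠ 0 → ‖Δ (cutoffSchwartz n φ) x‖ ≤ C * (‖x‖ * (1 + ‖x‖))⁻¹ := by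
  obtain ⟨C, hC, hb⟩ := exists_annularCutoff_bound
  let S : ℕ → ℕ → ℝ := fun k l => SchwartzMap.seminorm ℝ k l φ
  have hS : ∀ k l x, ‖x‖ ^ k * ‖iteratedFDeriv ℝ l φ x‖ ≤ S k l := fun k l x =>
    SchwartzMap.le_seminorm ℝ k l φ x
  have hlip : ∀ x, ‖φ x‖ ≤ S 0 1 * ‖x‖ := by
    intro x
    have := Convex.norm_image_sub_le_of_norm_fderiv_le (𝕜 := ℝ) (f := φ) (s := Set.univ) (x := 0)
      (y := x) (C := S 0 1) (fun y _ => φ.differentiableAt) (fun y _ => by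
        have := hS 0 1 y
        rwa [pow_zero, one_mul, norm_iteratedFDeriv_one] at this) convex_univ trivial trivial
    simpa [h0] using this
  refine ⟨3 * C * ((S 0 1 + S 0 0) + 2 * (S 0 1 + S 1 1) + (S 1 2 + S 2 2)), fun n x hx => ?_⟩
  have hx0 : 0 < ‖x‖ := norm_pos_iff.2 hx
  set t := ‖x‖ with ht
  rw [SchwartzMap.laplacian_apply]
  refine (norm_laplacian_le _ x).trans ?_
  rw [cutoffSchwartz_coe, ← div_eq_mul_inv, le_div_iff₀ (by positivity)]
  have hle := norm_iteratedFDeriv_smul_le (N := ∞) (contDiff_annularCutoff n) (φ.smooth ⊤) x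
    (n := 2) (by norm_cast)
  simp only [Finset.sum_range_succ, Finset.range_zero, Finset.sum_empty, zero_add, Nat.choose_zero_right,
    Nat.choose_one_right, Nat.choose_self, Nat.cast_one, one_mul, Nat.sub_zero, 
    Nat.cast_ofNat, Nat.reduceSub] at hle
  have a0 := hb n x 0 (by norm_num)
  have a1 := hb n x 1 (by norm_num)
  have a2 := hb n x 2 (by norm_num)
  have b0 := hlip x
  have b0' := hS 0 0 x
  have b1 := hS 0 1 x
  have b1' := hS 1 1 x
  have b2 := hS 1 2 x
  have b2' := hS 2 2 x
  simp only [pow_zero, one_mul, pow_one, norm_iteratedFDeriv_zero, ← ht] at a0 a1 a2 b0 b0' b1 b1' b2 b2' hle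
  have p0 := norm_nonneg (annularCutoff n x)
  have p1 := norm_nonneg (iteratedFDeriv ℝ 1 (annularCutoff n) x)
  have p2 := norm_nonneg (iteratedFDeriv ℝ 2 (annularCutoff n) x)
  have q0 := norm_nonneg (φ x)
  have q1 := norm_nonneg (iteratedFDeriv ℝ 1 φ x)
  have q2 := norm_nonneg (iteratedFDeriv ℝ 2 φ x)
  generalize ‖iteratedFDeriv ℝ 2 (fun y => annularCutoff n y • φ y) x‖ = L at *
  generalize ‖iteratedFDeriv ℝ 2 φ x‖ = d2 at *
  generalize ‖iteratedFDeriv ℝ 1 φ x‖ = d1 at *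
  generalize ‖φ x‖ = d0 at *
  generalize ‖iteratedFDeriv ℝ 2 (annularCutoff n) x‖ = A2 at *
  generalize ‖iteratedFDeriv ℝ 1 (annularCutoff n) x‖ = A1 at *
  generalize ‖annularCutoff n x‖ = A0 at *
  have e0 : A0 * (t * d2 + t ^ 2 * d2) ≤ C * (S 1 2 + S 2 2) :=
    mul_le_mul a0 (add_le_add b2 b2') (by positivity) hC
  have e1 : (t * A1) * (d1 + t * d1) ≤ C * (S 0 1 + S 1 1) :=
    mul_le_mul a1 (add_le_add b1 b1') (by positivity) hC
  have e2 : (t ^ 2 * A2) * d0 ≤ C * S 0 0 := mul_le_mul a2 b0' q0 hC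
  have hs : 0 ≤ S 0 1 := q1.trans b1
  -- The Lipschitz bound `b0`, that is the vanishing of `φ` at `0`, enters only here: it trades `d0`
  -- for the second factor `t` that the bound on `A2` requires.
  have e3 : (t * A2) * d0 ≤ C * S 0 1 :=
    calc (t * A2) * d0 ≤ (t * A2) * (S 0 1 * t) := by gcongr
      _ = (t ^ 2 * A2) * S 0 1 := by ring
      _ ≤ C * S 0 1 := by gcongr
  calc 3 * L * (t * (1 + t)) ≤ 3 * (A0 * d2 + 2 * A1 * d1 + A2 * d0) * (t * (1 + t)) := by gcongr
    _ = 3 * (A0 * (t * d2 + t ^ 2 * d2) + 2 * ((t * A1) * (d1 + t * d1)) +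
        ((t ^ 2 * A2) * d0 + (t * A2) * d0)) := by ring
    _ ≤ 3 * (C * (S 1 2 + S 2 2) + 2 * (C * (S 0 1 + S 1 1)) + (C * S 0 0 + C * S 0 1)) := by
        gcongr
    _ = _ := by ring

/-- `(|x| (1 + |x|))⁻¹` is square integrable on `ℝ³`. -/
theorem memLp_inv_norm_mul_one_add_norm :
    MemLp (fun x : R3 => (‖x‖ * (1 + ‖x‖))⁻¹) 2 (volume : Measure R3) := by
  have hm : AEStronglyMeasurable (fun x : R3 => (‖x‖ * (1 + ‖x‖))⁻¹) volume :=
    (by fun_prop : Measurable fun x : R3 => (‖x‖ * (1 + ‖x‖))⁻¹).aestronglyMeasurable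
  rw [memLp_two_iff_integrable_sq hm]
  rw [integrable_fun_norm_addHaar volume (f := fun r : ℝ => ((r * (1 + r))⁻¹) ^ 2)]
  refine Integrable.mono' integrable_inv_one_add_sq.integrableOn
    (by fun_prop : Measurable _).aestronglyMeasurable ?_
  filter_upwards [ae_restrict_mem measurableSet_Ioi] with r (hr : 0 < r)
  rw [finrank_euclideanSpace_fin, smul_eq_mul, Real.norm_of_nonneg (by positivity)]
  have : r ^ (3 - 1) * (r * (1 + r))⁻¹ ^ 2 = ((1 + r) ^ 2)⁻¹ := by
    field_simp
  rw [this]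
  exact inv_anti₀ (by positivity) (by nlinarith)

/-- If a pair `(g, h)` annihilates all pairs `(Δψ, ψ)` with `ψ` a test function away from the
origin, it annihilates those with a Schwartz function `φ` vanishing at the origin. -/
theorem integral_schwartz_eq_zero_of_cutoff {g h : L2}
    (H : ∀ ψ : 𝓢(R3, ℂ), HasCompactSupport ψ → (0 : R3) ∉ tsupport ψ →
      ∫ x : R3, (conj (h x) * ψ x + conj (g x) * Δ ψ x) = 0)
    (φ : 𝓢(R3, ℂ)) (h0 : φ 0 = 0) :
    ∫ x : R3, (conj (h x) * φ x + conj (g x) * Δ φ x) = 0 := by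
  obtain ⟨C, hC⟩ := exists_cutoffSchwartz_bound φ h0
  obtain ⟨D, hD, hb⟩ := exists_annularCutoff_bound
  have hne : ∀ᵐ x : R3, x ≠ 0 := by simp [ae_iff]
  have hlim : Tendsto (fun n => ∫ x : R3, (conj (h x) * cutoffSchwartz n φ x +
      conj (g x) * Δ (cutoffSchwartz n φ) x)) atTop
      (𝓝 (∫ x : R3, (conj (h x) * φ x + conj (g x) * Δ φ x))) := by
    -- The dominating function is a sum of products of two square integrable functions, hence
    -- integrable.
    refine tendsto_integral_of_dominated_convergence
      (fun x => ‖h x‖ * (D * ‖φ x‖) + ‖g x‖ * (C * (‖x‖ * (1 + ‖x‖))⁻¹)) ?_ ?_ ?_ ?_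
    · intro n
      exact ((Complex.continuous_conj.comp_aestronglyMeasurable (Lp.aestronglyMeasurable h)).mul
        (cutoffSchwartz n φ).continuous.aestronglyMeasurable).add
        ((Complex.continuous_conj.comp_aestronglyMeasurable (Lp.aestronglyMeasurable g)).mul
        (Δ (cutoffSchwartz n φ)).continuous.aestronglyMeasurable)
    · refine Integrable.add ?_ ?_
      · exact (Lp.memLp h).norm.integrable_mul (((φ.memLp 2).norm).const_mul D)
      · exact (Lp.memLp g).norm.integrable_mul (memLp_inv_norm_mul_one_add_norm.const_mul C)
    · intro n
      filter_upwards [hne] with x hx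
      refine (norm_add_le _ _).trans ?_
      rw [norm_mul, norm_mul, RCLike.norm_conj, RCLike.norm_conj]
      gcongr
      · have := hb n x 0 (by norm_num)
        rw [pow_zero, one_mul, norm_iteratedFDeriv_zero] at this
        rw [cutoffSchwartz_coe]
        simp only [norm_smul]
        gcongr
      · exact hC n x hx
    · filter_upwards [hne] with x hx
      refine tendsto_const_nhds.congr' ?_
      filter_upwards [eventually_annularCutoff_eq_one hx] with n hn
      have he : (cutoffSchwartz n φ : R3 → ℂ) =ᶠ[𝓝 x] φ := by
        filter_upwards [hn] with y hy
        rw [cutoffSchwartz_coe]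
        simp [hy]
      rw [he.eq_of_nhds, SchwartzMap.laplacian_apply, SchwartzMap.laplacian_apply,
        (InnerProductSpace.laplacian_congr_nhds he).eq_of_nhds]
  refine tendsto_nhds_unique hlim ?_
  simp_rw [H _ (hasCompactSupport_cutoffSchwartz _ φ) (zero_notMem_tsupport_cutoffSchwartz _ φ)]
  exact tendsto_const_nhds

/-! ### The annihilator of the test functions -/

theorem locallyIntegrable_hat (f : L2) : LocallyIntegrable (hat f) :=
  (hat_memLp f).locallyIntegrable (by norm_num)

theorem inner_toLp_schwartz (h : L2) (φ : 𝓢(R3, ℂ)) :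
    inner ℂ h (φ.toLp 2 : L2) = ∫ x : R3, conj (h x) * φ x := by
  rw [L2.inner_def]
  refine integral_congr_ae ?_
  filter_upwards [φ.coeFn_toLp 2 volume] with x hx
  rw [hx, RCLike.inner_apply, mul_comm]

theorem integral_conj_mul_add_laplacian (g h : L2) (φ : 𝓢(R3, ℂ)) :
    ∫ x : R3, (conj (h x) * φ x + conj (g x) * Δ φ x) =
      inner ℂ h (φ.toLp 2 : L2) + inner ℂ g ((Δ φ).toLp 2 : L2) := by
  rw [inner_toLp_schwartz, inner_toLp_schwartz, integral_add]
  · exact (Lp.memLp h).star.integrable_mul (φ.memLp 2)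
  · exact (Lp.memLp g).star.integrable_mul ((Δ φ).memLp 2)

/-- Plancherel moves the functional to momentum space, where the conjugate of the defect `ĥ - p² ĝ`
is its density. -/
theorem inner_add_inner_laplacian_eq (g h : L2) (φ : 𝓢(R3, ℂ)) :
    inner ℂ h (φ.toLp 2 : L2) + inner ℂ g ((Δ φ).toLp 2 : L2) =
      ∫ p : R3, conj (hat h p - (‖p‖ ^ 2 : ℝ) * hat g p) *
        (fourierConst * (𝓕 φ : 𝓢(R3, ℂ)) ((2 * Real.pi)⁻¹ • p)) := by
  rw [inner_eq_integral_hat, inner_eq_integral_hat,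
    ← integral_add (integrable_conj_hat_mul _ (hat_memLp _))
      (integrable_conj_hat_mul _ (hat_memLp _))]
  refine integral_congr_ae ?_
  filter_upwards [hat_toLp_schwartz φ, hat_toLp_laplacian φ] with p h1 h2
  simp only [h2, h1, map_sub, map_mul, Complex.conj_ofReal]
  ring

/-- The functional `φ ↦ ⟨h, φ⟩ + ⟨g, Δφ⟩` on Schwartz functions. -/
def schwartzFunctional (g h : L2) : 𝓢(R3, ℂ) →ₗ[ℂ] ℂ :=
  ((innerSL ℂ h).toLinearMap ∘ₗ (SchwartzMap.toLpCLM ℂ ℂ 2 (volume : Measure R3)).toLinearMap) +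
  ((innerSL ℂ g).toLinearMap ∘ₗ (SchwartzMap.toLpCLM ℂ ℂ 2 (volume : Measure R3)).toLinearMap ∘ₗ
    (LineDeriv.laplacianCLM ℂ R3 𝓢(R3, ℂ)).toLinearMap)

theorem schwartzFunctional_apply (g h : L2) (φ : 𝓢(R3, ℂ)) :
    schwartzFunctional g h φ =
      inner ℂ h (φ.toLp 2 : L2) + inner ℂ g ((Δ φ).toLp 2 : L2) := by
  rw [← SchwartzMap.laplacianCLM_eq (𝕜 := ℂ)]
  rfl

/-- The functional kills `φ - φ(0)χ` when `χ(0) = 1`, because this function vanishes at the origin.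
Its value at `χ` is the constant `κ`. -/
theorem exists_schwartzFunctional_eq_delta {g h : L2}
    (H : ∀ ψ : 𝓢(R3, ℂ), HasCompactSupport ψ → (0 : R3) ∉ tsupport ψ →
      schwartzFunctional g h ψ = 0) :
    ∃ κ : ℂ, ∀ φ : 𝓢(R3, ℂ), schwartzFunctional g h φ = φ 0 * κ := by
  have hcut := integral_schwartz_eq_zero_of_cutoff (g := g) (h := h) fun ψ h1 h2 => by
    rw [integral_conj_mul_add_laplacian, ← schwartzFunctional_apply]; exact H ψ h1 h2
  simp_rw [integral_conj_mul_add_laplacian, ← schwartzFunctional_apply] at hcut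
  let χ : 𝓢(R3, ℂ) := (unitBump.hasCompactSupport.comp_left (g := ((↑) : ℝ → ℂ))
    (by simp)).toSchwartzMap (Complex.ofRealCLM.contDiff.comp unitBump.contDiff)
  have hχ : χ 0 = 1 := by
    change ((unitBump (0 : R3) : ℝ) : ℂ) = 1
    rw [unitBump.one_of_mem_closedBall (by simp [unitBump])]; simp
  refine ⟨schwartzFunctional g h χ, fun φ => ?_⟩
  have h1 := hcut (φ - φ 0 • χ) (by simp [hχ])
  rw [map_sub, map_smul, smul_eq_mul] at h1
  exact sub_eq_zero.1 h1

theorem locallyIntegrable_defect (g h : L2) (μ : ℂ) : LocallyIntegrable (fun p : R3 =>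
    conj (hat h p - (‖p‖ ^ 2 : ℝ) * hat g p) - μ) := by
  have l0 : LocallyIntegrable (fun p : R3 => ((‖p‖ ^ 2 : ℝ) : ℂ) * hat g p) := by
    rw [← locallyIntegrableOn_univ]
    exact ((locallyIntegrable_hat g).locallyIntegrableOn _).continuousOn_mul
      (Continuous.continuousOn (by fun_prop)) isOpen_univ.isLocallyClosed
  have l1 : LocallyIntegrable (fun p : R3 => hat h p - (‖p‖ ^ 2 : ℝ) * hat g p) :=
    (locallyIntegrable_hat h).sub l0
  refine LocallyIntegrable.sub (l1.mono ?_ ?_) (locallyIntegrable_const μ)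
  · exact Complex.continuous_conj.comp_aestronglyMeasurable l1.aestronglyMeasurable
  · exact Eventually.of_forall fun p => (RCLike.norm_conj _).le

/-- A pair annihilating `(Δψ, ψ)` for all test functions `ψ` away from the origin is related by
the free Laplacian up to a point charge. -/
theorem exists_charge_of_annihilates {g h : L2}
    (H : ∀ ψ : 𝓢(R3, ℂ), HasCompactSupport ψ → (0 : R3) ∉ tsupport ψ →
      schwartzFunctional g h ψ = 0) :
    ∃ ξ : ℂ, ∀ᵐ p : R3, hat h p = (‖p‖ ^ 2 : ℝ) * hat g p - ξ := by
  obtain ⟨κ, hdelta⟩ := exists_schwartzFunctional_eq_delta H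
  have hc : (fourierConst : ℂ) ≠ 0 := by exact_mod_cast fourierConst_pos.ne'
  have hπ : (((2 * Real.pi) ^ 3 : ℝ) : ℂ) ≠ 0 := by
    exact_mod_cast (by positivity : ((2 * Real.pi) ^ 3 : ℝ) ≠ 0)
  -- By Fourier inversion at `0` the evaluation `φ ↦ φ(0)` is integration of the transform against a
  -- constant. This `μ` is that constant, with the normalisation and the Jacobian divided out.
  obtain ⟨μ, hμ⟩ : ∃ μ : ℂ, κ = (((2 * Real.pi) ^ 3 : ℝ) : ℂ) * fourierConst * μ :=
    ⟨κ / ((((2 * Real.pi) ^ 3 : ℝ) : ℂ) * fourierConst), by field_simp⟩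
  refine ⟨-conj μ, ?_⟩
  have key : ∀ᵐ p : R3, conj (hat h p - (‖p‖ ^ 2 : ℝ) * hat g p) - μ = 0 := by
    refine ae_eq_zero_of_integral_contDiff_smul_eq_zero (locallyIntegrable_defect g h μ) ?_
    intro G hG hGc
    have hne : (2 * Real.pi : ℝ) ≠ 0 := by positivity
    -- The functional is applied to the inverse transform of the rescaled `G`, so that after `p ↦
    -- p/(2π)` the density is tested against `G` itself.
    let Gs : 𝓢(R3, ℂ) := ((hGc.comp_homeomorph (Homeomorph.smulOfNeZero _ hne)).comp_left
      (g := ((↑) : ℝ → ℂ)) (by simp)).toSchwartzMap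
      (Complex.ofRealCLM.contDiff.comp (hG.comp (g := G)
        (contDiff_const_smul (2 * Real.pi) : ContDiff ℝ ∞ fun w : R3 => (2 * Real.pi) • w)))
    have hGs : ∀ w, Gs w = (G ((2 * Real.pi) • w) : ℂ) := fun w => rfl
    have h1 := hdelta (𝓕⁻ Gs)
    rw [schwartzFunctional_apply, inner_add_inner_laplacian_eq,
      FourierTransform.fourier_fourierInv_eq] at h1
    have h0 : (𝓕⁻ Gs : 𝓢(R3, ℂ)) 0 = ∫ w : R3, Gs w := by
      rw [SchwartzMap.fourierInv_coe, Real.fourierInv_eq]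
      simp
    have h2 := integral_comp_two_pi_inv_smul Gs
    have h3 : ∀ p : R3, Gs ((2 * Real.pi)⁻¹ • p) = (G p : ℂ) := fun p => by
      rw [hGs, smul_smul, mul_inv_cancel₀ hne, one_smul]
    simp_rw [h3] at h1 h2
    rw [h0, hμ] at h1
    have i1 : Integrable (fun p : R3 => conj (hat h p - (‖p‖ ^ 2 : ℝ) * hat g p) * (G p : ℂ)) := by
      have := (locallyIntegrable_defect g h 0).integrable_smul_left_of_hasCompactSupport
        hG.continuous hGc
      refine this.congr (Eventually.of_forall fun p => ?_)
      simp only [sub_zero, Complex.real_smul]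
      ring
    have i2 : Integrable (fun p : R3 => (G p : ℂ)) :=
      (hG.continuous.integrable_of_hasCompactSupport hGc).ofReal
    have e : ∀ p : R3, G p • (conj (hat h p - (‖p‖ ^ 2 : ℝ) * hat g p) - μ) =
        conj (hat h p - (‖p‖ ^ 2 : ℝ) * hat g p) * (G p : ℂ) - μ * (G p : ℂ) := fun p => by
      rw [Complex.real_smul]; ring
    simp_rw [e]
    rw [integral_sub i1 (i2.const_mul _), integral_const_mul, h2]
    have e2 : ∀ p : R3, conj (hat h p - (‖p‖ ^ 2 : ℝ) * hat g p) * (fourierConst * (G p : ℂ)) =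
        fourierConst * (conj (hat h p - (‖p‖ ^ 2 : ℝ) * hat g p) * (G p : ℂ)) := fun p => by ring
    simp_rw [e2] at h1
    rw [integral_const_mul] at h1
    apply mul_left_cancel₀ hc
    linear_combination h1
  filter_upwards [key] with p hp
  have := congrArg conj hp
  simp only [map_sub, map_mul, Complex.conj_conj, map_zero] at this
  linear_combination this

/-! ### The domain of `H̊` and the graph of its adjoint -/

theorem isTestFunction_toLp {ψ : 𝓢(R3, ℂ)} (h1 : HasCompactSupport ψ)
    (h2 : (0 : R3) ∉ tsupport ψ) : IsTestFunction (ψ.toLp 2 : L2) :=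
  ⟨ψ, ψ.smooth ⊤, h1, h2, ψ.coeFn_toLp 2 volume⟩

theorem IsTestFunction.exists_schwartz {f : L2} (hf : IsTestFunction f) :
    ∃ ψ : 𝓢(R3, ℂ), HasCompactSupport ψ ∧ (0 : R3) ∉ tsupport ψ ∧ f = ψ.toLp 2 := by
  obtain ⟨φ, h1, h2, h3, h4⟩ := hf
  have h5 := SchwartzMap.coeFn_toLp (h2.toSchwartzMap h1) 2 volume
  exact ⟨h2.toSchwartzMap h1, h2, h3, Lp.ext (h4.trans h5.symm)⟩

theorem memLp_resolvent {lam : ℝ} (hlam : 0 < lam) :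
    MemLp (fun p : R3 => (((‖p‖ ^ 2 + lam : ℝ) : ℂ))⁻¹) 2 (volume : Measure R3) := by
  have hm : AEStronglyMeasurable (fun p : R3 => (((‖p‖ ^ 2 + lam : ℝ) : ℂ))⁻¹) volume :=
    (by fun_prop : Measurable fun p : R3 => (((‖p‖ ^ 2 + lam : ℝ) : ℂ))⁻¹).aestronglyMeasurable
  rw [memLp_two_iff_integrable_sq_norm hm]
  have e : ∀ p : R3, ‖(((‖p‖ ^ 2 + lam : ℝ) : ℂ))⁻¹‖ ^ 2 =
      (fun r : ℝ => ((r ^ 2 + lam) ^ 2)⁻¹) ‖p‖ := fun p => by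
    rw [norm_inv, Complex.norm_real, Real.norm_of_nonneg (by positivity), inv_pow]
  simp_rw [e]
  rw [integrable_fun_norm_addHaar volume (f := fun r : ℝ => ((r ^ 2 + lam) ^ 2)⁻¹)]
  refine Integrable.mono' (integrable_inv_one_add_sq.const_mul (max 1 lam⁻¹)).integrableOn
    (by fun_prop : Measurable _).aestronglyMeasurable (Eventually.of_forall fun r => ?_)
  rw [finrank_euclideanSpace_fin, smul_eq_mul, show 3 - 1 = 2 from rfl,
    Real.norm_of_nonneg (by positivity), ← div_eq_mul_inv, ← div_eq_mul_inv, div_le_div_iff₀ (by positivity) (by positivity)]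
  -- The constant `max 1 λ⁻¹` is chosen so that `1 + r² ≤ max 1 λ⁻¹ · (r² + λ)` holds for small and
  -- for large `λ`.
  have h1 : 1 ≤ max 1 lam⁻¹ := le_max_left _ _
  have h2 : 1 ≤ max 1 lam⁻¹ * lam := by
    calc 1 = lam⁻¹ * lam := (inv_mul_cancel₀ hlam.ne').symm
      _ ≤ _ := by gcongr; exact le_max_right _ _
  have h3 : r ^ 2 ≤ r ^ 2 + lam := by linarith
  have h4 : 1 + r ^ 2 ≤ max 1 lam⁻¹ * (r ^ 2 + lam) := by nlinarith [sq_nonneg r]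
  calc r ^ 2 * (1 + r ^ 2) ≤ (r ^ 2 + lam) * (max 1 lam⁻¹ * (r ^ 2 + lam)) := by gcongr
    _ = _ := by ring

theorem resolvent_ne_zero {lam : ℝ} (hlam : 0 < lam) (p : R3) :
    ((‖p‖ ^ 2 + lam : ℝ) : ℂ) ≠ 0 := by
  exact_mod_cast (by positivity : (‖p‖ ^ 2 + lam : ℝ) ≠ 0)

/-- Multiplication by `(p² + λ)⁻¹` preserves `L²`. -/
theorem MemLp.resolvent_mul {lam : ℝ} (hlam : 0 < lam) {F : R3 → ℂ}
    (hF : MemLp F 2 (volume : Measure R3)) :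
    MemLp (fun p : R3 => F p / ((‖p‖ ^ 2 + lam : ℝ) : ℂ)) 2 (volume : Measure R3) := by
  refine (hF.const_mul ((lam⁻¹ : ℝ) : ℂ)).mono (hF.1.div₀
    (by fun_prop : Measurable _).aestronglyMeasurable) (Eventually.of_forall fun p => ?_)
  rw [norm_div, norm_mul, Complex.norm_real, Complex.norm_real, Real.norm_of_nonneg (by positivity),
    Real.norm_of_nonneg (by positivity), div_eq_inv_mul]
  gcongr
  nlinarith [sq_nonneg ‖p‖]

/-- `(1 - Δ) f = F` in Fourier space. -/
def IsShiftedLaplacian (f F : L2) : Prop :=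
  ∀ᵐ p : R3, hat F p = ((1 + ‖p‖ ^ 2 : ℝ) : ℂ) * hat f p

theorem IsShiftedLaplacian.sobolevNorm_eq {f F : L2} (h : IsShiftedLaplacian f F) :
    sobolevNorm f = ‖F‖ₑ := by
  rw [← eLpNorm_hat]
  exact (eLpNorm_congr_ae h).symm

theorem IsShiftedLaplacian.sub {f F g G : L2} (h : IsShiftedLaplacian f F)
    (k : IsShiftedLaplacian g G) : IsShiftedLaplacian (f - g) (F - G) := by
  filter_upwards [h, k, hat_sub f g, hat_sub F G] with p h1 h2 h3 h4
  rw [h3, h4, h1, h2]; ring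

theorem IsShiftedLaplacian.add {f F g G : L2} (h : IsShiftedLaplacian f F)
    (k : IsShiftedLaplacian g G) : IsShiftedLaplacian (f + g) (F + G) := by
  filter_upwards [h, k, hat_add f g, hat_add F G] with p h1 h2 h3 h4
  rw [h3, h4, h1, h2]; ring

theorem IsShiftedLaplacian.smul {f F : L2} (c : ℂ) (h : IsShiftedLaplacian f F) :
    IsShiftedLaplacian (c • f) (c • F) := by
  filter_upwards [h, hat_smul c f, hat_smul c F] with p h1 h3 h4
  rw [h3, h4, h1]; ring

theorem isShiftedLaplacian_zero : IsShiftedLaplacian 0 0 := by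
  filter_upwards [hat_zero] with p h
  simp [h]

theorem isShiftedLaplacian_schwartz (ψ : 𝓢(R3, ℂ)) :
    IsShiftedLaplacian (ψ.toLp 2) ((ψ.toLp 2 : L2) - ((Δ ψ).toLp 2 : L2)) := by
  filter_upwards [hat_toLp_laplacian ψ, hat_sub (ψ.toLp 2) ((Δ ψ).toLp 2)] with p h1 h2
  rw [h2, h1]; push_cast; ring

theorem exists_isShiftedLaplacian {f : L2} (h : sobolevNorm f < ⊤) :
    ∃ F, IsShiftedLaplacian f F := by
  refine exists_hat_eq ⟨?_, h⟩
  exact (Continuous.aestronglyMeasurable (by fun_prop)).mul (hat_memLp f).1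

/-- The element of `L²` with Fourier transform `(1 + p²)⁻¹`. -/
def unitResolvent : L2 := (exists_hat_eq (memLp_resolvent one_pos)).choose

theorem hat_unitResolvent : ∀ᵐ p : R3, hat unitResolvent p = (((‖p‖ ^ 2 + 1 : ℝ) : ℂ))⁻¹ :=
  (exists_hat_eq (memLp_resolvent one_pos)).choose_spec

theorem IsShiftedLaplacian.conj_hat_mul {f F : L2} (h : IsShiftedLaplacian f F) :
    ∀ᵐ p : R3, conj (hat unitResolvent p) * hat F p = hat f p := by
  filter_upwards [h, hat_unitResolvent] with p h1 h2
  rw [h1, h2, ← Complex.ofReal_inv, Complex.conj_ofReal, ← mul_assoc, ← Complex.ofReal_mul,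
    add_comm 1, inv_mul_cancel₀ (by positivity)]
  simp

theorem IsShiftedLaplacian.integrable_hat {f F : L2} (h : IsShiftedLaplacian f F) :
    Integrable (hat f) :=
  (integrable_conj_hat_mul unitResolvent (hat_memLp F)).congr h.conj_hat_mul

/-- The value of `f` at the origin, up to normalisation, is thus a bounded functional of `(1 - Δ)f ∈
L²`. Approximation questions about `f(0)` become questions of orthogonality to one vector. -/
theorem IsShiftedLaplacian.integral_hat {f F : L2} (h : IsShiftedLaplacian f F) :
    ∫ p : R3, hat f p = inner ℂ unitResolvent F := by
  rw [inner_eq_integral_hat]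
  exact (integral_congr_ae h.conj_hat_mul).symm

theorem integral_hat_schwartz (ψ : 𝓢(R3, ℂ)) :
    ∫ p : R3, hat (ψ.toLp 2 : L2) p = fourierConst * ((2 * Real.pi) ^ 3 : ℝ) * ψ 0 := by
  have h0 : ψ 0 = ∫ w : R3, (𝓕 ψ : 𝓢(R3, ℂ)) w := by
    have e : 𝓕⁻ (𝓕 ψ : 𝓢(R3, ℂ)) = ψ := FourierTransform.fourierInv_fourier_eq ψ
    conv_lhs => rw [← e]
    rw [SchwartzMap.fourierInv_coe, Real.fourierInv_eq]
    simp
  rw [integral_congr_ae (hat_toLp_schwartz ψ), integral_const_mul,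
    integral_comp_two_pi_inv_smul, h0, mul_assoc]

/-- The images `(1 - Δ) φ` of the test functions away from the origin. -/
def testRange : Submodule ℂ L2 where
  carrier := {F | ∃ φ, IsTestFunction φ ∧ IsShiftedLaplacian φ F}
  add_mem' := by
    rintro F G ⟨φ, h1, h2⟩ ⟨ψ, k1, k2⟩
    exact ⟨φ + ψ, h1.add k1, h2.add k2⟩
  zero_mem' := ⟨0, ⟨0, contDiff_const, HasCompactSupport.zero, by simp, Lp.coeFn_zero _ _ _⟩,
    isShiftedLaplacian_zero⟩
  smul_mem' := by
    rintro c F ⟨φ, h1, h2⟩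
    exact ⟨c • φ, h1.smul c, h2.smul c⟩

theorem mem_testRange {φ F : L2} (h : IsTestFunction φ) (k : IsShiftedLaplacian φ F) :
    F ∈ testRange := ⟨φ, h, k⟩

theorem IsTestFunction.exists_isShiftedLaplacian {φ : L2} (h : IsTestFunction φ) :
    ∃ F, IsShiftedLaplacian φ F := by
  obtain ⟨ψ, -, -, rfl⟩ := h.exists_schwartz
  exact ⟨_, isShiftedLaplacian_schwartz ψ⟩

theorem sobolevNorm_lt_top_of_mem_H20 {f : L2} (hf : f ∈ H20) : sobolevNorm f < ⊤ := by
  obtain ⟨φ, h1, h2⟩ := hf 1 one_pos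
  obtain ⟨G, hG⟩ := h1.exists_isShiftedLaplacian
  have h3 : sobolevNorm φ < ⊤ := by
    rw [hG.sobolevNorm_eq]
    exact enorm_lt_top
  have h4 := sobolevNorm_add_le (f - φ) φ
  rw [sub_add_cancel] at h4
  exact h4.trans_lt (ENNReal.add_lt_top.2 ⟨h2.trans ENNReal.one_lt_top, h3⟩)

theorem inner_unitResolvent_testRange {F : L2} (hF : F ∈ testRange) :
    inner ℂ unitResolvent F = 0 := by
  obtain ⟨φ, h1, h2⟩ := hF
  obtain ⟨ψ, -, k2, rfl⟩ := h1.exists_schwartz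
  rw [← h2.integral_hat, integral_hat_schwartz, image_eq_zero_of_notMem_tsupport k2, mul_zero]

/-- Orthogonality of `v` to all `ψ - Δψ` says that the pair `(-v, v)` annihilates the test
functions. The charge relation then reads `(1 + p²) v̂ = -ξ`. -/
theorem testRange_orthogonal_le : testRangeᗮ ≤ ℂ ∙ unitResolvent := by
  intro v hv
  obtain ⟨ξ, hξ⟩ := exists_charge_of_annihilates (g := -v) (h := v) fun ψ h1 h2 => by
    have hm : ((ψ.toLp 2 : L2) - ((Δ ψ).toLp 2 : L2)) ∈ testRange :=
      ⟨_, isTestFunction_toLp h1 h2, isShiftedLaplacian_schwartz ψ⟩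
    have := (Submodule.mem_orthogonal' _ _).1 hv _ hm
    rw [schwartzFunctional_apply, inner_neg_left]
    rwa [inner_sub_right, sub_eq_add_neg] at this
  refine Submodule.mem_span_singleton.2 ⟨-ξ, eq_of_hat ?_⟩
  filter_upwards [hξ, hat_smul (-1) v, hat_smul (-ξ) unitResolvent, hat_unitResolvent] with
    p h1 h2 h3 h4
  rw [neg_one_smul] at h2
  have hne := resolvent_ne_zero one_pos p
  rw [h3, h4]
  rw [h2] at h1
  push_cast at h1 hne ⊢
  field_simp
  linear_combination -h1

/-- The closure is the double orthogonal complement, and the orthogonal complement lies in the line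
spanned by `unitResolvent`, which is itself orthogonal to the test range. -/
theorem mem_closure_testRange_iff {F : L2} :
    F ∈ closure (testRange : Set L2) ↔ inner ℂ unitResolvent F = 0 := by
  rw [← Submodule.topologicalClosure_coe, SetLike.mem_coe,
    ← Submodule.orthogonal_orthogonal_eq_closure]
  constructor
  · intro h
    refine (Submodule.mem_orthogonal _ _).1 h _ ((Submodule.mem_orthogonal' _ _).2 fun G hG => ?_)
    exact inner_unitResolvent_testRange hG
  · intro h
    refine (Submodule.mem_orthogonal _ _).2 fun v hv => ?_
    obtain ⟨c, rfl⟩ := Submodule.mem_span_singleton.1 (testRange_orthogonal_le hv)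
    rw [inner_smul_left, h, mul_zero]

/-- `H²₀(ℝ³ ∖ {0})` consists of the functions in `H²` that vanish at the origin. -/
theorem mem_H20_iff {f : L2} :
    f ∈ H20 ↔ ∃ F, IsShiftedLaplacian f F ∧ ∫ p : R3, hat f p = 0 := by
  constructor
  · intro hf
    obtain ⟨F, hF⟩ := exists_isShiftedLaplacian (sobolevNorm_lt_top_of_mem_H20 hf)
    refine ⟨F, hF, ?_⟩
    rw [hF.integral_hat, ← mem_closure_testRange_iff]
    -- The map `f ↦ (1 - Δ)f` carries the `H²`-norm to the `L²`-norm, so approximating `f` by test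
    -- functions is approximating `F` from `testRange`.
    refine EMetric.mem_closure_iff.2 fun ε hε => ?_
    obtain ⟨φ, h1, h2⟩ := hf ε hε
    obtain ⟨G, hG⟩ := h1.exists_isShiftedLaplacian
    refine ⟨G, mem_testRange h1 hG, ?_⟩
    rw [(hF.sub hG).sobolevNorm_eq] at h2
    rwa [edist_eq_enorm_sub]
  · rintro ⟨F, hF, h0⟩ ε hε
    rw [hF.integral_hat, ← mem_closure_testRange_iff] at h0
    obtain ⟨G, ⟨φ, h1, h2⟩, h3⟩ := EMetric.mem_closure_iff.1 h0 ε hε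
    refine ⟨φ, h1, ?_⟩
    rwa [(hF.sub h2).sobolevNorm_eq, ← edist_eq_enorm_sub]

theorem mem_domRestrict_graph {A : L2 →ₗ.[ℂ] L2} {S : Submodule ℂ L2} {x y : L2} :
    (x, y) ∈ (A.domRestrict S).graph ↔ x ∈ S ∧ (x, y) ∈ A.graph := by
  simp only [LinearPMap.mem_graph_iff]
  constructor
  · rintro ⟨z, rfl, rfl⟩
    exact ⟨z.2.1, ⟨z, z.2.2⟩, rfl, (LinearPMap.domRestrict_apply rfl).symm⟩
  · rintro ⟨hx, z, rfl, rfl⟩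
    exact ⟨⟨z, hx, z.2⟩, rfl, LinearPMap.domRestrict_apply rfl⟩

theorem mem_freeHamiltonian_graph {x y : L2} :
    (x, y) ∈ freeHamiltonian.graph ↔ ∀ᵐ p : R3, hat y p = (‖p‖ ^ 2 : ℝ) * hat x p := by
  rw [freeHamiltonian_graph]; rfl

theorem mem_Hring_graph {x y : L2} :
    (x, y) ∈ Hring.graph ↔ x ∈ H20 ∧ ∀ᵐ p : R3, hat y p = (‖p‖ ^ 2 : ℝ) * hat x p := by
  rw [Hring, mem_domRestrict_graph, mem_freeHamiltonian_graph]

theorem IsShiftedLaplacian.hat_sub_eq {f F : L2} (h : IsShiftedLaplacian f F) :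
    ∀ᵐ p : R3, hat (F - f) p = (‖p‖ ^ 2 : ℝ) * hat f p := by
  filter_upwards [h, hat_sub F f] with p h1 h2
  rw [h2, h1]; push_cast; ring

/-- Restricting to `H20` loses nothing: its elements have finite `H²`-norm, so `-Δf = F - f` is in
`L²`. -/
theorem Hring_domain : Hring.domain = H20 := by
  ext x
  rw [LinearPMap.mem_domain_iff]
  constructor
  · rintro ⟨y, hy⟩
    exact (mem_Hring_graph.1 hy).1
  · intro hx
    obtain ⟨F, hF, -⟩ := mem_H20_iff.1 hx
    exact ⟨F - x, mem_Hring_graph.2 ⟨hx, hF.hat_sub_eq⟩⟩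

theorem schwartz_mem_Hring_graph {ψ : 𝓢(R3, ℂ)} (h1 : HasCompactSupport ψ)
    (h2 : (0 : R3) ∉ tsupport ψ) : ((ψ.toLp 2 : L2), -((Δ ψ).toLp 2 : L2)) ∈ Hring.graph := by
  refine mem_Hring_graph.2 ⟨fun ε hε => ⟨_, isTestFunction_toLp h1 h2, ?_⟩, ?_⟩
  · rw [sub_self, isShiftedLaplacian_zero.sobolevNorm_eq]
    simpa using hε
  · filter_upwards [hat_toLp_laplacian ψ, hat_smul (-1) ((Δ ψ).toLp 2)] with p k1 k2
    rw [neg_one_smul] at k2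
    rw [k2, k1]; ring

theorem eq_zero_of_hat_ae_const {h : L2} {c : ℂ} (hc : ∀ᵐ p : R3, hat h p = c) : c = 0 := by
  have hm : MemLp (fun _ : R3 => c) 2 (volume : Measure R3) :=
    (memLp_congr_ae hc).1 (hat_memLp h)
  rcases (memLp_const_iff (by norm_num) (by norm_num)).1 hm with h | h
  · exact h
  · simp at h

/-- For `v` orthogonal to the domain, the pair `(0, v)` annihilates the test functions, so `v̂` is
constant; the only constant in `L²(ℝ³)` is zero. -/
theorem Hring_dense : Dense (Hring.domain : Set L2) := by
  rw [Submodule.dense_iff_topologicalClosure_eq_top, Submodule.topologicalClosure_eq_top_iff,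
    Submodule.eq_bot_iff]
  intro v hv
  obtain ⟨ξ, hξ⟩ := exists_charge_of_annihilates (g := 0) (h := v) fun ψ h1 h2 => by
    rw [schwartzFunctional_apply, inner_zero_left, add_zero]
    exact (Submodule.mem_orthogonal' _ _).1 hv _
      (LinearPMap.mem_domain_of_mem_graph (schwartz_mem_Hring_graph h1 h2))
  have hc : ∀ᵐ p : R3, hat v p = -ξ := by
    filter_upwards [hξ, hat_zero] with p h1 h2
    rw [h1, h2]; ring
  refine eq_zero_of_hat ?_
  rwa [eq_zero_of_hat_ae_const hc] at hc

/-- The pair `(g, h)` belongs to the graph of `H̊*` with charge `ξ`. -/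
def HasCharge (ξ : ℂ) (g h : L2) : Prop :=
  ∀ᵐ p : R3, hat h p = (‖p‖ ^ 2 : ℝ) * hat g p - ξ

/-- The adjoint of `H̊` acts as `-Δ` up to a point charge at the origin. -/
theorem mem_HringAdj_graph {g h : L2} : (g, h) ∈ HringAdj.graph ↔ ∃ ξ, HasCharge ξ g h := by
  rw [HringAdj, LinearPMap.adjoint_graph_eq_graph_adjoint Hring_dense, Submodule.mem_adjoint_iff]
  constructor
  · intro H
    refine exists_charge_of_annihilates fun ψ h1 h2 => ?_
    have := congrArg conj (H _ _ (schwartz_mem_Hring_graph h1 h2))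
    rw [map_sub, inner_conj_symm, inner_conj_symm, inner_neg_right, map_zero] at this
    rw [schwartzFunctional_apply]
    linear_combination -this
  · rintro ⟨ξ, hξ⟩ a b hab
    obtain ⟨h1, h2⟩ := mem_Hring_graph.1 hab
    obtain ⟨F, hF, h0⟩ := mem_H20_iff.1 h1
    dsimp only
    rw [inner_eq_integral_hat, inner_eq_integral_hat,
      ← integral_sub (integrable_conj_hat_mul _ (hat_memLp _))
        (integrable_conj_hat_mul _ (hat_memLp _))]
    -- The terms with `p²` cancel and leave the charge times `∫ conj â`, which vanishes because `a`
    -- is in `H20`.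
    have e : ∀ᵐ p : R3, conj (hat b p) * hat g p - conj (hat a p) * hat h p =
        ξ * conj (hat a p) := by
      filter_upwards [hξ, h2] with p k1 k2
      rw [k1, k2, map_mul, Complex.conj_ofReal]; ring
    rw [integral_congr_ae e, integral_const_mul, integral_conj, h0]
    simp

/-! ### Radial integrals -/

theorem three_smul_volume_ball_smul (z : ℂ) :
    Module.finrank ℝ R3 • (volume : Measure R3).real (Metric.ball 0 1) • z = 4 * Real.pi * z := by
  rw [finrank_euclideanSpace_fin, Measure.real, EuclideanSpace.volume_ball_fin_three]
  rw [ENNReal.toReal_mul, ENNReal.toReal_pow, ENNReal.toReal_ofReal (by positivity),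
    ENNReal.toReal_ofReal (by positivity),
    nsmul_eq_mul, Complex.real_smul]
  push_cast; ring

theorem integral_radial (f : ℝ → ℂ) :
    ∫ x : R3, f ‖x‖ = 4 * Real.pi * ∫ r in Set.Ioi (0 : ℝ), (r : ℂ) ^ 2 * f r := by
  rw [integral_fun_norm_addHaar, three_smul_volume_ball_smul, finrank_euclideanSpace_fin]
  simp [Complex.real_smul]

theorem integrable_radial_iff {f : ℝ → ℂ} :
    Integrable (fun x : R3 => f ‖x‖) ↔
      IntegrableOn (fun r : ℝ => (r : ℂ) ^ 2 * f r) (Set.Ioi 0) := by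
  rw [integrable_fun_norm_addHaar, finrank_euclideanSpace_fin]
  simp [Complex.real_smul]

theorem integral_ball_radial (f : ℝ → ℂ) {R : ℝ} (hR : 0 ≤ R) :
    ∫ x in Metric.ball (0 : R3) R, f ‖x‖ = 4 * Real.pi * ∫ r in (0 : ℝ)..R, (r : ℂ) ^ 2 * f r := by
  rw [← integral_indicator measurableSet_ball]
  have e : (Metric.ball (0 : R3) R).indicator (fun x => f ‖x‖) =
      fun x => (Set.Iio R).indicator f ‖x‖ := by
    ext x; simp [Set.indicator]
  have e2 : ∀ r : ℝ, (r : ℂ) ^ 2 * (Set.Iio R).indicator f r =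
      (Set.Iio R).indicator (fun r : ℝ => (r : ℂ) ^ 2 * f r) r := by
    intro r; simp [Set.indicator]
  rw [e, integral_radial]
  simp_rw [e2]
  rw [setIntegral_indicator measurableSet_Iio, Set.Ioi_inter_Iio,
    intervalIntegral.integral_of_le hR, integral_Ioc_eq_integral_Ioo]

/-- This is the source of the linear divergence `4πR`; as `arctan → π/2`, it also yields the
constant `-2π²√λ` that accompanies a charge. -/
theorem integral_ball_resolvent {lam : ℝ} (hlam : 0 < lam) {R : ℝ} (hR : 0 ≤ R) :
    ∫ p in Metric.ball (0 : R3) R, (((‖p‖ ^ 2 + lam : ℝ) : ℂ))⁻¹ =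
      ((4 * Real.pi * (R - √lam * Real.arctan (R / √lam)) : ℝ) : ℂ) := by
  have hs : 0 < √lam := Real.sqrt_pos.2 hlam
  have hsq : √lam ^ 2 = lam := Real.sq_sqrt hlam.le
  rw [integral_ball_radial (fun r => (((r ^ 2 + lam : ℝ) : ℂ))⁻¹) hR]
  have e : ∀ r : ℝ, (r : ℂ) ^ 2 * (((r ^ 2 + lam : ℝ) : ℂ))⁻¹ =
      ((r ^ 2 * (r ^ 2 + lam)⁻¹ : ℝ) : ℂ) := fun r => by push_cast; rfl
  simp_rw [e]
  rw [intervalIntegral.integral_ofReal]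
  have hd : ∀ r : ℝ, HasDerivAt (fun r => r - √lam * Real.arctan (r / √lam))
      (r ^ 2 * (r ^ 2 + lam)⁻¹) r := by
    intro r
    have h := (hasDerivAt_id r).sub ((((hasDerivAt_id r).div_const √lam).arctan).const_mul √lam)
    refine h.congr_deriv ?_
    have : (0 : ℝ) < r ^ 2 + lam := by positivity
    simp only [id]
    rw [div_pow, hsq]
    field_simp
    ring
  rw [intervalIntegral.integral_eq_sub_of_hasDerivAt (fun r _ => hd r)]
  · simp
  · refine Continuous.intervalIntegrable ?_ _ _
    have : ∀ r : ℝ, r ^ 2 + lam ≠ 0 := fun r => by positivity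
    fun_prop (disch := assumption)

theorem integral_resolvent_sq {lam : ℝ} (hlam : 0 < lam) :
    ∫ p : R3, (((‖p‖ ^ 2 + lam : ℝ) : ℂ) ^ 2)⁻¹ = ((Real.pi ^ 2 / √lam : ℝ) : ℂ) := by
  have hs : 0 < √lam := Real.sqrt_pos.2 hlam
  have hsq : √lam ^ 2 = lam := Real.sq_sqrt hlam.le
  rw [integral_radial (fun r => (((r ^ 2 + lam : ℝ) : ℂ) ^ 2)⁻¹)]
  have e : ∀ r : ℝ, (r : ℂ) ^ 2 * (((r ^ 2 + lam : ℝ) : ℂ) ^ 2)⁻¹ =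
      ((r ^ 2 * ((r ^ 2 + lam) ^ 2)⁻¹ : ℝ) : ℂ) := fun r => by push_cast; rfl
  simp_rw [e]
  rw [integral_complex_ofReal]
  have hd : ∀ r : ℝ, HasDerivAt (fun r => (Real.arctan (r / √lam) / √lam - r / (r ^ 2 + lam)) / 2)
      (r ^ 2 * ((r ^ 2 + lam) ^ 2)⁻¹) r := by
    intro r
    have hpos : (0 : ℝ) < r ^ 2 + lam := by positivity
    have h := (((((hasDerivAt_id r).div_const √lam).arctan).div_const √lam).sub
      ((hasDerivAt_id r).div (((hasDerivAt_id r).pow 2).add_const lam) hpos.ne')).div_const 2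
    refine h.congr_deriv ?_
    have h1 : 1 + (id r / √lam) ^ 2 = (r ^ 2 + lam) / lam := by
      simp only [id]; rw [div_pow, hsq]; field_simp; ring
    rw [h1]
    simp only [Pi.pow_apply, id]
    have h2 : 1 / ((r ^ 2 + lam) / lam) * (1 / √lam) / √lam = 1 / (r ^ 2 + lam) := by
      have : √lam * √lam = lam := by rw [← sq, hsq]
      field_simp
      linear_combination -hsq
    rw [h2]
    field_simp
    push_cast
    ring
  have hlim : Tendsto (fun r => (Real.arctan (r / √lam) / √lam - r / (r ^ 2 + lam)) / 2) atTop
      (𝓝 ((Real.pi / 2 / √lam - 0) / 2)) := by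
    have l1 : Tendsto (fun r : ℝ => Real.arctan (r / √lam)) atTop (𝓝 (Real.pi / 2)) :=
      (tendsto_nhds_of_tendsto_nhdsWithin Real.tendsto_arctan_atTop).comp
        (tendsto_id.atTop_div_const hs)
    have l2 : Tendsto (fun r : ℝ => r / (r ^ 2 + lam)) atTop (𝓝 0) := by
      refine squeeze_zero' ?_ ?_ tendsto_inv_atTop_zero
      · filter_upwards [eventually_ge_atTop 0] with r hr
        positivity
      · filter_upwards [eventually_gt_atTop 0] with r hr
        rw [div_le_iff₀ (by positivity)]
        field_simp
        linarith
    exact ((l1.div_const _).sub l2).div_const 2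
  rw [integral_Ioi_of_hasDerivAt_of_nonneg' (fun r _ => hd r) (fun r _ => by positivity) hlim]
  rw [← Complex.ofReal_ofNat, ← Complex.ofReal_mul, ← Complex.ofReal_mul]
  congr 1
  simp
  field_simp
  ring

/-! ### Boundary data of the elements of `D(H̊*)` -/

/-- `∫_{|p| < R} ĝ(p) dp = 4 π ξ R + c + o(1)` as `R → ∞`. -/
def HasRegularPart (ξ c : ℂ) (g : L2) : Prop :=
  Tendsto (fun R : ℝ => cutoffIntegral g R - 4 * Real.pi * ξ * R) atTop (𝓝 c)

/-- Dividing the difference of the two expansions by `R` forces equal charges; uniqueness of limits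
then gives equal constants. -/
theorem HasRegularPart.unique {ξ ξ' c c' : ℂ} {g : L2} (h : HasRegularPart ξ c g)
    (h' : HasRegularPart ξ' c' g) : ξ = ξ' ∧ c = c' := by
  have hinv : Tendsto (fun R : ℝ => ((R⁻¹ : ℝ) : ℂ)) atTop (𝓝 0) := by
    have := (Complex.continuous_ofReal.tendsto 0).comp tendsto_inv_atTop_zero
    rw [Complex.ofReal_zero] at this
    exact this
  have hd := (h.sub h')
  have h1 : Tendsto (fun R : ℝ => 4 * Real.pi * (ξ' - ξ)) atTop (𝓝 ((c - c') * 0)) := by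
    refine (hd.mul hinv).congr' ?_
    filter_upwards [eventually_gt_atTop 0] with R hR
    have hR' : (R : ℂ) ≠ 0 := by exact_mod_cast hR.ne'
    push_cast
    field_simp
    ring
  rw [mul_zero] at h1
  have h2 := tendsto_nhds_unique h1 tendsto_const_nhds
  have hπ : (4 * Real.pi : ℂ) ≠ 0 := by exact_mod_cast (by positivity : (4 * Real.pi : ℝ) ≠ 0)
  have h3 : ξ = ξ' := (sub_eq_zero.1 ((mul_eq_zero.1 h2.symm).resolve_left hπ)).symm
  subst h3
  exact ⟨rfl, tendsto_nhds_unique h h'⟩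

theorem tmsAsymptotics_iff_hasRegularPart {α : ℝ} {ξ : ℂ} {g : L2} :
    TMSAsymptotics α ξ g ↔ HasRegularPart ξ (8 * Real.pi ^ 3 * α * ξ) g := by
  unfold TMSAsymptotics HasRegularPart
  rw [tendsto_iff_norm_sub_tendsto_zero (b := 8 * (Real.pi : ℂ) ^ 3 * α * ξ),
    tendsto_zero_iff_norm_tendsto_zero]
  refine tendsto_congr fun R => ?_
  congr 1; ring

theorem HasRegularPart.tmsAsymptotics_iff {α : ℝ} {ξ ξ' c : ℂ} {g : L2}
    (h : HasRegularPart ξ c g) :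
    TMSAsymptotics α ξ' g ↔ ξ' = ξ ∧ c = 8 * Real.pi ^ 3 * α * ξ := by
  rw [tmsAsymptotics_iff_hasRegularPart]
  constructor
  · intro h'
    obtain ⟨rfl, rfl⟩ := h.unique h'
    exact ⟨rfl, rfl⟩
  · rintro ⟨rfl, rfl⟩
    exact h

theorem HasRegularPart.mem_tmsReal_iff {α : ℝ} {ξ c : ℂ} {g : L2} (h : HasRegularPart ξ c g) :
    g ∈ tmsReal α ↔ c = 8 * Real.pi ^ 3 * α * ξ := by
  change (∃ ξ', TMSAsymptotics α ξ' g) ↔ _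
  simp_rw [h.tmsAsymptotics_iff]
  simp

theorem HasRegularPart.mem_tmsInfty_iff {ξ c : ℂ} {g : L2} (h : HasRegularPart ξ c g) :
    g ∈ tmsInfty ↔ ξ = 0 := by
  constructor
  · rintro ⟨c', hc'⟩
    have : HasRegularPart 0 c' g := by simpa [HasRegularPart] using hc'
    exact (h.unique this).1
  · rintro rfl
    exact ⟨c, by simpa [HasRegularPart] using h⟩

theorem tendsto_integral_ball {F : R3 → ℂ} (hF : Integrable F) :
    Tendsto (fun R : ℝ => ∫ p in Metric.ball (0 : R3) R, F p) atTop (𝓝 (∫ p, F p)) :=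
  (aecover_ball tendsto_id).integral_tendsto_of_countably_generated hF

theorem integrable_resolvent_sq {lam : ℝ} (hlam : 0 < lam) :
    Integrable (fun p : R3 => (((‖p‖ ^ 2 + lam : ℝ) : ℂ) ^ 2)⁻¹) := by
  refine ((memLp_resolvent hlam).integrable_mul (memLp_resolvent hlam)).congr
    (Eventually.of_forall fun p => ?_)
  simp [sq]

theorem memLp_resolvent_sq {lam : ℝ} (hlam : 0 < lam) :
    MemLp (fun p : R3 => (((‖p‖ ^ 2 + lam : ℝ) : ℂ) ^ 2)⁻¹) 2 (volume : Measure R3) := by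
  refine (memLp_congr_ae (Eventually.of_forall fun p => ?_)).1
    (MemLp.resolvent_mul hlam (memLp_resolvent hlam))
  rw [div_eq_mul_inv, ← mul_inv, ← sq]

/-- The decomposition `ĝ = f̂ + η (p² + λ)⁻² + ξ (p² + λ)⁻¹`. -/
def IsDecomposition (lam : ℝ) (f : L2) (η ξ : ℂ) (g : L2) : Prop :=
  ∀ᵐ p : R3, hat g p = hat f p + η / ((‖p‖ ^ 2 + lam : ℝ) : ℂ) ^ 2 +
    ξ / ((‖p‖ ^ 2 + lam : ℝ) : ℂ)

/-- Term by term: `f̂` has total integral zero since `f` is in `H20`, the `η` term converges to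
`π²η/√λ`, and the `ξ` term contributes `4πξR - 2π²√λ ξ`. -/
theorem IsDecomposition.hasRegularPart {lam : ℝ} (hlam : 0 < lam) {f g : L2} {η ξ : ℂ}
    (hf : f ∈ H20) (h : IsDecomposition lam f η ξ g) :
    HasRegularPart ξ ((Real.pi : ℂ) ^ 2 / (√lam : ℝ) * η -
      2 * (Real.pi : ℂ) ^ 2 * (√lam : ℝ) * ξ) g := by
  have hs : 0 < √lam := Real.sqrt_pos.2 hlam
  obtain ⟨F, hF, h0⟩ := mem_H20_iff.1 hf
  have l1 := tendsto_integral_ball hF.integrable_hat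
  have l2 := (tendsto_integral_ball (integrable_resolvent_sq hlam)).const_mul η
  rw [h0] at l1
  rw [integral_resolvent_sq hlam] at l2
  have l3 : Tendsto (fun R : ℝ => ((Real.arctan (R / √lam) : ℝ) : ℂ)) atTop
      (𝓝 ((Real.pi / 2 : ℝ) : ℂ)) :=
    (Complex.continuous_ofReal.tendsto _).comp
      ((tendsto_nhds_of_tendsto_nhdsWithin Real.tendsto_arctan_atTop).comp
        (tendsto_id.atTop_div_const hs))
  have l4 := (l1.add l2).sub (l3.const_mul (4 * Real.pi * √lam * ξ : ℂ))
  have e : (0 + η * ((Real.pi ^ 2 / √lam : ℝ) : ℂ) -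
      (4 * Real.pi * √lam * ξ : ℂ) * ((Real.pi / 2 : ℝ) : ℂ)) =
      (Real.pi : ℂ) ^ 2 / (√lam : ℝ) * η - 2 * (Real.pi : ℂ) ^ 2 * (√lam : ℝ) * ξ := by
    push_cast; ring
  rw [e] at l4
  refine l4.congr' ?_
  filter_upwards [eventually_ge_atTop 0] with R hR
  have hres : IntegrableOn (fun p : R3 => (((‖p‖ ^ 2 + lam : ℝ) : ℂ))⁻¹)
      (Metric.ball (0 : R3) R) := by
    have : IsFiniteMeasure ((volume : Measure R3).restrict (Metric.ball (0 : R3) R)) :=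
      ⟨by rw [Measure.restrict_apply_univ]; exact measure_ball_lt_top⟩
    exact ((memLp_resolvent hlam).restrict _).integrable (by norm_num)
  have hcut : cutoffIntegral g R = ∫ p in Metric.ball (0 : R3) R, (hat f p +
      η * (((‖p‖ ^ 2 + lam : ℝ) : ℂ) ^ 2)⁻¹ + ξ * (((‖p‖ ^ 2 + lam : ℝ) : ℂ))⁻¹) :=
    integral_congr_ae (ae_restrict_of_ae h)
  rw [hcut, integral_add, integral_add, integral_const_mul, integral_const_mul,
    integral_ball_resolvent hlam hR]
  · push_cast; ring
  · exact hF.integrable_hat.integrableOn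
  · exact (integrable_resolvent_sq hlam).integrableOn.const_mul η
  · exact hF.integrable_hat.integrableOn.add ((integrable_resolvent_sq hlam).integrableOn.const_mul η)
  · exact Integrable.const_mul hres ξ

/-- With `F = h + λg` one has `ĝ = F̂/(p² + λ) + ξ/(p² + λ)`. The first summand is in `H²`, and `η`
is the multiple of `(p² + λ)⁻²` whose removal makes its integral vanish. -/
theorem HasCharge.exists_decomposition {lam : ℝ} (hlam : 0 < lam) {g h : L2} {ξ : ℂ}
    (H : HasCharge ξ g h) : ∃ f ∈ H20, ∃ η : ℂ, IsDecomposition lam f η ξ g := by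
  have hs : 0 < √lam := Real.sqrt_pos.2 hlam
  set F : L2 := h + (lam : ℂ) • g with hFdef
  have hF : ∀ᵐ p : R3, hat F p = ((‖p‖ ^ 2 + lam : ℝ) : ℂ) * hat g p - ξ := by
    filter_upwards [H, hat_add h ((lam : ℂ) • g), hat_smul (lam : ℂ) g] with p h1 h2 h3
    rw [h2, h3, h1]; push_cast; ring
  have m0 := hat_memLp F
  have m1 := MemLp.resolvent_mul hlam m0
  have i1 : Integrable (fun p : R3 => hat F p / ((‖p‖ ^ 2 + lam : ℝ) : ℂ)) :=
    m0.integrable_mul (memLp_resolvent hlam)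
  set η : ℂ := (∫ p : R3, hat F p / ((‖p‖ ^ 2 + lam : ℝ) : ℂ)) / ((Real.pi ^ 2 / √lam : ℝ) : ℂ)
    with hη
  have hηeq : (∫ p : R3, hat F p / ((‖p‖ ^ 2 + lam : ℝ) : ℂ)) =
      η * ((Real.pi ^ 2 / √lam : ℝ) : ℂ) := by
    rw [hη, div_mul_cancel₀]
    exact_mod_cast (by positivity : (Real.pi ^ 2 / √lam : ℝ) ≠ 0)
  obtain ⟨f, hf⟩ := exists_hat_eq (m1.sub ((memLp_resolvent_sq hlam).const_mul η))
  -- This is `(1 + p²) f̂`, expanded with `1 + p² = (p² + λ) + (1 - λ)` so that each summand is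
  -- visibly square integrable.
  have mF := (m0.add (m1.const_mul (1 - lam : ℂ))).sub
    ((((memLp_resolvent hlam).add ((memLp_resolvent_sq hlam).const_mul (1 - lam : ℂ)))).const_mul η)
  obtain ⟨G, hG⟩ := exists_hat_eq mF
  have hfG : IsShiftedLaplacian f G := by
    filter_upwards [hf, hG] with p h1 h2
    rw [h1, h2]
    have hne := resolvent_ne_zero hlam p
    simp only [Pi.add_apply, Pi.sub_apply]
    push_cast at hne ⊢
    field_simp
    ring
  refine ⟨f, mem_H20_iff.2 ⟨G, hfG, ?_⟩, η, ?_⟩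
  · rw [integral_congr_ae hf]
    change ∫ p : R3, (hat F p / ((‖p‖ ^ 2 + lam : ℝ) : ℂ) -
      η * (((‖p‖ ^ 2 + lam : ℝ) : ℂ) ^ 2)⁻¹) = 0
    rw [integral_sub i1 ((integrable_resolvent_sq hlam).const_mul η), integral_const_mul,
      integral_resolvent_sq hlam, hηeq, sub_self]
  · filter_upwards [hf, hF] with p h1 h2
    rw [h1]
    simp only [Pi.sub_apply]
    rw [h2]
    have hne := resolvent_ne_zero hlam p
    field_simp
    ring

/-- `(g, h)` is in the graph of `H̊*`, with charge `ξ` and regular part `c` at the origin. -/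
def BoundaryData (ξ c : ℂ) (g h : L2) : Prop := HasCharge ξ g h ∧ HasRegularPart ξ c g

theorem HasCharge.exists_boundaryData {g h : L2} {ξ : ℂ} (H : HasCharge ξ g h) :
    ∃ c, BoundaryData ξ c g h := by
  obtain ⟨f, hf, η, hd⟩ := H.exists_decomposition one_pos
  exact ⟨_, H, hd.hasRegularPart one_pos hf⟩

theorem mem_HringAdj_graph_iff_boundaryData {g h : L2} :
    (g, h) ∈ HringAdj.graph ↔ ∃ ξ c, BoundaryData ξ c g h := by
  rw [mem_HringAdj_graph]
  exact ⟨fun ⟨ξ, H⟩ => ⟨ξ, H.exists_boundaryData⟩, fun ⟨ξ, _, H, _⟩ => ⟨ξ, H⟩⟩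

/-- Surjectivity of the boundary map supplies the test elements for the self-adjointness argument.
With `λ = 1` and `f = 0` the formula for the regular part is solved for `η`. -/
theorem exists_boundaryData (ξ c : ℂ) : ∃ g h, BoundaryData ξ c g h := by
  obtain ⟨η, hη⟩ : ∃ η : ℂ, (Real.pi : ℂ) ^ 2 / (√1 : ℝ) * η -
      2 * (Real.pi : ℂ) ^ 2 * (√1 : ℝ) * ξ = c := by
    refine ⟨(c + 2 * (Real.pi : ℂ) ^ 2 * ξ) / (Real.pi : ℂ) ^ 2, ?_⟩
    have hπ : (Real.pi : ℂ) ≠ 0 := by exact_mod_cast Real.pi_ne_zero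
    simp only [Real.sqrt_one, Complex.ofReal_one]
    field_simp
    ring
  obtain ⟨g, hg⟩ := exists_hat_eq (((memLp_resolvent_sq one_pos).const_mul η).add
    ((memLp_resolvent one_pos).const_mul ξ))
  obtain ⟨k, hk⟩ := exists_hat_eq ((memLp_resolvent one_pos).const_mul η)
  refine ⟨g, k - g, ?_, ?_⟩
  · filter_upwards [hg, hk, hat_sub k g] with p h1 h2 h3
    rw [h3, h2, h1]
    have hne := resolvent_ne_zero one_pos p
    simp only [Pi.add_apply]
    push_cast at hne ⊢
    field_simp
    ring
  · rw [← hη]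
    refine IsDecomposition.hasRegularPart one_pos (zero_mem H20) ?_
    filter_upwards [hg, hat_zero] with p h1 h2
    rw [h1, h2, zero_add]
    rfl

/-- Green's formula. -/
theorem BoundaryData.inner_sub_inner {ξ c ξ' c' : ℂ} {g h g' h' : L2} (H : BoundaryData ξ c g h)
    (H' : BoundaryData ξ' c' g' h') :
    inner ℂ g' h - inner ℂ h' g = conj ξ' * c - ξ * conj c' := by
  rw [inner_eq_integral_hat, inner_eq_integral_hat]
  have i1 := integrable_conj_hat_mul g' (hat_memLp h)
  have i2 := integrable_conj_hat_mul h' (hat_memLp g)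
  rw [← integral_sub i1 i2]
  -- The surviving terms `conj ξ' · ĝ` and `ξ · conj ĝ'` need not be integrable separately. The
  -- integral is therefore taken over balls, where their divergences `4πR ξ conj ξ'` cancel.
  refine tendsto_nhds_unique (tendsto_integral_ball (i1.sub i2)) ?_
  have l1 := (H.2.const_mul (conj ξ')).sub
    (((Complex.continuous_conj.tendsto _).comp H'.2).const_mul ξ)
  refine l1.congr fun R => ?_
  have e : ∀ᵐ p : R3, conj (hat g' p) * hat h p - conj (hat h' p) * hat g p =
      conj ξ' * hat g p - ξ * conj (hat g' p) := by
    filter_upwards [H.1, H'.1] with p h1 h2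
    rw [h1, h2, map_sub, map_mul, Complex.conj_ofReal]; ring
  change _ = ∫ p in Metric.ball (0 : R3) R,
    (conj (hat g' p) * hat h p - conj (hat h' p) * hat g p)
  rw [integral_congr_ae (ae_restrict_of_ae e), integral_sub, integral_const_mul,
    integral_const_mul, integral_conj]
  · simp only [Function.comp_apply, map_sub, map_mul, Complex.conj_ofReal, map_ofNat,
      cutoffIntegral]
    ring
  · exact (hat_integrableOn_ball g R).const_mul _
  · exact Integrable.const_mul (LinearIsometryEquiv.integrable_comp_iff Complex.conjLIE |>.2
      (hat_integrableOn_ball g' R)) ξ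

/-! ### The graphs of the TMS operators -/

theorem mem_HTMS_coe_graph {α : ℝ} {g h : L2} :
    (g, h) ∈ (HTMS α).graph ↔ ∃ ξ, BoundaryData ξ (8 * Real.pi ^ 3 * α * ξ) g h := by
  rw [HTMS, mem_domRestrict_graph, mem_HringAdj_graph_iff_boundaryData]
  change g ∈ tmsReal α ∧ _ ↔ _
  constructor
  · rintro ⟨h1, ξ, c, H⟩
    rw [H.2.mem_tmsReal_iff] at h1
    exact ⟨ξ, h1 ▸ H⟩
  · rintro ⟨ξ, H⟩
    exact ⟨H.2.mem_tmsReal_iff.2 rfl, ξ, _, H⟩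

theorem mem_HTMS_infty_graph {g h : L2} :
    (g, h) ∈ (HTMS OnePoint.infty).graph ↔ ∃ c, BoundaryData 0 c g h := by
  rw [HTMS, mem_domRestrict_graph, mem_HringAdj_graph_iff_boundaryData]
  change g ∈ tmsInfty ∧ _ ↔ _
  constructor
  · rintro ⟨h1, ξ, c, H⟩
    rw [H.2.mem_tmsInfty_iff] at h1
    exact ⟨c, h1 ▸ H⟩
  · rintro ⟨c, H⟩
    exact ⟨H.2.mem_tmsInfty_iff.2 rfl, 0, c, H⟩

theorem mem_HTMS_coe_domain {α : ℝ} {g : L2} :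
    g ∈ (HTMS α).domain ↔ g ∈ tmsReal α ∧ g ∈ HringAdj.domain := Iff.rfl

theorem mem_HTMS_infty_domain {g : L2} :
    g ∈ (HTMS OnePoint.infty).domain ↔ g ∈ tmsInfty ∧ g ∈ HringAdj.domain := Iff.rfl

theorem charge_relation_iff {lam : ℝ} (hlam : 0 < lam) (α : ℝ) (η ξ : ℂ) :
    ((Real.pi : ℂ) ^ 2 / (√lam : ℝ) * η - 2 * (Real.pi : ℂ) ^ 2 * (√lam : ℝ) * ξ =
      8 * (Real.pi : ℂ) ^ 3 * α * ξ) ↔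
    η = ((2 * √lam * (4 * Real.pi * α + √lam) : ℝ) : ℂ) * ξ := by
  have hs : ((√lam : ℝ) : ℂ) ≠ 0 := by exact_mod_cast (Real.sqrt_pos.2 hlam).ne'
  have hπ : (Real.pi : ℂ) ≠ 0 := by exact_mod_cast Real.pi_ne_zero
  push_cast
  constructor
  · intro h
    field_simp at h
    apply mul_left_cancel₀ hπ
    linear_combination Real.pi * h
  · rintro rfl
    field_simp
    ring

theorem IsDecomposition.domain_iff {lam : ℝ} (hlam : 0 < lam) {f g : L2} {η ξ : ℂ}
    (hg : g ∈ HringAdj.domain) (hf : f ∈ H20) (h : IsDecomposition lam f η ξ g) (α : ℝ) :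
    (g ∈ (HTMS α).domain ↔ TMSAsymptotics α ξ g) ∧
    (TMSAsymptotics α ξ g ↔ 8 * (Real.pi : ℂ) ^ 3 * α * ξ =
      -2 * (Real.pi : ℂ) ^ 2 * (√lam : ℝ) * ξ + (Real.pi : ℂ) ^ 2 / (√lam : ℝ) * η) ∧
    (TMSAsymptotics α ξ g ↔ η = ((2 * √lam * (4 * Real.pi * α + √lam) : ℝ) : ℂ) * ξ) := by
  have hr := h.hasRegularPart hlam hf
  rw [mem_HTMS_coe_domain, hr.mem_tmsReal_iff, hr.tmsAsymptotics_iff,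
    charge_relation_iff hlam]
  refine ⟨by tauto, ?_, by tauto⟩
  rw [← charge_relation_iff hlam]
  constructor
  · rintro ⟨-, h⟩
    linear_combination -h
  · intro h
    exact ⟨rfl, by linear_combination -h⟩

/-- The charge relation rewrites the action of the adjoint as `(p² + λ)(ĝ - ξ/(p² + λ)) - λĝ`. This
is the action in `extGraph` once the boundary condition has turned `η` into `τξ`. -/
theorem HTMS_coe_eq_Hext {lam : ℝ} (hlam : 0 < lam) (α : ℝ) :
    HTMS α = Hext lam ((2 * √lam * (4 * Real.pi * α + √lam) : ℝ) : OnePoint ℝ) := by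
  refine LinearPMap.eq_of_eq_graph ?_
  rw [Hext_coe_graph hlam]
  ext ⟨g, h⟩
  rw [mem_HTMS_coe_graph]
  change _ ↔ ∃ f ∈ Hring.domain, _
  rw [Hring_domain]
  constructor
  · rintro ⟨ξ, H⟩
    obtain ⟨f, hf, η, hd⟩ := H.1.exists_decomposition hlam
    have hη := (charge_relation_iff hlam α η ξ).1 ((hd.hasRegularPart hlam hf).unique H.2).2
    refine ⟨f, hf, ξ, ?_⟩
    filter_upwards [hd, H.1] with p h1 h2
    have hne := resolvent_ne_zero hlam p
    rw [hη] at h1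
    refine ⟨h1, ?_⟩
    have h3 : hat h p + lam * hat g p = ((‖p‖ ^ 2 + lam : ℝ) : ℂ) *
        (hat g p - ξ / ((‖p‖ ^ 2 + lam : ℝ) : ℂ)) := by
      rw [mul_sub, mul_div_cancel₀ _ hne, h2]; push_cast; ring
    rw [h3, h1]; ring
  · rintro ⟨f, hf, ξ, H⟩
    have hd : IsDecomposition lam f (((2 * √lam * (4 * Real.pi * α + √lam) : ℝ) : ℂ) * ξ) ξ g :=
      H.mono fun p hp => hp.1
    have hr := hd.hasRegularPart hlam hf
    rw [(charge_relation_iff hlam α _ ξ).2 rfl] at hr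
    refine ⟨ξ, ?_, hr⟩
    filter_upwards [H] with p ⟨h1, h2⟩
    have hne := resolvent_ne_zero hlam p
    have h3 : hat h p + lam * hat g p = ((‖p‖ ^ 2 + lam : ℝ) : ℂ) *
        (hat g p - ξ / ((‖p‖ ^ 2 + lam : ℝ) : ℂ)) := by
      rw [h2, h1]; ring
    rw [mul_sub, mul_div_cancel₀ _ hne] at h3
    push_cast at h3 ⊢
    linear_combination h3

theorem HTMS_infty_eq_freeHamiltonian : HTMS OnePoint.infty = freeHamiltonian := by
  refine LinearPMap.eq_of_eq_graph ?_
  ext ⟨g, h⟩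
  rw [mem_HTMS_infty_graph, mem_freeHamiltonian_graph]
  have e : HasCharge 0 g h ↔ ∀ᵐ p : R3, hat h p = (‖p‖ ^ 2 : ℝ) * hat g p := by
    simp [HasCharge]
  rw [← e]
  exact ⟨fun ⟨c, H⟩ => H.1, fun H => H.exists_boundaryData⟩

/-! ### Self-adjoint extensions -/

theorem Hring_le_HTMS (α : OnePoint ℝ) : Hring ≤ HTMS α := by
  refine LinearPMap.le_of_le_graph ?_
  rintro ⟨g, h⟩ H
  obtain ⟨h1, h2⟩ := mem_Hring_graph.1 H
  have hr : HasRegularPart 0 0 g := by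
    have hd : IsDecomposition 1 g 0 0 g := Eventually.of_forall fun p => by simp
    simpa using hd.hasRegularPart one_pos h1
  have hb : BoundaryData 0 0 g h := ⟨by simpa [HasCharge] using h2, hr⟩
  induction α using OnePoint.rec with
  | infty => exact mem_HTMS_infty_graph.2 ⟨0, hb⟩
  | coe α => exact mem_HTMS_coe_graph.2 ⟨0, by simpa using hb⟩

theorem adjoint_graph_antitone {A B : L2 →ₗ.[ℂ] L2} (hA : Dense (A.domain : Set L2)) (h : A ≤ B) :
    B.adjoint ≤ A.adjoint := by
  have hB : Dense (B.domain : Set L2) := hA.mono h.1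
  refine LinearPMap.le_of_le_graph ?_
  rw [LinearPMap.adjoint_graph_eq_graph_adjoint hA, LinearPMap.adjoint_graph_eq_graph_adjoint hB]
  intro x hx
  rw [Submodule.mem_adjoint_iff] at hx ⊢
  exact fun a b hab => hx a b (LinearPMap.le_graph_of_le h hab)

/-- The boundary condition is a line in `ℂ²` equal to its own annihilator under the boundary form.
One direction uses that `α` is real; for the other, a single test element with data `(0, 1)` or `(1,
8π³α)` suffices. -/
theorem mem_HTMS_graph_of_green {α : OnePoint ℝ} {ξ' c' : ℂ} {g' h' : L2}
    (H' : BoundaryData ξ' c' g' h') : (g', h') ∈ (HTMS α).graph ↔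
      ∀ ξ c g h, BoundaryData ξ c g h → (g, h) ∈ (HTMS α).graph →
        conj ξ * c' - ξ' * conj c = 0 := by
  induction α using OnePoint.rec with
  | infty =>
    simp only [mem_HTMS_infty_graph]
    constructor
    · rintro ⟨d', K'⟩ ξ c g h H ⟨d, K⟩
      rw [(H.2.unique K.2).1, (H'.2.unique K'.2).1]
      simp
    · intro hyp
      obtain ⟨g, h, H⟩ := exists_boundaryData 0 1
      have := hyp 0 1 g h H ⟨1, H⟩
      have hξ : ξ' = 0 := by simpa using this
      exact ⟨c', hξ ▸ H'⟩
  | coe α =>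
    simp only [mem_HTMS_coe_graph]
    constructor
    · rintro ⟨d', K'⟩ ξ c g h H ⟨d, K⟩
      obtain ⟨rfl, rfl⟩ := H.2.unique K.2
      obtain ⟨rfl, rfl⟩ := H'.2.unique K'.2
      simp only [map_mul, map_pow, Complex.conj_ofReal, map_ofNat]
      ring
    · intro hyp
      obtain ⟨g, h, H⟩ := exists_boundaryData 1 (8 * Real.pi ^ 3 * α * 1)
      have := hyp 1 _ g h H ⟨1, H⟩
      simp only [map_one, map_mul, map_pow, Complex.conj_ofReal, map_ofNat] at this
      have hc : c' = 8 * Real.pi ^ 3 * α * ξ' := by linear_combination this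
      exact ⟨ξ', hc ▸ H'⟩

theorem HTMS_dense (α : OnePoint ℝ) : Dense ((HTMS α).domain : Set L2) :=
  Hring_dense.mono (Hring_le_HTMS α).1

theorem HTMS_le_HringAdj (α : OnePoint ℝ) : HTMS α ≤ HringAdj := LinearPMap.domRestrict_le

/-- Elements of the adjoint lie in the domain of `H̊*` and so have boundary data. Green's formula
then makes membership in the adjoint the annihilator condition of `mem_HTMS_graph_of_green`. -/
theorem isSelfAdjoint_HTMS (α : OnePoint ℝ) : IsSelfAdjoint (HTMS α) := by
  rw [LinearPMap.isSelfAdjoint_def]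
  refine LinearPMap.eq_of_eq_graph ?_
  ext ⟨g', h'⟩
  have key : ∀ {ξ' c'}, BoundaryData ξ' c' g' h' →
      ((g', h') ∈ (HTMS α).adjoint.graph ↔ (g', h') ∈ (HTMS α).graph) := by
    intro ξ' c' H'
    rw [LinearPMap.adjoint_graph_eq_graph_adjoint (HTMS_dense α), Submodule.mem_adjoint_iff,
      mem_HTMS_graph_of_green H']
    constructor
    · intro hyp ξ c g h H hgh
      rw [← H'.inner_sub_inner H, ← neg_sub, hyp g h hgh, neg_zero]
    · intro hyp g h hgh
      obtain ⟨ξ, c, H⟩ := mem_HringAdj_graph_iff_boundaryData.1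
        (LinearPMap.le_graph_of_le (HTMS_le_HringAdj α) hgh)
      have := hyp ξ c g h H hgh
      rw [← H'.inner_sub_inner H] at this
      linear_combination -this
  constructor
  · intro hm
    obtain ⟨ξ', c', H'⟩ := mem_HringAdj_graph_iff_boundaryData.1
      (LinearPMap.le_graph_of_le (adjoint_graph_antitone Hring_dense (Hring_le_HTMS α)) hm)
    exact (key H').1 hm
  · intro hm
    obtain ⟨ξ', c', H'⟩ := mem_HringAdj_graph_iff_boundaryData.1
      (LinearPMap.le_graph_of_le (HTMS_le_HringAdj α) hm)
    exact (key H').2 hm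

theorem eq_of_le_of_isSelfAdjoint {A B : L2 →ₗ.[ℂ] L2} (hA : IsSelfAdjoint A)
    (hB : IsSelfAdjoint B) (h : A ≤ B) : A = B := by
  refine le_antisymm h ?_
  have := adjoint_graph_antitone hA.dense_domain h
  rwa [LinearPMap.isSelfAdjoint_def.1 hA, LinearPMap.isSelfAdjoint_def.1 hB] at this

/-- If all charges in `H` vanish, `H` is contained in the extension `α = ∞`. Otherwise one element
has `ξ₀ ≠ 0`: pairing it with itself makes `c₀/ξ₀` real, and pairing any other element with it
forces `c = (c₀/ξ₀) ξ`. Inclusion is equality because a self-adjoint operator has no proper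
self-adjoint extension. -/
theorem exists_eq_HTMS {H : L2 →ₗ.[ℂ] L2} (h1 : Hring ≤ H) (h2 : IsSelfAdjoint H) :
    ∃ α : OnePoint ℝ, H = HTMS α := by
  have hle : H ≤ HringAdj := by
    have := adjoint_graph_antitone Hring_dense h1
    rwa [LinearPMap.isSelfAdjoint_def.1 h2] at this
  have hdata : ∀ {g h}, (g, h) ∈ H.graph → ∃ ξ c, BoundaryData ξ c g h := fun hm =>
    mem_HringAdj_graph_iff_boundaryData.1 (LinearPMap.le_graph_of_le hle hm)
  have hsymm : ∀ {ξ c g h ξ' c' g' h'}, BoundaryData ξ c g h → BoundaryData ξ' c' g' h' →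
      (g, h) ∈ H.graph → (g', h') ∈ H.graph → conj ξ' * c - ξ * conj c' = 0 := by
    intro ξ c g h ξ' c' g' h' K K' hm hm'
    rw [← K.inner_sub_inner K']
    have hm2 : (g, h) ∈ H.adjoint.graph := by rwa [LinearPMap.isSelfAdjoint_def.1 h2]
    rw [LinearPMap.adjoint_graph_eq_graph_adjoint h2.dense_domain,
      Submodule.mem_adjoint_iff] at hm2
    linear_combination -(hm2 g' h' hm')
  suffices ∃ α : OnePoint ℝ, H ≤ HTMS α by
    obtain ⟨α, hα⟩ := this
    exact ⟨α, eq_of_le_of_isSelfAdjoint h2 (isSelfAdjoint_HTMS α) hα⟩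
  by_cases hall : ∀ ξ c g h, BoundaryData ξ c g h → (g, h) ∈ H.graph → ξ = 0
  · refine ⟨OnePoint.infty, LinearPMap.le_of_le_graph ?_⟩
    rintro ⟨g, h⟩ hm
    obtain ⟨ξ, c, K⟩ := hdata hm
    obtain rfl := hall ξ c g h K hm
    exact mem_HTMS_infty_graph.2 ⟨c, K⟩
  · push Not at hall
    obtain ⟨ξ₀, c₀, g₀, h₀, K₀, hm₀, hξ₀⟩ := hall
    have hconj : conj ξ₀ ≠ 0 := (map_ne_zero _).2 hξ₀
    have hreal : conj (c₀ / ξ₀) = c₀ / ξ₀ := by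
      have := hsymm K₀ K₀ hm₀ hm₀
      rw [map_div₀]
      field_simp
      linear_combination -this
    obtain ⟨t, ht⟩ := Complex.conj_eq_iff_real.1 hreal
    -- The parameter is obtained by solving `8π³α = t`, where `t = c₀/ξ₀`.
    refine ⟨((t / (8 * Real.pi ^ 3) : ℝ) : OnePoint ℝ), LinearPMap.le_of_le_graph ?_⟩
    rintro ⟨g, h⟩ hm
    obtain ⟨ξ, c, K⟩ := hdata hm
    have h3 := hsymm K K₀ hm hm₀
    have h4 : conj c₀ = t * conj ξ₀ := by
      have : c₀ = t * ξ₀ := by rw [← ht]; field_simp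
      rw [this, map_mul, Complex.conj_ofReal]
    have h5 : c = t * ξ := by
      rw [h4] at h3
      apply mul_left_cancel₀ hconj
      linear_combination h3
    refine mem_HTMS_coe_graph.2 ⟨ξ, ?_⟩
    have hπ : (Real.pi : ℂ) ≠ 0 := by exact_mod_cast Real.pi_ne_zero
    convert K using 1
    rw [h5]
    push_cast
    field_simp

/-! ### The Fourier transform of radial functions -/

/-- The orthogonal splitting of `ℝ³` into a line and a plane. -/
abbrev SplitSpace : Type := WithLp 2 (ℝ × EuclideanSpace ℝ (Fin 2))

/-- The Fourier transform commutes with linear isometries, so the frequency may be put on the first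
axis. Any identification of the two spaces becomes suitable after a reflection exchanging two
vectors of equal norm. -/
theorem exists_isometry_axis (w : R3) :
    ∃ U : SplitSpace ≃ₗᵢ[ℝ] R3, U (WithLp.toLp 2 (‖w‖, 0)) = w := by
  have hd : Module.finrank ℝ SplitSpace = 3 := by
    rw [(WithLp.linearEquiv 2 ℝ (ℝ × EuclideanSpace ℝ (Fin 2))).finrank_eq]
    simp
  let U₀ : SplitSpace ≃ₗᵢ[ℝ] R3 := (stdOrthonormalBasis ℝ SplitSpace).equiv
    (EuclideanSpace.basisFun (Fin 3) ℝ) (finCongr hd)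
  have hn : ‖U₀ (WithLp.toLp 2 (‖w‖, 0))‖ = ‖w‖ := by
    rw [LinearIsometryEquiv.norm_map, WithLp.prod_norm_eq_of_L2]
    simp
  refine ⟨U₀.trans (Submodule.reflection (ℝ ∙ (U₀ (WithLp.toLp 2 (‖w‖, 0)) - w))ᗮ), ?_⟩
  exact Submodule.reflection_sub hn

theorem integral_plane_radial (f : ℝ → ℂ) :
    ∫ y : EuclideanSpace ℝ (Fin 2), f ‖y‖ = 2 * Real.pi * ∫ r in Set.Ioi (0 : ℝ), (r : ℂ) * f r := by
  rw [integral_fun_norm_addHaar, finrank_euclideanSpace_fin, Measure.real,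
    EuclideanSpace.volume_ball_fin_two]
  simp [Complex.real_smul, mul_assoc, ENNReal.toReal_ofReal Real.pi_pos.le]

/-- The integral of a radial function over a plane at distance `|t|` from the origin. -/
theorem integral_plane_slice (W : ℝ → ℂ) (t : ℝ) :
    ∫ y : EuclideanSpace ℝ (Fin 2), W √(t ^ 2 + ‖y‖ ^ 2) / (√(t ^ 2 + ‖y‖ ^ 2) : ℝ) =
      2 * Real.pi * ∫ r in Set.Ioi |t|, W r := by
  rw [integral_plane_radial (fun s => W √(t ^ 2 + s ^ 2) / (√(t ^ 2 + s ^ 2) : ℝ))]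
  congr 1
  have hpos : ∀ s ∈ Set.Ioi (0 : ℝ), 0 < t ^ 2 + s ^ 2 := fun s (hs : 0 < s) => by positivity
  -- Substitution `r = √(t² + s²)`: since `r dr = s ds`, the Jacobian `s` of polar coordinates
  -- absorbs the factor `1/r`.
  have himg : (fun s : ℝ => √(t ^ 2 + s ^ 2)) '' Set.Ioi 0 = Set.Ioi |t| := by
    ext r
    constructor
    · rintro ⟨s, hs : 0 < s, rfl⟩
      exact Real.lt_sqrt_of_sq_lt (by rw [sq_abs]; nlinarith)
    · intro (hr : |t| < r)
      have h1 : t ^ 2 < r ^ 2 := by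
        rw [← sq_abs t]; exact pow_lt_pow_left₀ hr (abs_nonneg t) two_ne_zero
      refine ⟨√(r ^ 2 - t ^ 2), Real.sqrt_pos.2 (by linarith), ?_⟩
      simp only
      rw [Real.sq_sqrt (by linarith), add_sub_cancel, Real.sqrt_sq ((abs_nonneg t).trans hr.le)]
  have hderiv : ∀ s ∈ Set.Ioi (0 : ℝ), HasDerivWithinAt (fun s : ℝ => √(t ^ 2 + s ^ 2))
      (s / √(t ^ 2 + s ^ 2)) (Set.Ioi 0) s := by
    intro s hs
    have h := (((hasDerivAt_id s).pow 2).const_add (t ^ 2)).sqrt (hpos s hs).ne'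
    refine (h.congr_deriv ?_).hasDerivWithinAt
    simp only [Pi.pow_apply, id]
    field_simp
    norm_num
  have hinj : Set.InjOn (fun s : ℝ => √(t ^ 2 + s ^ 2)) (Set.Ioi 0) := by
    intro a (ha : 0 < a) b (hb : 0 < b) hab
    have h1 := (Real.sqrt_inj (hpos a ha).le (hpos b hb).le).1 hab
    exact (sq_eq_sq₀ ha.le hb.le).1 (by linarith)
  rw [← himg, integral_image_eq_integral_abs_deriv_smul measurableSet_Ioi hderiv hinj]
  refine setIntegral_congr_fun measurableSet_Ioi fun s (hs : 0 < s) => ?_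
  rw [abs_of_nonneg (by positivity), Complex.real_smul]
  push_cast
  ring

/-- `∫_{|t| < r} exp(-i s t) dt = 2 sin(s r) / s`. -/
theorem integral_exp_Ioo {s r : ℝ} (hs : s ≠ 0) (hr : 0 ≤ r) :
    ∫ t in Set.Ioo (-r) r, Complex.exp (-(Complex.I * s * t)) = 2 * Complex.sin (s * r) / s := by
  rw [← integral_Ioc_eq_integral_Ioo, ← intervalIntegral.integral_of_le (by linarith)]
  have hc : -(Complex.I * s) ≠ 0 := by
    simp [hs]
  have h := integral_exp_mul_complex (a := -r) (b := r) hc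
  simp only [neg_mul] at h
  rw [h, Complex.sin]
  have hs' : (s : ℂ) ≠ 0 := by exact_mod_cast hs
  push_cast
  field_simp
  simp only [Complex.I_sq]
  ring_nf

/-- Continuous functions with exponential decay on the half line. -/
def ExpDecay (W : ℝ → ℂ) : Prop :=
  Continuous W ∧ ∃ C μ : ℝ, 0 < μ ∧ ∀ r, 0 ≤ r → ‖W r‖ ≤ C * Real.exp (-μ * r)

theorem ExpDecay.integrableOn_pow_mul {W : ℝ → ℂ} (h : ExpDecay W) (n : ℕ) :
    IntegrableOn (fun r : ℝ => (r : ℂ) ^ n * W r) (Set.Ioi 0) := by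
  obtain ⟨hc, C, μ, hμ, hb⟩ := h
  have hg : IntegrableOn (fun r : ℝ => C * (r ^ (n : ℝ) * Real.exp (-μ * r ^ (1 : ℝ))))
      (Set.Ioi 0) :=
    Integrable.const_mul (integrableOn_rpow_mul_exp_neg_mul_rpow
      (by linarith [n.cast_nonneg (α := ℝ)]) one_pos hμ) C
  refine Integrable.mono' hg (Continuous.aestronglyMeasurable (by fun_prop)) ?_
  filter_upwards [ae_restrict_mem measurableSet_Ioi] with r (hr : 0 < r)
  rw [norm_mul, norm_pow, Complex.norm_real, Real.norm_of_nonneg hr.le, Real.rpow_natCast,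
    Real.rpow_one]
  calc r ^ n * ‖W r‖ ≤ r ^ n * (C * Real.exp (-μ * r)) := by gcongr; exact hb r hr.le
    _ = _ := by ring

theorem ExpDecay.integrableOn {W : ℝ → ℂ} (h : ExpDecay W) : IntegrableOn W (Set.Ioi 0) := by
  simpa using h.integrableOn_pow_mul 0

theorem ExpDecay.conj_mul {V W : ℝ → ℂ} (hV : ExpDecay V) (hW : ExpDecay W) :
    ExpDecay (fun r => conj (V r) * W r) := by
  obtain ⟨c1, C, μ, hμ, h1⟩ := hV
  obtain ⟨c2, D, ν, hν, h2⟩ := hW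
  refine ⟨by fun_prop, C * D, μ + ν, by positivity, fun r hr => ?_⟩
  rw [norm_mul, RCLike.norm_conj]
  calc ‖V r‖ * ‖W r‖ ≤ (C * Real.exp (-μ * r)) * (D * Real.exp (-ν * r)) :=
        mul_le_mul (h1 r hr) (h2 r hr) (norm_nonneg _) ((norm_nonneg _).trans (h1 r hr))
    _ = _ := by
        rw [show -(μ + ν) * r = -μ * r + -ν * r by ring, Real.exp_add]; ring

theorem ExpDecay.neg {W : ℝ → ℂ} (h : ExpDecay W) : ExpDecay (fun r => -W r) :=
  ⟨h.1.neg, by simpa using h.2⟩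

theorem ExpDecay.tendsto_zero {W : ℝ → ℂ} (h : ExpDecay W) : Tendsto W atTop (𝓝 0) := by
  obtain ⟨hc, C, μ, hμ, hb⟩ := h
  have hl : Tendsto (fun r => C * Real.exp (-μ * r)) atTop (𝓝 0) := by
    have : Tendsto (fun r : ℝ => -μ * r) atTop atBot :=
      tendsto_id.const_mul_atTop_of_neg (neg_lt_zero.2 hμ)
    simpa using (Real.tendsto_exp_atBot.comp this).const_mul C
  refine squeeze_zero_norm' ?_ hl
  filter_upwards [eventually_ge_atTop 0] with r hr using hb r hr

theorem measurable_radial {W : ℝ → ℂ} (hW : Continuous W) :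
    Measurable (fun x : R3 => W ‖x‖ / (‖x‖ : ℂ)) := by
  have := hW.measurable
  fun_prop

theorem ExpDecay.integrable_radial {W : ℝ → ℂ} (h : ExpDecay W) :
    Integrable (fun x : R3 => W ‖x‖ / (‖x‖ : ℂ)) := by
  rw [integrable_radial_iff (f := fun r => W r / (r : ℂ))]
  refine (h.integrableOn_pow_mul 1).congr_fun (fun r (hr : 0 < r) => ?_) measurableSet_Ioi
  have : (r : ℂ) ≠ 0 := by exact_mod_cast hr.ne'
  simp only
  field_simp

theorem ExpDecay.memLp_radial {W : ℝ → ℂ} (h : ExpDecay W) :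
    MemLp (fun x : R3 => W ‖x‖ / (‖x‖ : ℂ)) 2 (volume : Measure R3) := by
  rw [memLp_two_iff_integrable_sq_norm (measurable_radial h.1).aestronglyMeasurable]
  have e := integrable_fun_norm_addHaar (volume : Measure R3)
    (f := fun r : ℝ => ‖W r / (r : ℂ)‖ ^ 2)
  refine (Iff.trans ?_ e).2 ?_
  · simp
  · have hn : IntegrableOn (fun r => ‖conj (W r) * W r‖) (Set.Ioi 0) :=
      (h.conj_mul h).integrableOn.norm
    refine hn.congr_fun (fun r (hr : 0 < r) => ?_) measurableSet_Ioi
    beta_reduce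
    rw [finrank_euclideanSpace_fin, norm_mul, RCLike.norm_conj, norm_div, Complex.norm_real,
      Real.norm_of_nonneg hr.le, smul_eq_mul]
    field_simp

/-- The Fourier transform of `W(|x|) / |x|` is a one-dimensional sine transform. -/
theorem fourier_radial {W : ℝ → ℂ} (h : ExpDecay W) {w : R3} (hw : w ≠ 0) :
    𝓕 (fun x : R3 => W ‖x‖ / (‖x‖ : ℂ)) w =
      2 / (‖w‖ : ℂ) * ∫ r in Set.Ioi (0 : ℝ), W r * Complex.sin (2 * Real.pi * ‖w‖ * r) := by
  obtain ⟨U, hU⟩ := exists_isometry_axis w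
  have hw0 : 0 < ‖w‖ := norm_pos_iff.2 hw
  set s : ℝ := 2 * Real.pi * ‖w‖ with hs
  have hs0 : s ≠ 0 := by positivity
  set g : ℝ → ℂ := fun r => W r / (r : ℂ) with hg
  have hnorm : ∀ z : ℝ × EuclideanSpace ℝ (Fin 2), ‖(WithLp.toLp 2 z : SplitSpace)‖ =
      √(z.1 ^ 2 + ‖z.2‖ ^ 2) := fun z => by
    rw [WithLp.prod_norm_eq_of_L2]; simp
  have hint : Integrable (fun z : ℝ × EuclideanSpace ℝ (Fin 2) =>
      Complex.exp (-(Complex.I * s * z.1)) * g √(z.1 ^ 2 + ‖z.2‖ ^ 2)) := by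
    have i1 : Integrable (fun v : SplitSpace => g ‖v‖) := by
      have := (U.measurePreserving.integrable_comp_emb U.toHomeomorph.measurableEmbedding).2
        h.integrable_radial
      refine this.congr (Eventually.of_forall fun v => ?_)
      simp [hg]
    have i2 := ((WithLp.volume_preserving_toLp ℝ (EuclideanSpace ℝ (Fin 2))).integrable_comp_emb
      (MeasurableEquiv.toLp 2 _).measurableEmbedding).2 i1
    have i3 : Integrable (fun z : ℝ × EuclideanSpace ℝ (Fin 2) => g √(z.1 ^ 2 + ‖z.2‖ ^ 2)) := by
      refine i2.congr (Eventually.of_forall fun z => ?_)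
      simp [hnorm]
    refine i3.bdd_mul (c := 1) (Continuous.aestronglyMeasurable (by fun_prop))
      (Eventually.of_forall fun z => ?_)
    rw [show -(Complex.I * s * z.1) = ((-(s * z.1) : ℝ) : ℂ) * Complex.I by push_cast; ring,
      Complex.norm_exp_ofReal_mul_I]
  have e1 : 𝓕 (fun x : R3 => W ‖x‖ / (‖x‖ : ℂ)) w =
      ∫ z : ℝ × EuclideanSpace ℝ (Fin 2),
        Complex.exp (-(Complex.I * s * z.1)) * g √(z.1 ^ 2 + ‖z.2‖ ^ 2) := by
    conv_lhs => rw [← hU]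
    rw [← Real.fourier_comp_linearIsometry, Real.fourier_eq',
      ← (WithLp.volume_preserving_toLp ℝ (EuclideanSpace ℝ (Fin 2))).integral_comp
        (MeasurableEquiv.toLp 2 _).measurableEmbedding]
    refine integral_congr_ae (Eventually.of_forall fun z => ?_)
    simp only [Function.comp_apply, LinearIsometryEquiv.norm_map, hnorm, smul_eq_mul,
      WithLp.prod_inner_apply, inner_zero_right, add_zero]
    congr 2
    simp only [RCLike.inner_apply, conj_trivial]
    rw [hs]; push_cast; ring
  rw [e1, Measure.volume_eq_prod, integral_prod _ hint]
  -- The slice at height `t` contributes `∫_{|t|}^∞ W`. Written with the indicator of `|t| < r`, it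
  -- becomes a double integral whose order can be exchanged.
  have e2 : ∀ t : ℝ, ∫ y : EuclideanSpace ℝ (Fin 2),
      Complex.exp (-(Complex.I * s * t)) * g √(t ^ 2 + ‖y‖ ^ 2) =
      2 * Real.pi * ∫ r in Set.Ioi (0 : ℝ), (Set.Ioo (-r) r).indicator
        (fun t : ℝ => Complex.exp (-(Complex.I * s * t)) * W r) t := by
    intro t
    rw [integral_const_mul, integral_plane_slice, mul_left_comm, ← integral_const_mul,
      ← integral_indicator measurableSet_Ioi, ← integral_indicator measurableSet_Ioi]
    congr 2
    ext r
    by_cases h1 : |t| < r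
    · have h2 : 0 < r := (abs_nonneg t).trans_lt h1
      simp [Set.indicator, h1, h2, abs_lt.1 h1]
    · have h3 : ¬(-r < t ∧ t < r) := fun h3 => h1 (abs_lt.2 h3)
      simp [Set.indicator, h1, h3]
  simp_rw [e2]
  rw [integral_const_mul, integral_integral_swap]
  · have e3 : ∀ r ∈ Set.Ioi (0 : ℝ), ∫ t : ℝ, (Set.Ioo (-r) r).indicator
        (fun t : ℝ => Complex.exp (-(Complex.I * s * t)) * W r) t =
        2 / (s : ℂ) * (W r * Complex.sin (s * r)) := by
      intro r (hr : 0 < r)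
      rw [integral_indicator measurableSet_Ioo, integral_mul_const, integral_exp_Ioo hs0 hr.le]
      ring
    rw [setIntegral_congr_fun measurableSet_Ioi e3, integral_const_mul, ← mul_assoc]
    congr 1
    · rw [hs]
      have : (‖w‖ : ℂ) ≠ 0 := by exact_mod_cast hw0.ne'
      have hπ : (Real.pi : ℂ) ≠ 0 := by exact_mod_cast Real.pi_ne_zero
      push_cast
      field_simp
    · rw [hs]; push_cast; rfl
  -- For Fubini, the absolute value of the integrand has `t`-integral `2r|W(r)|`, which is
  -- integrable by exponential decay.
  · have hm : Measurable (Function.uncurry fun (t r : ℝ) => (Set.Ioo (-r) r).indicator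
        (fun t : ℝ => Complex.exp (-(Complex.I * s * t)) * W r) t) := by
      have hset : MeasurableSet ({z : ℝ × ℝ | -z.2 < z.1} ∩ {z : ℝ × ℝ | z.1 < z.2}) :=
        ((isOpen_lt (by fun_prop) (by fun_prop)).inter
          (isOpen_lt (by fun_prop) (by fun_prop))).measurableSet
      have hc : Continuous (fun z : ℝ × ℝ => Complex.exp (-(Complex.I * s * z.1)) * W z.2) := by
        have := h.1
        fun_prop
      convert hc.measurable.indicator hset using 1
      ext z
      simp [Set.indicator, Function.uncurry]
    rw [integrable_prod_iff' hm.aestronglyMeasurable]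
    have hnorm1 : ∀ t : ℝ, ‖Complex.exp (-(Complex.I * s * t))‖ = 1 := fun t => by
      rw [show -(Complex.I * s * t) = ((-(s * t) : ℝ) : ℂ) * Complex.I by push_cast; ring,
        Complex.norm_exp_ofReal_mul_I]
    constructor
    · refine Eventually.of_forall fun r => ?_
      simp only [Function.uncurry]
      rw [integrable_indicator_iff measurableSet_Ioo]
      exact ((by fun_prop : Continuous fun t : ℝ =>
        Complex.exp (-(Complex.I * s * t)) * W r).integrableOn_Icc).mono_set Set.Ioo_subset_Icc_self
    · have hi : IntegrableOn (fun r : ℝ => 2 * ‖(r : ℂ) ^ 1 * W r‖) (Set.Ioi 0) :=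
        Integrable.const_mul (h.integrableOn_pow_mul 1).norm 2
      refine IntegrableOn.congr_fun hi (fun r (hr : 0 < r) => ?_) measurableSet_Ioi
      simp only [Function.uncurry, norm_indicator_eq_indicator_norm, norm_mul, hnorm1, one_mul]
      rw [integral_indicator measurableSet_Ioo, setIntegral_const, Measure.real, Real.volume_Ioo,
        ENNReal.toReal_ofReal (by linarith), smul_eq_mul, pow_one, Complex.norm_real,
        Real.norm_of_nonneg hr.le]
      ring

/-! ### Radial elements of `D(H̊*)` -/

/-- The element `W(|x|) / |x|` of `L²(ℝ³)`. -/
def radialL2 {W : ℝ → ℂ} (h : ExpDecay W) : L2 := h.memLp_radial.toLp _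

theorem coeFn_radialL2 {W : ℝ → ℂ} (h : ExpDecay W) :
    ∀ᵐ x : R3, radialL2 h x = W ‖x‖ / (‖x‖ : ℂ) := h.memLp_radial.coeFn_toLp

theorem ae_ne_zero : ∀ᵐ x : R3, x ≠ 0 := by simp [ae_iff]

theorem hat_radialL2 {W : ℝ → ℂ} (h : ExpDecay W) : ∀ᵐ p : R3, hat (radialL2 h) p =
    4 * Real.pi * fourierConst / (‖p‖ : ℂ) *
      ∫ r in Set.Ioi (0 : ℝ), W r * Complex.sin (‖p‖ * r) := by
  filter_upwards [hat_toLp h.integrable_radial h.memLp_radial, ae_ne_zero] with p h1 h2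
  have h3 : (2 * Real.pi)⁻¹ • p ≠ 0 := smul_ne_zero two_pi_inv_ne h2
  have hp : (‖p‖ : ℂ) ≠ 0 := by exact_mod_cast (norm_pos_iff.2 h2).ne'
  have hπ : (Real.pi : ℂ) ≠ 0 := by exact_mod_cast Real.pi_ne_zero
  have h4 : (‖(2 * Real.pi)⁻¹ • p‖ : ℂ) = (2 * (Real.pi : ℂ))⁻¹ * (‖p‖ : ℂ) := by
    rw [norm_smul, Real.norm_of_nonneg (by positivity)]
    push_cast; rfl
  have h5 : 2 * Real.pi * ((2 * (Real.pi : ℂ))⁻¹ * (‖p‖ : ℂ)) = ‖p‖ := by field_simp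
  have h6 := fourier_radial h h3
  simp only [h4, h5] at h6
  rw [radialL2, h1, h6]
  field_simp
  ring

theorem inner_radialL2 {V W : ℝ → ℂ} (hV : ExpDecay V) (hW : ExpDecay W) :
    inner ℂ (radialL2 hV) (radialL2 hW) =
      4 * Real.pi * ∫ r in Set.Ioi (0 : ℝ), conj (V r) * W r := by
  rw [L2.inner_def]
  have e : ∀ᵐ x : R3, inner ℂ (radialL2 hV x) (radialL2 hW x) =
      (fun r : ℝ => conj (V r) * W r / (r : ℂ) ^ 2) ‖x‖ := by
    filter_upwards [coeFn_radialL2 hV, coeFn_radialL2 hW] with x h1 h2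
    rw [h1, h2, RCLike.inner_apply, map_div₀, Complex.conj_ofReal]
    ring
  rw [integral_congr_ae e, integral_radial (fun r : ℝ => conj (V r) * W r / (r : ℂ) ^ 2)]
  congr 1
  refine setIntegral_congr_fun measurableSet_Ioi fun r (hr : 0 < r) => ?_
  have : (r : ℂ) ≠ 0 := by exact_mod_cast hr.ne'
  field_simp

theorem ExpDecay.mul_of_norm_le_one {W : ℝ → ℂ} (h : ExpDecay W) {f : ℝ → ℂ} (hf : Continuous f)
    (hb : ∀ r, ‖f r‖ ≤ 1) : ExpDecay (fun r => W r * f r) := by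
  obtain ⟨hc, C, μ, hμ, hW⟩ := h
  refine ⟨hc.mul hf, C, μ, hμ, fun r hr => ?_⟩
  rw [norm_mul]
  calc ‖W r‖ * ‖f r‖ ≤ ‖W r‖ * 1 := by gcongr; exact hb r
    _ ≤ _ := by rw [mul_one]; exact hW r hr

theorem ExpDecay.congr {V W : ℝ → ℂ} (hV : ExpDecay V) (h : V = W) : ExpDecay W := h ▸ hV

theorem norm_sin_ofReal_le (x : ℝ) : ‖Complex.sin x‖ ≤ 1 := by
  rw [← Complex.ofReal_sin, Complex.norm_real]
  exact Real.abs_sin_le_one x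

theorem norm_cos_ofReal_le (x : ℝ) : ‖Complex.cos x‖ ≤ 1 := by
  rw [← Complex.ofReal_cos, Complex.norm_real]
  exact Real.abs_cos_le_one x

/-- Two integrations by parts in the sine transform. -/
theorem sine_transform_second_deriv {W W₁ W₂ : ℝ → ℂ} (h : ExpDecay W) (h₁ : ExpDecay W₁)
    (h₂ : ExpDecay W₂) (d : ∀ r, HasDerivAt W (W₁ r) r) (d₁ : ∀ r, HasDerivAt W₁ (W₂ r) r)
    (s : ℝ) :
    ∫ r in Set.Ioi (0 : ℝ), -W₂ r * Complex.sin (s * r) =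
      (s : ℂ) ^ 2 * (∫ r in Set.Ioi (0 : ℝ), W r * Complex.sin (s * r)) - s * W 0 := by
  have cs : Continuous fun r : ℝ => Complex.sin (s * r) := by fun_prop
  have cc : Continuous fun r : ℝ => Complex.cos (s * r) := by fun_prop
  have bs : ∀ r : ℝ, ‖Complex.sin (s * r)‖ ≤ 1 := fun r => by
    rw [← Complex.ofReal_mul]; exact norm_sin_ofReal_le _
  have bc : ∀ r : ℝ, ‖Complex.cos (s * r)‖ ≤ 1 := fun r => by
    rw [← Complex.ofReal_mul]; exact norm_cos_ofReal_le _
  have i0 := (h.mul_of_norm_le_one cs bs).integrableOn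
  have i2 := (h₂.neg.mul_of_norm_le_one cs bs).integrableOn
  have l0 := (h.mul_of_norm_le_one cc bc).tendsto_zero
  have l1 := (h₁.mul_of_norm_le_one cs bs).tendsto_zero
  -- The antiderivative combines both integrations by parts; its value `s W(0)` at `r = 0` is the
  -- only boundary term.
  have hd : ∀ r ∈ Set.Ici (0 : ℝ), HasDerivAt (fun r : ℝ => s * (W r * Complex.cos (s * r)) -
      W₁ r * Complex.sin (s * r))
      (-W₂ r * Complex.sin (s * r) - (s : ℂ) ^ 2 * (W r * Complex.sin (s * r))) r := by
    intro r _
    have hlin : HasDerivAt (fun r : ℝ => (s : ℂ) * r) s r := by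
      simpa using (Complex.ofRealCLM.hasDerivAt (x := r)).const_mul (s : ℂ)
    have e := (((d r).mul ((Complex.hasDerivAt_cos _).comp r hlin)).const_mul (s : ℂ)).sub ((d₁ r).mul ((Complex.hasDerivAt_sin _).comp r hlin))
    refine e.congr_deriv ?_
    simp only [Function.comp_apply]
    ring
  have key := integral_Ioi_of_hasDerivAt_of_tendsto' hd (i2.sub (Integrable.const_mul i0 _))
    ((l0.const_mul (s : ℂ)).sub l1)
  rw [integral_sub i2 (Integrable.const_mul i0 _), integral_const_mul] at key
  simp only [Complex.ofReal_zero, mul_zero, Complex.cos_zero, Complex.sin_zero, mul_one,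
    sub_zero, zero_sub] at key
  linear_combination key

/-- The boundary term `|p| W(0)` of the sine transform, multiplied by the prefactor proportional to
`|p|⁻¹`, is constant in `p`: it is the charge. -/
theorem hasCharge_radialL2 {W W₁ W₂ : ℝ → ℂ} (h : ExpDecay W) (h₁ : ExpDecay W₁)
    (h₂ : ExpDecay W₂) (d : ∀ r, HasDerivAt W (W₁ r) r) (d₁ : ∀ r, HasDerivAt W₁ (W₂ r) r) :
    HasCharge (4 * Real.pi * fourierConst * W 0) (radialL2 h) (radialL2 h₂.neg) := by
  filter_upwards [hat_radialL2 h, hat_radialL2 h₂.neg, ae_ne_zero] with p e1 e2 hp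
  have hp' : (‖p‖ : ℂ) ≠ 0 := by exact_mod_cast (norm_pos_iff.2 hp).ne'
  rw [e1, e2, sine_transform_second_deriv h h₁ h₂ d d₁]
  push_cast
  field_simp

theorem hasDerivAt_exp_neg (r : ℝ) :
    HasDerivAt (fun r : ℝ => Complex.exp (-r)) (-Complex.exp (-r)) r := by
  have h := ((Complex.ofRealCLM.hasDerivAt (x := r)).neg).cexp
  simpa using h

theorem expDecay_exp_neg : ExpDecay fun r : ℝ => Complex.exp (-r) := by
  refine ⟨by fun_prop, 1, 1, one_pos, fun r _ => ?_⟩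
  beta_reduce
  rw [← Complex.ofReal_neg, ← Complex.ofReal_exp, Complex.norm_real,
    Real.norm_of_nonneg (Real.exp_pos _).le]
  simp

/-- `exp(-r)/r` satisfies `W'' = W`, so its transform is a pure multiple of `(p² + 1)⁻¹` and its
regular part is known. It serves as the reference element for reading off regular parts by Green's
formula. -/
theorem boundaryData_yukawa : BoundaryData (4 * Real.pi * fourierConst)
    (-2 * Real.pi ^ 2 * (4 * Real.pi * fourierConst))
    (radialL2 expDecay_exp_neg) (radialL2 expDecay_exp_neg.neg) := by
  have hc := hasCharge_radialL2 expDecay_exp_neg expDecay_exp_neg.neg expDecay_exp_neg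
    hasDerivAt_exp_neg (fun r => by simpa using (hasDerivAt_exp_neg r).fun_neg)
  simp only [Complex.ofReal_zero, neg_zero, Complex.exp_zero, mul_one] at hc
  refine ⟨hc, ?_⟩
  have hneg : radialL2 expDecay_exp_neg.neg = -radialL2 expDecay_exp_neg := by
    refine Lp.ext ?_
    filter_upwards [coeFn_radialL2 expDecay_exp_neg, coeFn_radialL2 expDecay_exp_neg.neg,
      Lp.coeFn_neg (radialL2 expDecay_exp_neg)] with x h1 h2 h3
    rw [h2, h3, Pi.neg_apply, h1, neg_div]
  have hd : IsDecomposition 1 0 0 (4 * Real.pi * fourierConst) (radialL2 expDecay_exp_neg) := by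
    filter_upwards [hc, hat_zero, hat_smul (-1) (radialL2 expDecay_exp_neg)] with p h1 h2 h3
    rw [neg_one_smul, ← hneg] at h3
    have hne := resolvent_ne_zero one_pos p
    rw [h3] at h1
    rw [h2, zero_div, zero_add, zero_add, eq_div_iff hne]
    push_cast at h1 ⊢
    linear_combination -h1
  have hr := hd.hasRegularPart one_pos (zero_mem H20)
  convert hr using 1
  simp

/-- The boundary data of `W(|x|) / |x|` are determined by `W(0)` and `W'(0)`. -/
theorem boundaryData_radialL2 {W W₁ W₂ : ℝ → ℂ} (h : ExpDecay W) (h₁ : ExpDecay W₁)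
    (h₂ : ExpDecay W₂) (d : ∀ r, HasDerivAt W (W₁ r) r) (d₁ : ∀ r, HasDerivAt W₁ (W₂ r) r) :
    BoundaryData (4 * Real.pi * fourierConst * W 0) (8 * Real.pi ^ 3 * fourierConst * W₁ 0)
      (radialL2 h) (radialL2 h₂.neg) := by
  obtain ⟨c, hc⟩ := (hasCharge_radialL2 h h₁ h₂ d d₁).exists_boundaryData
  -- Rather than evaluating the cut-off integral, `c` is extracted from Green's formula against
  -- `exp(-r)/r`, whose left side reduces to boundary values of `W` at `0`.
  have green := hc.inner_sub_inner boundaryData_yukawa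
  rw [inner_radialL2, inner_radialL2] at green
  have econj : ∀ r : ℝ, conj (Complex.exp (-r)) = Complex.exp (-r) := fun r => by
    rw [← Complex.exp_conj, map_neg, Complex.conj_ofReal]
  simp only [map_neg, econj] at green
  have dE : ∀ {V : ℝ → ℂ}, ExpDecay V → ExpDecay (fun r : ℝ => Complex.exp (-r) * V r) :=
    fun hV => (expDecay_exp_neg.conj_mul hV).congr (funext fun r => by rw [econj])
  have hd : ∀ r ∈ Set.Ici (0 : ℝ), HasDerivAt
      (fun r : ℝ => -(Complex.exp (-r) * W r) - Complex.exp (-r) * W₁ r)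
      (Complex.exp (-r) * -W₂ r - -Complex.exp (-r) * W r) r := by
    intro r _
    refine (((hasDerivAt_exp_neg r).mul (d r)).neg.sub
      ((hasDerivAt_exp_neg r).mul (d₁ r))).congr_deriv ?_
    ring
  have i1 := (dE h₂.neg).integrableOn
  have i2 : IntegrableOn (fun r : ℝ => -Complex.exp (-r) * W r) (Set.Ioi 0) :=
    ((dE h).neg.congr (funext fun r => by ring)).integrableOn
  have key := integral_Ioi_of_hasDerivAt_of_tendsto' hd (i1.sub i2)
    ((dE h).tendsto_zero.neg.sub (dE h₁).tendsto_zero)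
  rw [integral_sub i1 i2] at key
  rw [← mul_sub, key] at green
  have hconj : conj (4 * Real.pi * fourierConst : ℂ) = 4 * Real.pi * fourierConst := by
    simp only [map_mul, map_ofNat, Complex.conj_ofReal]
  have hconj2 : conj (-2 * Real.pi ^ 2 * (4 * Real.pi * fourierConst) : ℂ) =
      -2 * Real.pi ^ 2 * (4 * Real.pi * fourierConst) := by
    simp only [map_mul, map_neg, map_pow, map_ofNat, Complex.conj_ofReal]
  rw [hconj, hconj2] at green
  simp only [Complex.ofReal_zero, neg_zero, Complex.exp_zero, one_mul, zero_sub] at green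
  have hπ : (Real.pi : ℂ) ≠ 0 := by exact_mod_cast Real.pi_ne_zero
  have hsq : (fourierConst : ℂ) ^ 2 * (8 * Real.pi ^ 3) = 1 := by
    have : fourierConst ^ 2 * (8 * Real.pi ^ 3) = 1 := by
      rw [fourierConst_sq]
      have := Real.pi_ne_zero
      field_simp
      norm_num
    exact_mod_cast this
  have hval : c = 8 * Real.pi ^ 3 * fourierConst * W₁ 0 := by
    have hf : (fourierConst : ℂ) ≠ 0 := by exact_mod_cast fourierConst_pos.ne'
    have h4 : (4 * Real.pi * fourierConst : ℂ) ≠ 0 := mul_ne_zero (mul_ne_zero (by norm_num) hπ) hf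
    apply mul_left_cancel₀ h4
    linear_combination -green + 4 * Real.pi * (-W 0 - W₁ 0) * hsq
  rwa [hval] at hc

/-! ### Truncated radial solutions -/

/-- A smooth step, equal to `1` on `(-∞, 0]` and to `0` on `[1, ∞)`. -/
def cut (t : ℝ) : ℝ := 1 - Real.smoothTransition t

theorem cut_contDiff : ContDiff ℝ ∞ cut := contDiff_const.sub Real.smoothTransition.contDiff

theorem cut_of_nonpos {t : ℝ} (h : t ≤ 0) : cut t = 1 := by
  rw [cut, Real.smoothTransition.zero_of_nonpos h, sub_zero]

theorem cut_of_one_le {t : ℝ} (h : 1 ≤ t) : cut t = 0 := by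
  rw [cut, Real.smoothTransition.one_of_one_le h, sub_self]

theorem cut_deriv_contDiff : ContDiff ℝ ∞ (deriv cut) :=
  (contDiff_infty_iff_deriv.1 cut_contDiff).2

theorem cut_deriv2_contDiff : ContDiff ℝ ∞ (deriv (deriv cut)) :=
  (contDiff_infty_iff_deriv.1 cut_deriv_contDiff).2

/-- The cut-off is locally constant only on the open half lines; continuity carries the vanishing of
its derivatives to the endpoints `0` and `1`. -/
theorem eq_zero_on_closure_of_eq_zero {f : ℝ → ℝ} (hf : Continuous f) {s : Set ℝ}
    (h : ∀ t ∈ s, f t = 0) : ∀ t ∈ closure s, f t = 0 :=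
  closure_minimal h (isClosed_eq hf continuous_const)

theorem deriv_cut_of_nonpos {t : ℝ} (h : t ≤ 0) : deriv cut t = 0 := by
  refine eq_zero_on_closure_of_eq_zero cut_deriv_contDiff.continuous (s := Set.Iio 0)
    (fun t (ht : t < 0) => ?_) t (by rwa [closure_Iio])
  have : cut =ᶠ[𝓝 t] fun _ => 1 := by
    filter_upwards [Iio_mem_nhds ht] with s hs using cut_of_nonpos (le_of_lt hs)
  rw [this.deriv_eq, deriv_const]

theorem deriv_cut_of_one_le {t : ℝ} (h : 1 ≤ t) : deriv cut t = 0 := by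
  refine eq_zero_on_closure_of_eq_zero cut_deriv_contDiff.continuous (s := Set.Ioi 1)
    (fun t (ht : 1 < t) => ?_) t (by rwa [closure_Ioi])
  have : cut =ᶠ[𝓝 t] fun _ => 0 := by
    filter_upwards [Ioi_mem_nhds ht] with s hs using cut_of_one_le (le_of_lt hs)
  rw [this.deriv_eq, deriv_const]

theorem deriv2_cut_of_nonpos {t : ℝ} (h : t ≤ 0) : deriv (deriv cut) t = 0 := by
  refine eq_zero_on_closure_of_eq_zero cut_deriv2_contDiff.continuous (s := Set.Iio 0)
    (fun t (ht : t < 0) => ?_) t (by rwa [closure_Iio])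
  have : deriv cut =ᶠ[𝓝 t] fun _ => 0 := by
    filter_upwards [Iio_mem_nhds ht] with s hs using deriv_cut_of_nonpos (le_of_lt hs)
  rw [this.deriv_eq, deriv_const]

theorem deriv2_cut_of_one_le {t : ℝ} (h : 1 ≤ t) : deriv (deriv cut) t = 0 := by
  refine eq_zero_on_closure_of_eq_zero cut_deriv2_contDiff.continuous (s := Set.Ioi 1)
    (fun t (ht : 1 < t) => ?_) t (by rwa [closure_Ioi])
  have : deriv cut =ᶠ[𝓝 t] fun _ => 0 := by
    filter_upwards [Ioi_mem_nhds ht] with s hs using deriv_cut_of_one_le (le_of_lt hs)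
  rw [this.deriv_eq, deriv_const]

theorem hasDerivAt_cut_sub (T r : ℝ) :
    HasDerivAt (fun r : ℝ => (cut (r - T) : ℂ)) (deriv cut (r - T) : ℝ) r := by
  have h := (cut_contDiff.differentiable (by simp) (r - T)).hasDerivAt
  exact (h.comp_sub_const r T).ofReal_comp

theorem hasDerivAt_deriv_cut_sub (T r : ℝ) :
    HasDerivAt (fun r : ℝ => ((deriv cut (r - T) : ℝ) : ℂ)) (deriv (deriv cut) (r - T) : ℝ) r := by
  have h := (cut_deriv_contDiff.differentiable (by simp) (r - T)).hasDerivAt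
  exact (h.comp_sub_const r T).ofReal_comp

theorem ExpDecay.of_eq_zero {W : ℝ → ℂ} (hc : Continuous W) {R : ℝ} (h : ∀ r, R ≤ r → W r = 0) :
    ExpDecay W := by
  obtain ⟨M, hM⟩ := (isCompact_Icc (a := (0 : ℝ)) (b := R)).exists_bound_of_continuousOn
    hc.continuousOn
  refine ⟨hc, |M| * Real.exp R, 1, one_pos, fun r hr => ?_⟩
  rcases le_total R r with h1 | h1
  · rw [h r h1, norm_zero]; positivity
  · calc ‖W r‖ ≤ |M| := (hM r ⟨hr, h1⟩).trans (le_abs_self M)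
      _ ≤ |M| * Real.exp (R - r) :=
        le_mul_of_one_le_right (abs_nonneg M) (Real.one_le_exp (by linarith))
      _ = _ := by rw [mul_assoc, ← Real.exp_add]; congr 2; ring

/-- `V` solves `-V'' = k² V`, with derivative `V₁`. -/
structure IsRadialSolution (k : ℝ) (V V₁ : ℝ → ℂ) : Prop where
  hasDerivAt : ∀ r, HasDerivAt V (V₁ r) r
  hasDerivAt₁ : ∀ r, HasDerivAt V₁ (-(k : ℂ) ^ 2 * V r) r

theorem IsRadialSolution.continuous {k : ℝ} {V V₁ : ℝ → ℂ} (h : IsRadialSolution k V V₁) :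
    Continuous V := continuous_iff_continuousAt.2 fun r => (h.hasDerivAt r).continuousAt

theorem IsRadialSolution.continuous₁ {k : ℝ} {V V₁ : ℝ → ℂ} (h : IsRadialSolution k V V₁) :
    Continuous V₁ := continuous_iff_continuousAt.2 fun r => (h.hasDerivAt₁ r).continuousAt

/-- The commutator term `2 χ' V' + χ'' V` of a truncated solution. -/
def cutDefect (T : ℝ) (V V₁ : ℝ → ℂ) (r : ℝ) : ℂ :=
  2 * (deriv cut (r - T) : ℝ) * V₁ r + (deriv (deriv cut) (r - T) : ℝ) * V r

theorem cutDefect_of_le {T : ℝ} {V V₁ : ℝ → ℂ} {r : ℝ} (h : r ≤ T) : cutDefect T V V₁ r = 0 := by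
  rw [cutDefect, deriv_cut_of_nonpos (by linarith), deriv2_cut_of_nonpos (by linarith)]
  simp

theorem cutDefect_of_ge {T : ℝ} {V V₁ : ℝ → ℂ} {r : ℝ} (h : T + 1 ≤ r) :
    cutDefect T V V₁ r = 0 := by
  rw [cutDefect, deriv_cut_of_one_le (by linarith), deriv2_cut_of_one_le (by linarith)]
  simp

theorem IsRadialSolution.continuous_cutDefect {k : ℝ} {V V₁ : ℝ → ℂ}
    (h : IsRadialSolution k V V₁) (T : ℝ) : Continuous (cutDefect T V V₁) := by
  have := h.continuous
  have := h.continuous₁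
  have := cut_deriv_contDiff.continuous
  have := cut_deriv2_contDiff.continuous
  unfold cutDefect
  fun_prop

/-- `W = χ(r - T)V` vanishes for `r ≥ T + 1` and satisfies `-W'' = k²W - (2χ'V' + χ''V)`. As `T >
0`, its data at the origin are those of `V`. -/
theorem IsRadialSolution.exists_truncation {k : ℝ} {V V₁ : ℝ → ℂ} (h : IsRadialSolution k V V₁)
    {T : ℝ} (hT : 0 < T) : ∃ g q : L2,
      BoundaryData (4 * Real.pi * fourierConst * V 0) (8 * Real.pi ^ 3 * fourierConst * V₁ 0) g q ∧
      (∀ᵐ x : R3, g x = cut (‖x‖ - T) * V ‖x‖ / (‖x‖ : ℂ)) ∧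
      (∀ᵐ x : R3, q x =
        ((k : ℂ) ^ 2 * (cut (‖x‖ - T) * V ‖x‖) - cutDefect T V V₁ ‖x‖) / (‖x‖ : ℂ)) := by
  have c0 := cut_contDiff.continuous
  have c1 := cut_deriv_contDiff.continuous
  have v0 := h.continuous
  have v1 := h.continuous₁
  have vd := h.continuous_cutDefect T
  have hW : ExpDecay fun r => (cut (r - T) : ℂ) * V r :=
    .of_eq_zero (by fun_prop) (R := T + 1) fun r hr => by
      rw [cut_of_one_le (by linarith)]; simp
  have hW₁ : ExpDecay fun r => ((deriv cut (r - T) : ℝ) : ℂ) * V r + cut (r - T) * V₁ r :=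
    .of_eq_zero (by fun_prop) (R := T + 1) fun r hr => by
      rw [cut_of_one_le (by linarith), deriv_cut_of_one_le (by linarith)]; simp
  have hW₂ : ExpDecay fun r => cutDefect T V V₁ r - (k : ℂ) ^ 2 * (cut (r - T) * V r) :=
    .of_eq_zero (by fun_prop) (R := T + 1) fun r hr => by
      rw [cut_of_one_le (by linarith), cutDefect_of_ge hr]; simp
  have hb := boundaryData_radialL2 hW hW₁ hW₂
    (fun r => (hasDerivAt_cut_sub T r).mul (h.hasDerivAt r))
    (fun r => (((hasDerivAt_deriv_cut_sub T r).mul (h.hasDerivAt r)).add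
      ((hasDerivAt_cut_sub T r).mul (h.hasDerivAt₁ r))).congr_deriv (by rw [cutDefect]; ring))
  refine ⟨radialL2 hW, radialL2 hW₂.neg, ?_, coeFn_radialL2 hW, ?_⟩
  · convert hb using 2
    · rw [cut_of_nonpos (by linarith)]; simp
    · rw [cut_of_nonpos (by linarith), deriv_cut_of_nonpos (by linarith)]; simp
  · filter_upwards [coeFn_radialL2 hW₂.neg] with x hx
    rw [hx]; ring

/-! ### Radial boundary conditions -/

/-- The boundary condition at `r = 0` for the reduced radial function `V`, in terms of `v = V(0)`
and `v₁ = V'(0)`. -/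
def RadialBC (α : OnePoint ℝ) (v v₁ : ℂ) : Prop :=
  α.elim (v = 0) (fun t => v₁ = 4 * Real.pi * t * v)

/-- For charge `4πCv` and regular part `8π³Cv₁`, with `C` the Fourier constant, `c = 8π³αξ` becomes
`v₁ = 4παv`. -/
theorem BoundaryData.mem_graph_HTMS {α : OnePoint ℝ} {v v₁ : ℂ} (hα : RadialBC α v v₁) {g q : L2}
    (h : BoundaryData (4 * Real.pi * fourierConst * v) (8 * Real.pi ^ 3 * fourierConst * v₁) g q) :
    (g, q) ∈ (HTMS α).graph := by
  induction α using OnePoint.rec with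
  | infty =>
    have hv : v = 0 := hα
    rw [mem_HTMS_infty_graph]
    refine ⟨8 * Real.pi ^ 3 * fourierConst * v₁, ?_⟩
    convert h using 1
    rw [hv, mul_zero]
  | coe t =>
    have hv : v₁ = 4 * Real.pi * t * v := hα
    rw [mem_HTMS_coe_graph]
    refine ⟨4 * Real.pi * fourierConst * v, ?_⟩
    convert h using 1
    rw [hv]; ring

theorem HTMS_symm {α : OnePoint ℝ} {g q g' q' : L2} (h : (g, q) ∈ (HTMS α).graph)
    (h' : (g', q') ∈ (HTMS α).graph) : inner ℂ g' q - inner ℂ q' g = 0 := by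
  induction α using OnePoint.rec with
  | infty =>
    rw [mem_HTMS_infty_graph] at h h'
    obtain ⟨c, hc⟩ := h
    obtain ⟨c', hc'⟩ := h'
    rw [hc.inner_sub_inner hc']
    simp
  | coe t =>
    rw [mem_HTMS_coe_graph] at h h'
    obtain ⟨c, hc⟩ := h
    obtain ⟨c', hc'⟩ := h'
    rw [hc.inner_sub_inner hc']
    simp only [map_mul, map_pow, map_ofNat, Complex.conj_ofReal]
    ring

/-! ### Scattering solutions -/

/-- The reduced radial scattering solution `sin(k r) / k + z exp(i k r)`. -/
def scatSol (k : ℝ) (z : ℂ) (r : ℝ) : ℂ :=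
  Complex.sin (k * r) / k + z * Complex.exp (Complex.I * k * r)

/-- The derivative of `scatSol`. -/
def scatSolDeriv (k : ℝ) (z : ℂ) (r : ℝ) : ℂ :=
  Complex.cos (k * r) + Complex.I * k * z * Complex.exp (Complex.I * k * r)

theorem hasDerivAt_mul_ofReal (a : ℂ) (r : ℝ) : HasDerivAt (fun r : ℝ => a * (r : ℂ)) a r := by
  simpa using (Complex.ofRealCLM.hasDerivAt (x := r)).const_mul a

theorem hasDerivAt_sin_mul (k : ℂ) (r : ℝ) :
    HasDerivAt (fun r : ℝ => Complex.sin (k * r)) (k * Complex.cos (k * r)) r :=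
  ((Complex.hasDerivAt_sin _).comp r (hasDerivAt_mul_ofReal k r)).congr_deriv (mul_comm _ _)

theorem hasDerivAt_cos_mul (k : ℂ) (r : ℝ) :
    HasDerivAt (fun r : ℝ => Complex.cos (k * r)) (-(k * Complex.sin (k * r))) r :=
  ((Complex.hasDerivAt_cos _).comp r (hasDerivAt_mul_ofReal k r)).congr_deriv (by ring)

theorem isRadialSolution_scatSol {k : ℝ} (hk : k ≠ 0) (z : ℂ) :
    IsRadialSolution k (scatSol k z) (scatSolDeriv k z) := by
  have hk' : (k : ℂ) ≠ 0 := by exact_mod_cast hk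
  have he : ∀ r : ℝ, HasDerivAt (fun r : ℝ => Complex.exp (Complex.I * k * r))
      (Complex.I * k * Complex.exp (Complex.I * k * r)) r := fun r =>
    (hasDerivAt_mul_ofReal _ r).cexp.congr_deriv (mul_comm _ _)
  constructor
  · intro r
    refine (((hasDerivAt_sin_mul k r).div_const (k : ℂ)).add ((he r).const_mul z)).congr_deriv ?_
    rw [scatSolDeriv]
    field_simp
  · intro r
    refine ((hasDerivAt_cos_mul k r).add
      ((he r).const_mul (Complex.I * k * z))).congr_deriv ?_
    rw [scatSol, mul_add, mul_div_assoc', neg_mul, sq, mul_assoc (k : ℂ), neg_div,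
      mul_div_cancel_left₀ _ hk']
    linear_combination k ^ 2 * z * Complex.exp (Complex.I * k * r) * Complex.I_sq

/-- The solution is `a cos(kr) + (b/k) sin(kr)`, with `(a, b) = (0, 1)` or `(1, 4πα)`. It is real,
so conjugation in inner products leaves it unchanged. The last clause recovers the boundary
condition from a vanishing Wronskian. -/
theorem exists_real_solution (α : OnePoint ℝ) {k : ℝ} (hk : k ≠ 0) :
    ∃ V V₁ : ℝ → ℂ, IsRadialSolution k V V₁ ∧ RadialBC α (V 0) (V₁ 0) ∧
      (∀ r, conj (V r) = V r) ∧ (∀ r, conj (V₁ r) = V₁ r) ∧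
      (∃ C, ∀ r, ‖V r‖ ≤ C ∧ ‖V₁ r‖ ≤ C) ∧
      ∀ e e₁ : ℂ, V₁ 0 * e - V 0 * e₁ = 0 → RadialBC α e e₁ := by
  have hk' : (k : ℂ) ≠ 0 := by exact_mod_cast hk
  have key : ∀ a b : ℝ, IsRadialSolution k
      (fun r => a * Complex.cos (k * r) + b / k * Complex.sin (k * r))
      (fun r => -(a * k) * Complex.sin (k * r) + b * Complex.cos (k * r)) := by
    intro a b
    constructor
    · intro r
      refine (((hasDerivAt_cos_mul k r).const_mul (a : ℂ)).add
        ((hasDerivAt_sin_mul k r).const_mul (b / k : ℂ))).congr_deriv ?_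
      field_simp
    · intro r
      refine (((hasDerivAt_sin_mul k r).const_mul (-(a * k) : ℂ)).add
        ((hasDerivAt_cos_mul k r).const_mul (b : ℂ))).congr_deriv ?_
      field_simp
      ring
  have hs : ∀ r : ℝ, ‖Complex.sin (k * r)‖ ≤ 1 := fun r => by
    rw [← Complex.ofReal_mul]; exact norm_sin_ofReal_le _
  have hc : ∀ r : ℝ, ‖Complex.cos (k * r)‖ ≤ 1 := fun r => by
    rw [← Complex.ofReal_mul]; exact norm_cos_ofReal_le _
  have hb : ∀ (a b : ℂ) (r : ℝ), ‖a * Complex.cos (k * r) + b * Complex.sin (k * r)‖ ≤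
      ‖a‖ + ‖b‖ := fun a b r => (norm_add_le _ _).trans <| by
    rw [norm_mul, norm_mul]
    exact add_le_add (mul_le_of_le_one_right (norm_nonneg _) (hc r))
      (mul_le_of_le_one_right (norm_nonneg _) (hs r))
  have main : ∀ a b : ℝ, RadialBC α a b →
      (∀ e e₁ : ℂ, b * e - a * e₁ = 0 → RadialBC α e e₁) →
      ∃ V V₁ : ℝ → ℂ, IsRadialSolution k V V₁ ∧ RadialBC α (V 0) (V₁ 0) ∧
      (∀ r, conj (V r) = V r) ∧ (∀ r, conj (V₁ r) = V₁ r) ∧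
      (∃ C, ∀ r, ‖V r‖ ≤ C ∧ ‖V₁ r‖ ≤ C) ∧
      ∀ e e₁ : ℂ, V₁ 0 * e - V 0 * e₁ = 0 → RadialBC α e e₁ := by
    intro a b h1 h2
    refine ⟨_, _, key a b, by simpa using h1, fun r => ?_, fun r => ?_,
      ⟨max (‖(a : ℂ)‖ + ‖(b / k : ℂ)‖) (‖(b : ℂ)‖ + ‖(-(a * k) : ℂ)‖), fun r => ⟨?_, ?_⟩⟩,
      by simpa using h2⟩
    · simp [← Complex.cos_conj, ← Complex.sin_conj]
    · simp [← Complex.cos_conj, ← Complex.sin_conj]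
    · exact (hb _ _ r).trans (le_max_left _ _)
    · rw [add_comm (-(a * k : ℂ) * _)]
      exact (hb _ _ r).trans (le_max_right _ _)
  induction α using OnePoint.rec with
  | infty =>
    refine main 0 1 (Complex.ofReal_zero : _) fun e e₁ h => ?_
    show e = 0
    simpa using h
  | coe t =>
    refine main 1 (4 * Real.pi * t) ?_ fun e e₁ h => ?_
    · show ((4 * Real.pi * t : ℝ) : ℂ) = 4 * Real.pi * t * ((1 : ℝ) : ℂ)
      push_cast; ring
    · show e₁ = 4 * Real.pi * t * e
      push_cast at h
      linear_combination -h

/-! ### Scattering amplitudes and scattering lengths -/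

/-- The explicit solution has the required asymptotics with zero error, and its truncation beyond
radius `ρ` is the domain element agreeing with it on the ball. -/
theorem isSWaveAmplitude_of_radialBC {α : OnePoint ℝ} {k : ℝ} (hk : k ≠ 0) {z : ℂ}
    (h : RadialBC α z (1 + Complex.I * k * z)) : IsSWaveAmplitude (HTMS α) k z := by
  refine ⟨fun r => scatSol k z r / r, fun ρ hρ => ?_, ?_⟩
  · obtain ⟨g, q, hb, hg, hq⟩ := (isRadialSolution_scatSol hk z).exists_truncation hρ
    have hm : (g, q) ∈ (HTMS α).graph := hb.mem_graph_HTMS (by simpa [scatSol, scatSolDeriv] using h)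
    obtain ⟨g', rfl, rfl⟩ := (LinearPMap.mem_graph_iff _).1 hm
    refine ⟨g', ?_, ?_⟩
    · filter_upwards [ae_restrict_of_ae hg, ae_restrict_mem measurableSet_ball] with x h1 h2
      have h3 : ‖x‖ < ρ := by simpa using h2
      rw [h1, cut_of_nonpos (by linarith)]
      simp
    · filter_upwards [ae_restrict_of_ae hq, ae_restrict_mem measurableSet_ball] with x h1 h2
      have h3 : ‖x‖ < ρ := by simpa using h2
      rw [h1, cut_of_nonpos (by linarith), cutDefect_of_le h3.le]
      simp [mul_div_assoc]
  · refine tendsto_const_nhds.congr fun r => ?_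
    simp only [scatSol, add_div, div_div, sub_self, mul_zero]

/-- Green's formula on a shell, for an eigenfunction that is locally in the domain. -/
theorem integral_cutDefect_eq_zero {α : OnePoint ℝ} {k : ℝ} {V V₁ : ℝ → ℂ}
    (hV : IsRadialSolution k V V₁) (hα : RadialBC α (V 0) (V₁ 0))
    (c0 : ∀ r, conj (V r) = V r) (c1 : ∀ r, conj (V₁ r) = V₁ r) {T : ℝ} (hT : 0 < T)
    {w : ℝ → ℂ} {g : (HTMS α).domain}
    (hg : ∀ᵐ x ∂(volume.restrict (Metric.ball (0 : R3) (T + 2))), (g : L2) x = w ‖x‖)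
    (hq : ∀ᵐ x ∂(volume.restrict (Metric.ball (0 : R3) (T + 2))),
      (HTMS α g) x = (k : ℂ) ^ 2 * w ‖x‖) :
    IntervalIntegrable (fun r => cutDefect T V V₁ r * (r * w r)) volume T (T + 1) ∧
      ∫ r in T..(T + 1), cutDefect T V V₁ r * (r * w r) = 0 := by
  obtain ⟨g₀, q₀, hb, hg₀, hq₀⟩ := hV.exists_truncation hT
  have hsymm := HTMS_symm ((HTMS α).mem_graph g) (hb.mem_graph_HTMS hα)
  have cd : ∀ r, conj (cutDefect T V V₁ r) = cutDefect T V V₁ r := fun r => by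
    simp only [cutDefect, map_add, map_mul, map_ofNat, Complex.conj_ofReal, c0, c1]
  rw [L2.inner_def, L2.inner_def,
    ← integral_sub (L2.integrable_inner _ _) (L2.integrable_inner _ _)] at hsymm
  have hint := (L2.integrable_inner (𝕜 := ℂ) g₀ (HTMS α g)).sub
    (L2.integrable_inner (𝕜 := ℂ) q₀ (g : L2))
  -- The `k²` terms cancel and only the commutator remains. The radius `T + 2` contains the support
  -- of the truncated solution, so the unknown values of `g` further out do not matter.
  have e : ∀ᵐ x : R3, inner ℂ (g₀ x) ((HTMS α g) x) - inner ℂ (q₀ x) ((g : L2) x) =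
      (fun r : ℝ => cutDefect T V V₁ r * w r / (r : ℂ)) ‖x‖ := by
    have hg' := (ae_restrict_iff' measurableSet_ball).1 hg
    have hq' := (ae_restrict_iff' measurableSet_ball).1 hq
    filter_upwards [hg₀, hq₀, hg', hq'] with x h1 h2 h3 h4
    rw [h1, h2, RCLike.inner_apply, RCLike.inner_apply]
    simp only [map_div₀, map_mul, map_sub, map_pow, Complex.conj_ofReal, c0, cd]
    by_cases hx : ‖x‖ < T + 2
    · rw [h3 (by simpa using hx), h4 (by simpa using hx)]
      ring
    · rw [cutDefect_of_ge (by linarith), cut_of_one_le (by linarith)]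
      simp
  have hint' := (integrable_radial_iff (f := fun r : ℝ => cutDefect T V V₁ r * w r / (r : ℂ))).1
    (hint.congr e)
  have hval : ∀ r ∈ Set.Ioi (0 : ℝ), (r : ℂ) ^ 2 * (cutDefect T V V₁ r * w r / (r : ℂ)) =
      cutDefect T V V₁ r * (r * w r) := by
    intro r (hr : 0 < r)
    have : (r : ℂ) ≠ 0 := by exact_mod_cast hr.ne'
    field_simp
  rw [integral_congr_ae e,
    integral_radial (fun r : ℝ => cutDefect T V V₁ r * w r / (r : ℂ)),
    setIntegral_congr_fun measurableSet_Ioi hval] at hsymm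
  have hI := hint'.congr_fun hval measurableSet_Ioi
  have hsub : Set.Ioc T (T + 1) ⊆ Set.Ioi 0 := fun r hr => hT.trans hr.1
  refine ⟨(intervalIntegrable_iff_integrableOn_Ioc_of_le (by linarith)).2 (hI.mono_set hsub), ?_⟩
  rw [intervalIntegral.integral_of_le (by linarith),
    ← setIntegral_eq_of_subset_of_forall_sdiff_eq_zero measurableSet_Ioi hsub]
  · have hπ : (4 * Real.pi : ℂ) ≠ 0 :=
      mul_ne_zero (by norm_num) (by exact_mod_cast Real.pi_ne_zero)
    exact (mul_eq_zero.1 hsymm).resolve_left hπ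
  · intro r hr
    have : r ≤ T ∨ T + 1 ≤ r := by
      by_contra! hc
      exact hr.2 ⟨hc.1, hc.2.le⟩
    rcases this with h | h
    · rw [cutDefect_of_le h, zero_mul]
    · rw [cutDefect_of_ge h, zero_mul]

theorem IsRadialSolution.wronskian {k : ℝ} {V V₁ E E₁ : ℝ → ℂ} (hV : IsRadialSolution k V V₁)
    (hE : IsRadialSolution k E E₁) (r : ℝ) :
    V₁ r * E r - V r * E₁ r = V₁ 0 * E 0 - V 0 * E₁ 0 := by
  have hd : ∀ r, HasDerivAt (fun r => V₁ r * E r - V r * E₁ r) 0 r := fun r =>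
    (((hV.hasDerivAt₁ r).mul (hE.hasDerivAt r)).sub
      ((hV.hasDerivAt r).mul (hE.hasDerivAt₁ r))).congr_deriv (by ring)
  exact is_const_of_deriv_eq_zero (fun r => (hd r).differentiableAt) (fun r => (hd r).deriv) r 0

/-- The integrand is the derivative of `χ'VE + χ(V'E - VE')`, the Wronskian being constant. Between
`T` and `T + 1` the cut-off drops from `1` to `0`, and `χ'` vanishes at both ends. -/
theorem IsRadialSolution.integral_cutDefect_mul {k : ℝ} {V V₁ E E₁ : ℝ → ℂ}
    (hV : IsRadialSolution k V V₁) (hE : IsRadialSolution k E E₁) (T : ℝ) :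
    ∫ r in T..(T + 1), cutDefect T V V₁ r * E r = -(V₁ 0 * E 0 - V 0 * E₁ 0) := by
  have hd : ∀ r, HasDerivAt (fun r => ((deriv cut (r - T) : ℝ) : ℂ) * (V r * E r) +
      cut (r - T) * (V₁ r * E r - V r * E₁ r)) (cutDefect T V V₁ r * E r) r := fun r =>
    (((hasDerivAt_deriv_cut_sub T r).mul ((hV.hasDerivAt r).mul (hE.hasDerivAt r))).add
      ((hasDerivAt_cut_sub T r).mul (((hV.hasDerivAt₁ r).mul (hE.hasDerivAt r)).sub
      ((hV.hasDerivAt r).mul (hE.hasDerivAt₁ r))))).congr_deriv (by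
        simp only [cutDefect, Pi.mul_apply, Pi.sub_apply]; ring)
  rw [intervalIntegral.integral_eq_sub_of_hasDerivAt (fun r _ => hd r)
    (((hV.continuous_cutDefect T).mul hE.continuous).intervalIntegrable _ _),
    deriv_cut_of_one_le (by linarith), cut_of_one_le (by linarith),
    deriv_cut_of_nonpos (by linarith), cut_of_nonpos (by linarith), ← hV.wronskian hE T]
  push_cast
  ring

theorem exists_bound_cutDefect {V V₁ : ℝ → ℂ} {C : ℝ} (hC : ∀ r, ‖V r‖ ≤ C ∧ ‖V₁ r‖ ≤ C) :
    ∃ M, ∀ T, ∀ r ∈ Set.Icc T (T + 1), ‖cutDefect T V V₁ r‖ ≤ M := by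
  obtain ⟨M₁, h₁⟩ := (isCompact_Icc (a := (0 : ℝ)) (b := 1)).exists_bound_of_continuousOn
    cut_deriv_contDiff.continuous.continuousOn
  obtain ⟨M₂, h₂⟩ := (isCompact_Icc (a := (0 : ℝ)) (b := 1)).exists_bound_of_continuousOn
    cut_deriv2_contDiff.continuous.continuousOn
  refine ⟨2 * M₁ * C + M₂ * C, fun T r hr => ?_⟩
  have hm : r - T ∈ Set.Icc (0 : ℝ) 1 := ⟨by linarith [hr.1], by linarith [hr.2]⟩
  refine (norm_add_le _ _).trans ?_
  rw [norm_mul, norm_mul, norm_mul, Complex.norm_real, Complex.norm_real, Complex.norm_ofNat]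
  have hp₁ := (norm_nonneg _).trans (h₁ _ hm)
  have hp₂ := (norm_nonneg _).trans (h₂ _ hm)
  gcongr
  · exact h₁ _ hm
  · exact (hC r).2
  · exact h₂ _ hm
  · exact (hC r).1

/-- The commutator term integrates to zero against `r w(r)` and to minus the Wronskian with `V`
against the scattering solution. For large `T` the two functions differ by at most `ε` on the shell,
so the Wronskian has norm at most `Mε` with `M` independent of `T`. No regularity of `w` is needed.
-/
theorem IsSWaveAmplitude.radialBC {α : OnePoint ℝ} {k : ℝ} (hk : k ≠ 0) {z : ℂ}
    (h : IsSWaveAmplitude (HTMS α) k z) : RadialBC α z (1 + Complex.I * k * z) := by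
  obtain ⟨w, hw, has⟩ := h
  obtain ⟨V, V₁, hV, hα, c0, c1, ⟨C, hC⟩, hW⟩ := exists_real_solution α hk
  have hE := isRadialSolution_scatSol hk z
  obtain ⟨M, hM⟩ := exists_bound_cutDefect hC
  have hM0 : 0 ≤ M := (norm_nonneg _).trans (hM 0 0 ⟨le_rfl, by norm_num⟩)
  suffices hz : V₁ 0 * scatSol k z 0 - V 0 * scatSolDeriv k z 0 = 0 by
    simpa [scatSol, scatSolDeriv] using hW _ _ hz
  have hlim : ∀ ε : ℝ, 0 < ε → ‖V₁ 0 * scatSol k z 0 - V 0 * scatSolDeriv k z 0‖ ≤ M * ε := by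
    intro ε hε
    obtain ⟨T₀, hT₀⟩ := eventually_atTop.1 (has.eventually (Metric.ball_mem_nhds 0 hε))
    set T := max T₀ 1 with hTdef
    have hT : 0 < T := lt_of_lt_of_le one_pos (le_max_right _ _)
    obtain ⟨g, hg, hq⟩ := hw (T + 2) (by linarith)
    obtain ⟨i1, z1⟩ := integral_cutDefect_eq_zero hV hα c0 c1 hT hg hq
    have z2 := hV.integral_cutDefect_mul hE T
    have i2 : IntervalIntegrable (fun r => cutDefect T V V₁ r * scatSol k z r) volume T (T + 1) :=
      ((hV.continuous_cutDefect T).mul hE.continuous).intervalIntegrable _ _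
    have hs := intervalIntegral.integral_sub i1 i2
    rw [z1, z2, zero_sub, neg_neg] at hs
    rw [← hs]
    have hb := intervalIntegral.norm_integral_le_of_norm_le_const (a := T) (b := T + 1)
      (C := M * ε) (f := fun r => cutDefect T V V₁ r * (r * w r) -
        cutDefect T V V₁ r * scatSol k z r) (fun r hr => by
        rw [Set.uIoc_of_le (by linarith)] at hr
        have hr0 : (r : ℂ) ≠ 0 := by exact_mod_cast (hT.trans hr.1).ne'
        have h1 := hT₀ r ((le_max_left _ _).trans hr.1.le)
        have h2 : (r : ℂ) * (w r - (Complex.sin (k * r) / (k * r) +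
            z * Complex.exp (Complex.I * k * r) / r)) = r * w r - scatSol k z r := by
          have hk' : (k : ℂ) ≠ 0 := by exact_mod_cast hk
          rw [scatSol, mul_sub, mul_add, ← div_div, mul_div_cancel₀ _ hr0,
            mul_div_cancel₀ _ hr0]
        rw [h2, dist_zero_right] at h1
        rw [← mul_sub, norm_mul]
        exact mul_le_mul (hM T r ⟨hr.1.le, hr.2⟩) h1.le (norm_nonneg _) hM0)
    simpa using hb
  have ht : Tendsto (fun ε : ℝ => M * ε) (𝓝[>] 0) (𝓝 0) := by
    have : Tendsto (fun ε : ℝ => M * ε) (𝓝 0) (𝓝 (M * 0)) := tendsto_id.const_mul M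
    rw [mul_zero] at this
    exact this.mono_left nhdsWithin_le_nhds
  exact norm_le_zero_iff.1 (ge_of_tendsto ht (by
    filter_upwards [self_mem_nhdsWithin] with ε hε using hlim ε hε))

theorem isSWaveAmplitude_iff {α : OnePoint ℝ} {k : ℝ} (hk : k ≠ 0) {z : ℂ} :
    IsSWaveAmplitude (HTMS α) k z ↔ RadialBC α z (1 + Complex.I * k * z) :=
  ⟨fun h => h.radialBC hk, isSWaveAmplitude_of_radialBC hk⟩

/-- The imaginary part is `-k`, so for real `k ≠ 0` no amplitude has a pole. -/
theorem scattering_denominator_ne_zero (t : ℝ) {k : ℝ} (hk : k ≠ 0) :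
    (4 * Real.pi * t - Complex.I * k : ℂ) ≠ 0 := by
  intro h
  have := congrArg Complex.im h
  simp [hk] at this

theorem isSWaveAmplitude_coe_iff (t : ℝ) {k : ℝ} (hk : 0 < k) (z : ℂ) :
    IsSWaveAmplitude (HTMS t) k z ↔ z = (4 * Real.pi * t - Complex.I * k : ℂ)⁻¹ := by
  rw [isSWaveAmplitude_iff hk.ne', ← one_div,
    eq_div_iff (scattering_denominator_ne_zero t hk.ne')]
  change 1 + Complex.I * k * z = 4 * Real.pi * t * z ↔ _
  constructor <;> intro h <;> linear_combination -h

theorem tendsto_scattering_denominator (t : ℝ) :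
    Tendsto (fun k : ℝ => (4 * Real.pi * t - Complex.I * k : ℂ)) (𝓝[>] 0)
      (𝓝 (4 * Real.pi * t)) := by
  have h : Continuous fun k : ℝ => (4 * Real.pi * t - Complex.I * k : ℂ) := by fun_prop
  have h0 := h.tendsto 0
  simp only [Complex.ofReal_zero, mul_zero, sub_zero] at h0
  exact h0.mono_left nhdsWithin_le_nhds

theorem hasScatteringLength_coe {t : ℝ} (ht : t ≠ 0) :
    HasScatteringLength (HTMS t) ((-(4 * Real.pi * t)⁻¹ : ℝ) : OnePoint ℝ) := by
  refine ⟨_, fun k hk z => isSWaveAmplitude_coe_iff t hk z, ?_⟩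
  have hne : (4 * Real.pi * t : ℂ) ≠ 0 := by
    exact_mod_cast mul_ne_zero (mul_ne_zero four_ne_zero Real.pi_ne_zero) ht
  have h := ((tendsto_scattering_denominator t).inv₀ hne).neg
  have h2 := (OnePoint.continuous_coe.tendsto _).comp h
  rw [OnePoint.map_some]
  push_cast
  exact h2

theorem hasScatteringLength_zero :
    HasScatteringLength (HTMS ((0 : ℝ) : OnePoint ℝ)) OnePoint.infty := by
  refine ⟨_, fun k hk z => isSWaveAmplitude_coe_iff 0 hk z, ?_⟩
  rw [OnePoint.map_infty]
  -- The denominator tends to `0` without vanishing, so its inverse leaves every compact set, which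
  -- is convergence to the point at infinity.
  have h1 : Tendsto (fun k : ℝ => -(4 * Real.pi * (0 : ℝ) - Complex.I * k : ℂ)) (𝓝[>] 0)
      (𝓝[≠] 0) := by
    refine tendsto_nhdsWithin_iff.2 ⟨?_, ?_⟩
    · simpa using (tendsto_scattering_denominator 0).neg
    · filter_upwards [self_mem_nhdsWithin] with k hk
      exact neg_ne_zero.2 (scattering_denominator_ne_zero 0 (ne_of_gt hk))
  have h2 := tendsto_inv₀_nhdsNE_zero.comp h1
  rw [Metric.cobounded_eq_cocompact, ← coclosedCompact_eq_cocompact] at h2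
  refine (OnePoint.tendsto_coe_infty.comp h2).congr fun k => ?_
  simp only [Function.comp_apply, inv_neg]

theorem hasScatteringLength_infty :
    HasScatteringLength (HTMS OnePoint.infty) ((0 : ℝ) : OnePoint ℝ) := by
  refine ⟨fun _ => 0, fun k hk z => isSWaveAmplitude_iff hk.ne', ?_⟩
  simp

end PointInteraction

end

/-! ### The main theorem -/

theorem mainTheorem2 :
    -- equivalent forms of the TMS condition in terms of the decomposition of `g ∈ D(H̊*)`
    (∀ lam : ℝ, 0 < lam → ∀ g ∈ PointInteraction.HringAdj.domain,
      ∀ f ∈ PointInteraction.Hring.domain, ∀ η ξ : ℂ,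
      (∀ᵐ p : PointInteraction.R3, PointInteraction.hat g p = PointInteraction.hat f p +
        η / ((‖p‖ ^ 2 + lam : ℝ) : ℂ) ^ 2 + ξ / ((‖p‖ ^ 2 + lam : ℝ) : ℂ)) →
      (∀ α : ℝ,
        (g ∈ (PointInteraction.HTMS α).domain ↔ PointInteraction.TMSAsymptotics α ξ g) ∧
        (PointInteraction.TMSAsymptotics α ξ g ↔
          8 * (Real.pi : ℂ) ^ 3 * α * ξ =
            -2 * (Real.pi : ℂ) ^ 2 * (√lam : ℝ) * ξ + (Real.pi : ℂ) ^ 2 / (√lam : ℝ) * η) ∧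
        (PointInteraction.TMSAsymptotics α ξ g ↔
          η = ((2 * √lam * (4 * Real.pi * α + √lam) : ℝ) : ℂ) * ξ)) ∧
      (g ∈ (PointInteraction.HTMS OnePoint.infty).domain ↔ ξ = 0)) ∧
    -- the TMS condition selects exactly the extension with `τ = 2 √λ (4 π α + √λ)`
    (∀ lam : ℝ, 0 < lam → ∀ α : OnePoint ℝ,
      PointInteraction.HTMS α = PointInteraction.Hext lam
        (OnePoint.map (fun t : ℝ => 2 * √lam * (4 * Real.pi * t + √lam)) α)) ∧
    -- its scattering length is `-(4 π α)⁻¹`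
    (∀ α : ℝ, α ≠ 0 → PointInteraction.HasScatteringLength (PointInteraction.HTMS α)
      ((-(4 * Real.pi * α)⁻¹ : ℝ) : OnePoint ℝ)) ∧
    PointInteraction.HasScatteringLength (PointInteraction.HTMS ((0 : ℝ) : OnePoint ℝ))
      OnePoint.infty ∧
    PointInteraction.HasScatteringLength (PointInteraction.HTMS OnePoint.infty)
      ((0 : ℝ) : OnePoint ℝ) ∧
    -- the TMS operators are exactly the self-adjoint extensions of `H̊`
    (∀ H : PointInteraction.L2 →ₗ.[ℂ] PointInteraction.L2,
      (PointInteraction.Hring ≤ H ∧ IsSelfAdjoint H) ↔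
        ∃ α : OnePoint ℝ, H = PointInteraction.HTMS α) := by
  refine ⟨fun lam hlam g hg f hf η ξ h => ?_, fun lam hlam α => ?_, fun α hα =>
    PointInteraction.hasScatteringLength_coe hα, PointInteraction.hasScatteringLength_zero,
    PointInteraction.hasScatteringLength_infty, fun H => ⟨fun ⟨h1, h2⟩ =>
      PointInteraction.exists_eq_HTMS h1 h2, ?_⟩⟩
  · rw [PointInteraction.Hring_domain] at hf
    have hd : PointInteraction.IsDecomposition lam f η ξ g := h
    refine ⟨fun α => hd.domain_iff hlam hg hf α, ?_⟩
    rw [PointInteraction.mem_HTMS_infty_domain,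
      ← (hd.hasRegularPart hlam hf).mem_tmsInfty_iff]
    exact and_iff_left hg
  · induction α using OnePoint.rec with
    | infty => exact PointInteraction.HTMS_infty_eq_freeHamiltonian
    | coe t => exact PointInteraction.HTMS_coe_eq_Hext hlam t
  · rintro ⟨α, rfl⟩
    exact ⟨PointInteraction.Hring_le_HTMS α, PointInteraction.isSelfAdjoint_HTMS α⟩
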